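/- **Setting.** Let $\mathcal P\subset\mathbf R^s$, let $\mathcal V=\prod_k[\underline\nu_k,\bar\nu_k]$, and consider the LPV plant with delayed input $$\dot x_p=A_px_p+B_{p1}d+B_{p2}\,u(t-\tau),\quad e=C_{p1}x_p+D_{p11}d+D_{p12}\,u(t-\tau),\quad y=C_{p2}x_p+D_{p21}d,$$ with coefficients continuous in $\rho\in\mathcal P$, $D_{p12}(\rho)$ of full column rank and $D_{p21}(\rho)$ of full row rank. Put $w=u-u(\cdot-\tau)$ (with $u=0$ for negative times), and let $$\dot x_\psi=A_\psi x_\psi+B_{\psi1}u+B_{\psi2}w,\quad x_\psi(0)=0,\quad z_{1,k}=C_{\psi,k}x_\psi+D_{\psi1,k}u+D_{\psi2,k}w,\quad z_{2,k}=w\quad(k=1,\dots,N_\lambda)$$ be realizations of filters. Stack $z_1=(z_{1,k})_k$ and likewise $C_\psi,D_{\psi1},D_{\psi2}$. With $x_{aug}=(x_p,x_\psi)\in\mathbf R^{n_{aug}}$ set $$A_{aug}=\begin{bmatrix}A_p&0\\0&A_\psi\end{bmatrix},\ B_{aug0}=\begin{bmatrix}-B_{p2}\\B_{\psi2}\end{bmatrix},\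 B_{aug1}=\begin{bmatrix}B_{p1}\\0\end{bmatrix},\ B_{aug2}=\begin{bmatrix}B_{p2}\\B_{\psi1}\end{bmatrix},$$ $C_{aug0}=[0\ \ C_\psi]$, $C_{aug1}=[C_{p1}\ \ 0]$, $C_{aug2}=[C_{p2}\ \ 0]$. Write ${\rm He}\,Z=Z+Z^T$; $\star$ denotes entries given by symmetry. **Hypothesis.** Let $\gamma>0$, let $R,S$ be continuously differentiable symmetric matrix functions, positive definite on $\mathcal P$, of size $n_{aug}$; let $X_k$ ($k\le N_\lambda$) be continuous positive definite and $X$ continuous on $\mathcal P$, of size $n_u$. Put $\Lambda={\rm diag}\{X_1,\dots,X_{N_\lambda}\}$ and $\Theta=\sum_k(X+X^T-X_k)$. Suppose that for all $\rho\in\mathcal P$ and all vertices $\nu$ of $\mathcal V$ (with $\partial_\nu=\sum_k\nu_k\partial/\partial\rho_k$) $$\mathcal N_R^T\begin{bmatrix}{\rm He}\{A_{aug}R\}-\partial_\nu R&\star&\star&\star&\star\\X^TB_{aug0}^T&-\Theta&\star&\star&\star\\B_{aug1}^T&0&-\gamma I&\star&\star\\C_{aug0}R&D_{\psi2}X&0&-\Lambda&\star\\C_{aug1}R&-D_{p12}X&D_{p11}&0&-\gamma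 I\end{bmatrix}\mathcal N_R<0,\qquad \mathcal N_S^T\begin{bmatrix}{\rm He}\{SA_{aug}\}+\partial_\nu S&\star&\star&\star\\C_{aug0}&-\Lambda&\star&\star\\C_{aug1}&0&-\gamma I&\star\\B_{aug1}^TS&0&D_{p11}^T&-\gamma I\end{bmatrix}\mathcal N_S<0,$$ and $\begin{bmatrix}R&I\\I&S\end{bmatrix}>0$, where the columns of $\mathcal N_R$, $\mathcal N_S$ are bases of $\ker[B_{aug2}^T\ 0\ 0\ D_{\psi1}^T\ D_{p12}^T]$ and $\ker[C_{aug2}\ 0\ 0\ D_{p21}]$. **Procedure.** *Step 1.* Choose $\hat D_{c1}(\rho),\hat D_{c2}(\rho)$ with $$\Pi=-\begin{bmatrix}-\Theta&\star&\star&\star\\0&-\gamma I&\star&\star\\D_{\psi2}X+D_{\psi1}\hat D_{c2}&D_{\psi1}\hat D_{c1}D_{p21}&-\Lambda&\star\\-D_{p12}X+D_{p12}\hat D_{c2}&D_{p11}+D_{p12}\hat D_{c1}D_{p21}&0&-\gamma I\end{bmatrix}>0\quad\text{on }\mathcal P.$$ *Step 2.* With $V=\begin{bmatrix}I&0&0&0\\0&D_{p21}&0&0\end{bmatrix}$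 and $U=[0\ \ 0\ \ D_{\psi1}^T\ \ D_{p12}^T]$, solve $$\begin{bmatrix}0&V\\V^T&-\Pi\end{bmatrix}\begin{bmatrix}\hat B_{c2}^T\\\hat B_{c1}^T\\\Xi_1\end{bmatrix}=-\begin{bmatrix}0\\C_{aug2}\\0\\B_{aug1}^TS\\C_{aug0}+D_{\psi1}\hat D_{c1}C_{aug2}\\C_{aug1}+D_{p12}\hat D_{c1}C_{aug2}\end{bmatrix},\qquad \begin{bmatrix}0&U\\U^T&-\Pi\end{bmatrix}\begin{bmatrix}\hat C_c\\\Xi_2\end{bmatrix}=-\begin{bmatrix}B_{aug2}^T\\X^TB_{aug0}^T+\hat D_{c2}^TB_{aug2}^T\\B_{aug1}^T+D_{p21}^T\hat D_{c1}^TB_{aug2}^T\\C_{aug0}R\\C_{aug1}R\end{bmatrix}$$ for $\hat B_{c1},\hat B_{c2},\hat C_c$ (and auxiliary $\Xi_1,\Xi_2$). *Step 3.* Choose $M,N$ with $MN^T=I-RS$ (near $\mathcal P$) and $M$ continuously differentiable, and set $$\hat A_c(\rho,\dot\rho)=-A_{aug}^T-C_{aug2}^T\hat D_{c1}^TB_{aug2}^T+S\frac{dR}{dt}+N\frac{dM^T}{dt}-L_2\Pi^{-1}L_1^T,$$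 where $d/dt=\sum_k\dot\rho_k\partial/\partial\rho_k$ and $$[L_1^T\ \ L_2^T]=\begin{bmatrix}X^TB_{aug0}^T+\hat D_{c2}^TB_{aug2}^T&\hat B_{c2}^T\\B_{aug1}^T+D_{p21}^T\hat D_{c1}^TB_{aug2}^T&B_{aug1}^TS+D_{p21}^T\hat B_{c1}^T\\C_{aug0}R+D_{\psi1}\hat C_c&C_{aug0}+D_{\psi1}\hat D_{c1}C_{aug2}\\C_{aug1}R+D_{p12}\hat C_c&C_{aug1}+D_{p12}\hat D_{c1}C_{aug2}\end{bmatrix}.$$ *Step 4.* Set $$\begin{bmatrix}A_c&B_{c2}&B_{c1}\\C_c&D_{c2}&D_{c1}\end{bmatrix}=\begin{bmatrix}N&SB_{aug2}\\0&I\end{bmatrix}^{-1}\begin{bmatrix}\hat A_c-SA_{aug}R&\hat B_{c2}-SB_{aug0}X&\hat B_{c1}\\\hat C_c&\hat D_{c2}&\hat D_{c1}\end{bmatrix}\begin{bmatrix}M^T&0&0\\0&X&0\\C_{aug2}R&0&I\end{bmatrix}^{-1}.$$ **Conclusion.** (a) Every step can be carried out: Step 1 has solutions, even continuous ones on $\mathcal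 P$; after any choice in Step 1 the equations of Step 2 have exactly one solution $(\hat B_{c1},\hat B_{c2})$, $\hat C_c$; factors $M,N$ exist; and for any such factors the two matrices inverted in Step 4 are nonsingular. So every choice in Step 1 and of $M,N$ leads to a controller of order $n_c=n_{aug}$, $$\dot x_c=A_c(\rho,\dot\rho)x_c+B_{c1}y+B_{c2}w,\qquad u=C_cx_c+D_{c1}y+D_{c2}w,\qquad w=u-u(\cdot-\tau).$$ (b) For every controller so obtained, $P=\begin{bmatrix}S&N\\N^T&-N^TRM^{-T}\end{bmatrix}$ satisfies, for all $\rho\in\mathcal P$ and $\dot\rho\in\mathcal V$, $P>0$, $$\begin{bmatrix}{\rm He}\{PA_{cl}\}+\dot P&\star&\star&\star&\star\\X^TB_{cl1}^TP&-\Theta&\star&\star&\star\\B_{cl2}^TP&0&-\gamma I&\star&\star\\C_{cl1}&D_{cl11}X&D_{cl12}&-\Lambda&\star\\C_{cl2}&D_{cl21}X&D_{cl22}&0&-\gamma I\end{bmatrix}<0$$ and $$\begin{bmatrix}{\rm He}\{PA_{cl}\}+\dot P&\star&\star\\B_{cl1}^TP&0&\star\\B_{cl2}^TP&0&-\gamma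 I\end{bmatrix}+\frac1\gamma\begin{bmatrix}C_{cl2}^T\\D_{cl21}^T\\D_{cl22}^T\end{bmatrix}\begin{bmatrix}C_{cl2}^T\\D_{cl21}^T\\D_{cl22}^T\end{bmatrix}^T+\begin{bmatrix}C_{cl1}^T\\D_{cl11}^T\\D_{cl12}^T\end{bmatrix}\Lambda^{-1}\begin{bmatrix}C_{cl1}^T\\D_{cl11}^T\\D_{cl12}^T\end{bmatrix}^T-\begin{bmatrix}0\\I\\0\end{bmatrix}\sum_kX_k^{-1}\begin{bmatrix}0\\I\\0\end{bmatrix}^T<0,$$ where $\dot x_{cl}=A_{cl}x_{cl}+B_{cl1}w+B_{cl2}d$, $z_1=C_{cl1}x_{cl}+D_{cl11}w+D_{cl12}d$, $e=C_{cl2}x_{cl}+D_{cl21}w+D_{cl22}d$ is the closed loop of plant, filters and controller, with state $x_{cl}=(x_{aug},x_c)$. (c) Let in addition $\hat D_{c1},\hat D_{c2}$ be continuous, and suppose that the delay operator satisfies the integral quadratic constraints $$\int_0^T\big(z_{1,k}^TX_k(\rho)^{-1}z_{1,k}-w^TX_k(\rho)^{-1}w\big)dt\ge0\qquad(k\le N_\lambda,\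 T\ge0)$$ for all delays $\tau$ with $0\le\tau\le\bar\tau$, $|\dot\tau|\le r$, all parameter trajectories with $\rho(t)\in\mathcal P$, $\dot\rho(t)\in\mathcal V$, and all locally square-integrable $u$ for which $w$ is also locally square integrable. Then, over all these delays and all parameter trajectories with values in a given compact subset of $\mathcal P$ (which is $\mathcal P$ itself if $\mathcal P$ is compact), the closed loop is asymptotically stable (for $d=0$, $|x_{cl}(t)|\le c\,|x_{cl}(0)|$ with a common constant $c$, and $x_{cl}(t)\to0$), and its $\mathcal L_2$ gain from $d$ to $e$ is less than $\gamma$: there is $\gamma'<\gamma$ with $\int_0^T|e|^2dt\le\gamma'^2\int_0^T|d|^2dt$ for all $T\ge0$ whenever $x_{cl}(0)=0$. -/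

import Mathlib

open Matrix MeasureTheory Filter Topology

namespace DelayLPV

noncomputable section

/-! ## Block-matrix conventions -/

/-- `He X = X + Xᵀ`. -/
def He {n : Type} (X : Matrix n n ℝ) : Matrix n n ℝ := X + Xᵀ

/-- The symmetric block matrix `[[A, ⋆], [B, D]]`, where `⋆ = Bᵀ`. -/
def symBlock {m n : Type} (A : Matrix m m ℝ) (B : Matrix n m ℝ) (D : Matrix n n ℝ) :
    Matrix (m ⊕ n) (m ⊕ n) ℝ :=
  fromBlocks A Bᵀ B D

/-- `𝒩ᵀ Q 𝒩 < 0`, where the columns of `𝒩` form a basis of the kernel of `K`: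
the quadratic form of `Q` is negative on the nonzero vectors of that kernel. -/
def NegDefOnKer {n k : Type} [Fintype n] (K : Matrix k n ℝ) (Q : Matrix n n ℝ) : Prop :=
  ∀ v : n → ℝ, v ≠ 0 → K *ᵥ v = 0 → v ⬝ᵥ (Q *ᵥ v) < 0

/-- The directional derivative `∑ k, ν k • ∂F/∂ρ_k` at `ρ` of a matrix function `F`.  Along a
parameter trajectory it is `dF/dt`, with `ν = dρ/dt`. -/
def dirDeriv {s : ℕ} {m n : Type} (F : (Fin s → ℝ) → Matrix m n ℝ) (ρ ν : Fin s → ℝ) :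
    Matrix m n ℝ :=
  Matrix.of fun i j => fderiv ℝ (fun q => F q i j) ρ ν

/-- `F` is continuously differentiable (on a neighbourhood of each point of `Ω`). -/
def C1On {s : ℕ} {m n : Type} (F : (Fin s → ℝ) → Matrix m n ℝ) (Ω : Set (Fin s → ℝ)) : Prop :=
  ∀ ρ ∈ Ω, ∀ i j, ContDiffAt ℝ 1 (fun q => F q i j) ρ

/-! ## Plant, multiplier filter, augmented plant -/

/-- Coefficients of the LPV plant with delayed input `v = u(t - τ(t))`:
`ẋ = A x + B1 d + B2 v`, `e = C1 x + D11 d + D12 v`, `y = C2 x + D21 d`. -/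
structure Plant (s np nd nu ne ny : ℕ) where
  A : (Fin s → ℝ) → Matrix (Fin np) (Fin np) ℝ
  B1 : (Fin s → ℝ) → Matrix (Fin np) (Fin nd) ℝ
  B2 : (Fin s → ℝ) → Matrix (Fin np) (Fin nu) ℝ
  C1 : (Fin s → ℝ) → Matrix (Fin ne) (Fin np) ℝ
  D11 : (Fin s → ℝ) → Matrix (Fin ne) (Fin nd) ℝ
  D12 : (Fin s → ℝ) → Matrix (Fin ne) (Fin nu) ℝ
  C2 : (Fin s → ℝ) → Matrix (Fin ny) (Fin np) ℝ
  D21 : (Fin s → ℝ) → Matrix (Fin ny) (Fin nd) ℝ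

/-- Continuity of the coefficients on `Ω`; `D12` has full column rank, `D21` full row rank. -/
structure Plant.Regular {s np nd nu ne ny : ℕ} (G : Plant s np nd nu ne ny)
    (Ω : Set (Fin s → ℝ)) : Prop where
  A : ContinuousOn G.A Ω
  B1 : ContinuousOn G.B1 Ω
  B2 : ContinuousOn G.B2 Ω
  C1 : ContinuousOn G.C1 Ω
  D11 : ContinuousOn G.D11 Ω
  D12 : ContinuousOn G.D12 Ω
  C2 : ContinuousOn G.C2 Ω
  D21 : ContinuousOn G.D21 Ω
  rank_D12 : ∀ ρ ∈ Ω, (G.D12 ρ).rank = nu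
  rank_D21 : ∀ ρ ∈ Ω, (G.D21 ρ).rank = ny

/-- Realization of the filters `Ψ_k`, `k < L`, with common state `x`:
`ẋ = A x + Bu u + Bw w`, `z_{1,k} = C k x + Du k u + Dw k w`, `z_{2,k} = w`. -/
structure IQCFilter (nψ nu L : ℕ) where
  A : Matrix (Fin nψ) (Fin nψ) ℝ
  Bu : Matrix (Fin nψ) (Fin nu) ℝ
  Bw : Matrix (Fin nψ) (Fin nu) ℝ
  C : Fin L → Matrix (Fin nu) (Fin nψ) ℝ
  Du : Fin L → Matrix (Fin nu) (Fin nu) ℝ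
  Dw : Fin L → Matrix (Fin nu) (Fin nu) ℝ

/-- Stacking of the blocks `T k` on top of each other. -/
def stack {m n l : Type} (T : l → Matrix m n ℝ) : Matrix (m × l) n ℝ :=
  Matrix.of fun p j => T p.2 p.1 j

/-- Coefficients, at one parameter value, of the augmented plant
`ẋ = A x + B0 w + B1 d + B2 u`, `z_1 = C0 x + Dψ2 w + Dψ1 u` (all `z_{1,k}` stacked),
`e = C1 x - D12 w + D11 d + D12 u`, `y = C2 x + D21 d`. -/
structure AugPlant (n d m e y l : Type) where
  A : Matrix n n ℝ
  B0 : Matrix n m ℝ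
  B1 : Matrix n d ℝ
  B2 : Matrix n m ℝ
  C0 : Matrix (m × l) n ℝ
  Dψ1 : Matrix (m × l) m ℝ
  Dψ2 : Matrix (m × l) m ℝ
  C1 : Matrix e n ℝ
  D11 : Matrix e d ℝ
  D12 : Matrix e m ℝ
  C2 : Matrix y n ℝ
  D21 : Matrix y d ℝ

/-- The augmented plant, with state `(x_p, x_ψ)`. -/
def augment {s np nψ nd nu ne ny L : ℕ} (G : Plant s np nd nu ne ny) (F : IQCFilter nψ nu L)
    (ρ : Fin s → ℝ) :
    AugPlant (Fin np ⊕ Fin nψ) (Fin nd) (Fin nu) (Fin ne) (Fin ny) (Fin L) where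
  A := fromBlocks (G.A ρ) 0 0 F.A
  B0 := fromRows (-G.B2 ρ) F.Bw
  B1 := fromRows (G.B1 ρ) 0
  B2 := fromRows (G.B2 ρ) F.Bu
  C0 := fromCols 0 (stack F.C)
  Dψ1 := stack F.Du
  Dψ2 := stack F.Dw
  C1 := fromCols (G.C1 ρ) 0
  D11 := G.D11 ρ
  D12 := G.D12 ρ
  C2 := fromCols (G.C2 ρ) 0
  D21 := G.D21 ρ

/-! ## Synthesis inequalities -/

section Pointwise

variable {n d m e y l : Type}
  [Fintype n] [DecidableEq n] [Fintype d] [DecidableEq d] [Fintype m] [DecidableEq m]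
  [Fintype e] [DecidableEq e] [Fintype y] [DecidableEq y] [Fintype l] [DecidableEq l]

/-- The blocks `(w, d, z, e)` of the closed-loop inequality, as a function of the transformed
feedthrough matrices `D1 = D̂_{c1}`, `D2 = D̂_{c2}`. -/
def feedBlock (a : AugPlant n d m e y l) (γ : ℝ) (X : Matrix m m ℝ) (Xk : l → Matrix m m ℝ)
    (D1 : Matrix m y ℝ) (D2 : Matrix m m ℝ) :
    Matrix (m ⊕ (d ⊕ ((m × l) ⊕ e))) (m ⊕ (d ⊕ ((m × l) ⊕ e))) ℝ :=
  symBlock (-∑ k, (X + Xᵀ - Xk k))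
    (fromRows 0 (fromRows (a.Dψ2 * X + a.Dψ1 * D2) (-(a.D12 * X) + a.D12 * D2)))
    (symBlock (-(γ • 1)) (fromRows (a.Dψ1 * D1 * a.D21) (a.D11 + a.D12 * D1 * a.D21))
      (symBlock (-blockDiagonal Xk) 0 (-(γ • 1))))

/-- Step 1: the matrix `Π`. -/
def PiMat (a : AugPlant n d m e y l) (γ : ℝ) (X : Matrix m m ℝ) (Xk : l → Matrix m m ℝ)
    (D1 : Matrix m y ℝ) (D2 : Matrix m m ℝ) :
    Matrix (m ⊕ (d ⊕ ((m × l) ⊕ e))) (m ⊕ (d ⊕ ((m × l) ⊕ e))) ℝ :=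
  -feedBlock a γ X Xk D1 D2

/-- The matrix of the first synthesis inequality, blocks `(x, w, d, z, e)`; `dR` is the derivative
of `R` in the direction of the parameter rate. -/
def lmiR (a : AugPlant n d m e y l) (γ : ℝ) (R dR : Matrix n n ℝ) (X : Matrix m m ℝ)
    (Xk : l → Matrix m m ℝ) :
    Matrix (n ⊕ (m ⊕ (d ⊕ ((m × l) ⊕ e)))) (n ⊕ (m ⊕ (d ⊕ ((m × l) ⊕ e)))) ℝ :=
  symBlock (He (a.A * R) - dR)
    (fromRows (Xᵀ * a.B0ᵀ) (fromRows a.B1ᵀ (fromRows (a.C0 * R) (a.C1 * R))))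
    (feedBlock a γ X Xk 0 0)

/-- `𝒩_R` spans the kernel of `[B2ᵀ 0 0 Dψ1ᵀ D12ᵀ]`. -/
def kerR (a : AugPlant n d m e y l) : Matrix m (n ⊕ (m ⊕ (d ⊕ ((m × l) ⊕ e)))) ℝ :=
  fromCols a.B2ᵀ (fromCols 0 (fromCols 0 (fromCols a.Dψ1ᵀ a.D12ᵀ)))

/-- The matrix of the second synthesis inequality, blocks `(x, z, e, d)`. -/
def lmiS (a : AugPlant n d m e y l) (γ : ℝ) (S dS : Matrix n n ℝ) (Xk : l → Matrix m m ℝ) :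
    Matrix (n ⊕ ((m × l) ⊕ (e ⊕ d))) (n ⊕ ((m × l) ⊕ (e ⊕ d))) ℝ :=
  symBlock (He (S * a.A) + dS) (fromRows a.C0 (fromRows a.C1 (a.B1ᵀ * S)))
    (symBlock (-blockDiagonal Xk) 0 (symBlock (-(γ • 1)) a.D11ᵀ (-(γ • 1))))

/-- `𝒩_S` spans the kernel of `[C2 0 0 D21]`. -/
def kerS (a : AugPlant n d m e y l) : Matrix y (n ⊕ ((m × l) ⊕ (e ⊕ d))) ℝ :=
  fromCols a.C2 (fromCols 0 (fromCols 0 a.D21))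

/-! ## Pointwise steps of the reconstruction -/

/-- Controller gains at one parameter value (and rate), or their transformed versions (with hats):
`ẋ_c = A x_c + B1 y + B2 w`, `u = C x_c + D1 y + D2 w`. -/
structure Gains (n m y : Type) where
  A : Matrix n n ℝ
  B1 : Matrix n y ℝ
  B2 : Matrix n m ℝ
  C : Matrix m n ℝ
  D1 : Matrix m y ℝ
  D2 : Matrix m m ℝ

/-- The matrix `[[A, B2, B1], [C, D2, D1]]`. -/
def Gains.toMatrix (g : Gains n m y) : Matrix (n ⊕ m) (n ⊕ (m ⊕ y)) ℝ :=
  fromBlocks g.A (fromCols g.B2 g.B1) g.C (fromCols g.D2 g.D1)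

/-- Step 2, first equation, for `B1 = B̂_{c1}`, `B2 = B̂_{c2}`; `Ξ` is the entry `⋆`. -/
def EqB (a : AugPlant n d m e y l) (γ : ℝ) (S : Matrix n n ℝ) (X : Matrix m m ℝ)
    (Xk : l → Matrix m m ℝ) (D1 : Matrix m y ℝ) (D2 : Matrix m m ℝ)
    (B1 : Matrix n y ℝ) (B2 : Matrix n m ℝ) : Prop :=
  let V : Matrix (m ⊕ y) (m ⊕ (d ⊕ ((m × l) ⊕ e))) ℝ :=
    fromRows (fromCols 1 0) (fromCols 0 (fromCols a.D21 0))
  ∃ Ξ : Matrix (m ⊕ (d ⊕ ((m × l) ⊕ e))) n ℝ,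
    fromBlocks 0 V Vᵀ (-PiMat a γ X Xk D1 D2) * fromRows (fromRows B2ᵀ B1ᵀ) Ξ =
      -fromRows (fromRows 0 a.C2)
        (fromRows 0 (fromRows (a.B1ᵀ * S)
          (fromRows (a.C0 + a.Dψ1 * D1 * a.C2) (a.C1 + a.D12 * D1 * a.C2))))

/-- Step 2, second equation, for `C = Ĉ_c`; `Ξ` is the entry `⋆`. -/
def EqC (a : AugPlant n d m e y l) (γ : ℝ) (R : Matrix n n ℝ) (X : Matrix m m ℝ)
    (Xk : l → Matrix m m ℝ) (D1 : Matrix m y ℝ) (D2 : Matrix m m ℝ) (C : Matrix m n ℝ) : Prop :=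
  let U : Matrix m (m ⊕ (d ⊕ ((m × l) ⊕ e))) ℝ :=
    fromCols 0 (fromCols 0 (fromCols a.Dψ1ᵀ a.D12ᵀ))
  ∃ Ξ : Matrix (m ⊕ (d ⊕ ((m × l) ⊕ e))) n ℝ,
    fromBlocks 0 U Uᵀ (-PiMat a γ X Xk D1 D2) * fromRows C Ξ =
      -fromRows a.B2ᵀ
        (fromRows (Xᵀ * a.B0ᵀ + D2ᵀ * a.B2ᵀ) (fromRows (a.B1ᵀ + a.D21ᵀ * D1ᵀ * a.B2ᵀ)
          (fromRows (a.C0 * R) (a.C1 * R))))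

/-- `L₁ᵀ` of Step 3. -/
def L1T (a : AugPlant n d m e y l) (R : Matrix n n ℝ) (X : Matrix m m ℝ) (h : Gains n m y) :
    Matrix (m ⊕ (d ⊕ ((m × l) ⊕ e))) n ℝ :=
  fromRows (Xᵀ * a.B0ᵀ + h.D2ᵀ * a.B2ᵀ) (fromRows (a.B1ᵀ + a.D21ᵀ * h.D1ᵀ * a.B2ᵀ)
    (fromRows (a.C0 * R + a.Dψ1 * h.C) (a.C1 * R + a.D12 * h.C)))

/-- `L₂ᵀ` of Step 3. -/
def L2T (a : AugPlant n d m e y l) (S : Matrix n n ℝ) (h : Gains n m y) :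
    Matrix (m ⊕ (d ⊕ ((m × l) ⊕ e))) n ℝ :=
  fromRows h.B2ᵀ (fromRows (a.B1ᵀ * S + a.D21ᵀ * h.B1ᵀ)
    (fromRows (a.C0 + a.Dψ1 * h.D1 * a.C2) (a.C1 + a.D12 * h.D1 * a.C2)))

/-- Step 3: the formula for `Â_c`; `dR`, `dM` are the time derivatives of `R`, `M`. -/
def EqA (a : AugPlant n d m e y l) (γ : ℝ) (R S dR N dM : Matrix n n ℝ) (X : Matrix m m ℝ)
    (Xk : l → Matrix m m ℝ) (h : Gains n m y) : Prop :=
  h.A = -a.Aᵀ - a.C2ᵀ * h.D1ᵀ * a.B2ᵀ + S * dR + N * dMᵀ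
    - (L2T a S h)ᵀ * (PiMat a γ X Xk h.D1 h.D2)⁻¹ * L1T a R X h

/-- The left matrix that is inverted in Step 4. -/
def leftT (a : AugPlant n d m e y l) (S N : Matrix n n ℝ) : Matrix (n ⊕ m) (n ⊕ m) ℝ :=
  fromBlocks N (S * a.B2) 0 1

/-- The right matrix that is inverted in Step 4. -/
def rightT (a : AugPlant n d m e y l) (R M : Matrix n n ℝ) (X : Matrix m m ℝ) :
    Matrix (n ⊕ (m ⊕ y)) (n ⊕ (m ⊕ y)) ℝ :=
  fromBlocks Mᵀ 0 (fromRows 0 (a.C2 * R)) (fromBlocks X 0 0 1)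

/-- Step 4: the actual gains `g` from the transformed gains `h`. -/
def EqGains (a : AugPlant n d m e y l) (R S M N : Matrix n n ℝ) (X : Matrix m m ℝ)
    (h g : Gains n m y) : Prop :=
  g.toMatrix = (leftT a S N)⁻¹
    * (h.toMatrix - fromBlocks (S * a.A * R) (fromCols (S * a.B0 * X) 0) 0 0)
    * (rightT a R M X)⁻¹

/-! ## Closed loop, at one parameter value -/

/-- `A_cl`, on the state `(x_aug, x_c)`. -/
def clA (a : AugPlant n d m e y l) (g : Gains n m y) : Matrix (n ⊕ n) (n ⊕ n) ℝ :=
  fromBlocks (a.A + a.B2 * g.D1 * a.C2) (a.B2 * g.C) (g.B1 * a.C2) g.A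

/-- `B_cl1`, from `w`. -/
def clB1 (a : AugPlant n d m e y l) (g : Gains n m y) : Matrix (n ⊕ n) m ℝ :=
  fromRows (a.B0 + a.B2 * g.D2) g.B2

/-- `B_cl2`, from `d`. -/
def clB2 (a : AugPlant n d m e y l) (g : Gains n m y) : Matrix (n ⊕ n) d ℝ :=
  fromRows (a.B1 + a.B2 * g.D1 * a.D21) (g.B1 * a.D21)

/-- `C_cl1`, to `z_1`. -/
def clC1 (a : AugPlant n d m e y l) (g : Gains n m y) : Matrix (m × l) (n ⊕ n) ℝ :=
  fromCols (a.C0 + a.Dψ1 * g.D1 * a.C2) (a.Dψ1 * g.C)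

/-- `D_cl11`, from `w` to `z_1`. -/
def clD11 (a : AugPlant n d m e y l) (g : Gains n m y) : Matrix (m × l) m ℝ :=
  a.Dψ2 + a.Dψ1 * g.D2

/-- `D_cl12`, from `d` to `z_1`. -/
def clD12 (a : AugPlant n d m e y l) (g : Gains n m y) : Matrix (m × l) d ℝ :=
  a.Dψ1 * g.D1 * a.D21

/-- `C_cl2`, to `e`. -/
def clC2 (a : AugPlant n d m e y l) (g : Gains n m y) : Matrix e (n ⊕ n) ℝ :=
  fromCols (a.C1 + a.D12 * g.D1 * a.C2) (a.D12 * g.C)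

/-- `D_cl21`, from `w` to `e`. -/
def clD21 (a : AugPlant n d m e y l) (g : Gains n m y) : Matrix e m ℝ :=
  -a.D12 + a.D12 * g.D2

/-- `D_cl22`, from `d` to `e`. -/
def clD22 (a : AugPlant n d m e y l) (g : Gains n m y) : Matrix e d ℝ :=
  a.D11 + a.D12 * g.D1 * a.D21

/-- The matrix of the closed-loop inequality with slack variable `X`, blocks `(x, w, d, z, e)`. -/
def clLMI (a : AugPlant n d m e y l) (g : Gains n m y) (γ : ℝ) (P dP : Matrix (n ⊕ n) (n ⊕ n) ℝ)
    (X : Matrix m m ℝ) (Xk : l → Matrix m m ℝ) :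
    Matrix ((n ⊕ n) ⊕ (m ⊕ (d ⊕ ((m × l) ⊕ e)))) ((n ⊕ n) ⊕ (m ⊕ (d ⊕ ((m × l) ⊕ e)))) ℝ :=
  symBlock (He (P * clA a g) + dP)
    (fromRows (Xᵀ * (clB1 a g)ᵀ * P) (fromRows ((clB2 a g)ᵀ * P) (fromRows (clC1 a g) (clC2 a g))))
    (symBlock (-∑ k, (X + Xᵀ - Xk k)) (fromRows 0 (fromRows (clD11 a g * X) (clD21 a g * X)))
      (symBlock (-(γ • 1)) (fromRows (clD12 a g) (clD22 a g))
        (symBlock (-blockDiagonal Xk) 0 (-(γ • 1)))))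

/-- The matrix of the dissipation inequality with scalings `X_k⁻¹`, blocks `(x, w, d)`. -/
def clDissip (a : AugPlant n d m e y l) (g : Gains n m y) (γ : ℝ)
    (P dP : Matrix (n ⊕ n) (n ⊕ n) ℝ) (Xk : l → Matrix m m ℝ) :
    Matrix ((n ⊕ n) ⊕ (m ⊕ d)) ((n ⊕ n) ⊕ (m ⊕ d)) ℝ :=
  let Ze : Matrix e ((n ⊕ n) ⊕ (m ⊕ d)) ℝ :=
    fromCols (clC2 a g) (fromCols (clD21 a g) (clD22 a g))
  let Z1 : Matrix (m × l) ((n ⊕ n) ⊕ (m ⊕ d)) ℝ :=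
    fromCols (clC1 a g) (fromCols (clD11 a g) (clD12 a g))
  let Z2 : Matrix m ((n ⊕ n) ⊕ (m ⊕ d)) ℝ := fromCols 0 (fromCols 1 0)
  symBlock (He (P * clA a g) + dP) (fromRows ((clB1 a g)ᵀ * P) ((clB2 a g)ᵀ * P))
      (symBlock 0 0 (-(γ • 1)))
    + γ⁻¹ • (Zeᵀ * Ze)
    + (Z1ᵀ * blockDiagonal (fun k => (Xk k)⁻¹) * Z1 - Z2ᵀ * (∑ k, (Xk k)⁻¹) * Z2)

/-- The Lyapunov matrix `P = [[S, N], [Nᵀ, -Nᵀ R M⁻ᵀ]]`. -/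
def lyap (R S M N : Matrix n n ℝ) : Matrix (n ⊕ n) (n ⊕ n) ℝ :=
  fromBlocks S N Nᵀ (-(Nᵀ * R * (Mᵀ)⁻¹))

end Pointwise

/-! ## Parameter-dependent objects -/

/-- Decision variables of the synthesis inequalities. -/
structure Decision (s n nu L : Type) where
  R : (s → ℝ) → Matrix n n ℝ
  S : (s → ℝ) → Matrix n n ℝ
  X : (s → ℝ) → Matrix nu nu ℝ
  Xk : (s → ℝ) → L → Matrix nu nu ℝ

/-- The box of admissible parameter rates. -/
def RateBox {s : ℕ} (νlo νhi : Fin s → ℝ) : Set (Fin s → ℝ) :=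
  {ν | ∀ k, νlo k ≤ ν k ∧ ν k ≤ νhi k}

/-- The vertices of the box of rates. -/
def RateVertices {s : ℕ} (νlo νhi : Fin s → ℝ) : Set (Fin s → ℝ) :=
  {ν | ∀ k, ν k = νlo k ∨ ν k = νhi k}

/-- `Q` is a feasible solution of the synthesis inequalities at level `γ`; the inequalities that
contain a derivative are imposed at the vertices of the box of rates. -/
structure Feasible {s np nψ nd nu ne ny L : ℕ} (G : Plant s np nd nu ne ny)
    (F : IQCFilter nψ nu L) (Ω : Set (Fin s → ℝ)) (νlo νhi : Fin s → ℝ) (γ : ℝ)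
    (Q : Decision (Fin s) (Fin np ⊕ Fin nψ) (Fin nu) (Fin L)) : Prop where
  R_symm : ∀ ρ, (Q.R ρ).IsSymm
  S_symm : ∀ ρ, (Q.S ρ).IsSymm
  R_C1 : C1On Q.R Ω
  S_C1 : C1On Q.S Ω
  X_cont : ContinuousOn Q.X Ω
  Xk_cont : ContinuousOn Q.Xk Ω
  R_pos : ∀ ρ ∈ Ω, (Q.R ρ).PosDef
  S_pos : ∀ ρ ∈ Ω, (Q.S ρ).PosDef
  Xk_pos : ∀ ρ ∈ Ω, ∀ k, (Q.Xk ρ k).PosDef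
  lmi_R : ∀ ρ ∈ Ω, ∀ ν ∈ RateVertices νlo νhi,
    NegDefOnKer (kerR (augment G F ρ))
      (lmiR (augment G F ρ) γ (Q.R ρ) (dirDeriv Q.R ρ ν) (Q.X ρ) (Q.Xk ρ))
  lmi_S : ∀ ρ ∈ Ω, ∀ ν ∈ RateVertices νlo νhi,
    NegDefOnKer (kerS (augment G F ρ))
      (lmiS (augment G F ρ) γ (Q.S ρ) (dirDeriv Q.S ρ ν) (Q.Xk ρ))
  coupling : ∀ ρ ∈ Ω, (fromBlocks (Q.R ρ) 1 1 (Q.S ρ)).PosDef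

/-- Parameter-dependent gains; only `A` depends on the parameter rate as well. -/
structure LPVGains (s n m y : Type) where
  A : (s → ℝ) → (s → ℝ) → Matrix n n ℝ
  B1 : (s → ℝ) → Matrix n y ℝ
  B2 : (s → ℝ) → Matrix n m ℝ
  C : (s → ℝ) → Matrix m n ℝ
  D1 : (s → ℝ) → Matrix m y ℝ
  D2 : (s → ℝ) → Matrix m m ℝ

/-- The gains at the parameter value `ρ` and the rate `ν`. -/
def LPVGains.eval {s n m y : Type} (K : LPVGains s n m y) (ρ ν : s → ℝ) : Gains n m y where
  A := K.A ρ ν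
  B1 := K.B1 ρ
  B2 := K.B2 ρ
  C := K.C ρ
  D1 := K.D1 ρ
  D2 := K.D2 ρ

/-- `M Nᵀ = I - R S` (as functions, near the parameter set), with `M` continuously
differentiable. -/
def IsFactor {s : ℕ} {n : Type} [Fintype n] [DecidableEq n] (Ω : Set (Fin s → ℝ))
    (R S M N : (Fin s → ℝ) → Matrix n n ℝ) : Prop :=
  C1On M Ω ∧ ∀ ρ ∈ Ω, ∀ᶠ q in 𝓝 ρ, M q * (N q)ᵀ = 1 - R q * S q

/-- `(Dh1, Dh2)` is an admissible choice in Step 1. -/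
def Step1 {s np nψ nd nu ne ny L : ℕ} (G : Plant s np nd nu ne ny) (F : IQCFilter nψ nu L)
    (Ω : Set (Fin s → ℝ)) (γ : ℝ) (Q : Decision (Fin s) (Fin np ⊕ Fin nψ) (Fin nu) (Fin L))
    (Dh1 : (Fin s → ℝ) → Matrix (Fin nu) (Fin ny) ℝ)
    (Dh2 : (Fin s → ℝ) → Matrix (Fin nu) (Fin nu) ℝ) : Prop :=
  ∀ ρ ∈ Ω, (PiMat (augment G F ρ) γ (Q.X ρ) (Q.Xk ρ) (Dh1 ρ) (Dh2 ρ)).PosDef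

/-- The controller `K` is obtained from `Q` by Steps 1 to 4, with intermediate gains `h` and the
factors `M`, `N`.  Its order is that of the augmented plant. -/
structure Reconstructs {s np nψ nd nu ne ny L : ℕ} (G : Plant s np nd nu ne ny)
    (F : IQCFilter nψ nu L) (Ω : Set (Fin s → ℝ)) (νlo νhi : Fin s → ℝ) (γ : ℝ)
    (Q : Decision (Fin s) (Fin np ⊕ Fin nψ) (Fin nu) (Fin L))
    (M N : (Fin s → ℝ) → Matrix (Fin np ⊕ Fin nψ) (Fin np ⊕ Fin nψ) ℝ)
    (h K : LPVGains (Fin s) (Fin np ⊕ Fin nψ) (Fin nu) (Fin ny)) : Prop where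
  factor : IsFactor Ω Q.R Q.S M N
  step1 : Step1 G F Ω γ Q h.D1 h.D2
  step2B : ∀ ρ ∈ Ω,
    EqB (augment G F ρ) γ (Q.S ρ) (Q.X ρ) (Q.Xk ρ) (h.D1 ρ) (h.D2 ρ) (h.B1 ρ) (h.B2 ρ)
  step2C : ∀ ρ ∈ Ω, EqC (augment G F ρ) γ (Q.R ρ) (Q.X ρ) (Q.Xk ρ) (h.D1 ρ) (h.D2 ρ) (h.C ρ)
  step3 : ∀ ρ ∈ Ω, ∀ ν ∈ RateBox νlo νhi,
    EqA (augment G F ρ) γ (Q.R ρ) (Q.S ρ) (dirDeriv Q.R ρ ν) (N ρ) (dirDeriv M ρ ν)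
      (Q.X ρ) (Q.Xk ρ) (h.eval ρ ν)
  step4 : ∀ ρ ∈ Ω, ∀ ν ∈ RateBox νlo νhi,
    EqGains (augment G F ρ) (Q.R ρ) (Q.S ρ) (M ρ) (N ρ) (Q.X ρ) (h.eval ρ ν) (K.eval ρ ν)

/-! ## Signals, delays, and the closed-loop system -/

/-- Locally square-integrable signals on `[0, ∞)`. -/
def LocL2 {ι : Type} [Fintype ι] (v : ℝ → ι → ℝ) : Prop :=
  ∀ T : ℝ, 0 ≤ T → MemLp v 2 (volume.restrict (Set.Icc 0 T))

/-- Admissible delays: `τ(t) ∈ [0, τmax]` and `|dτ/dt| ≤ r`. -/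
def IsDelay (τmax r : ℝ) (τ : ℝ → ℝ) : Prop :=
  ∀ t, 0 ≤ t → 0 ≤ τ t ∧ τ t ≤ τmax ∧
    ∃ τd, HasDerivWithinAt τ τd (Set.Ici 0) t ∧ |τd| ≤ r

/-- `ρ` is a parameter trajectory in `Ω` with derivative `ρd` in the box of rates. -/
def IsParamTraj {s : ℕ} (Ω : Set (Fin s → ℝ)) (νlo νhi : Fin s → ℝ) (ρ ρd : ℝ → Fin s → ℝ) :
    Prop :=
  ∀ t, 0 ≤ t → ρ t ∈ Ω ∧ HasDerivWithinAt ρ (ρd t) (Set.Ici 0) t ∧ ρd t ∈ RateBox νlo νhi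

/-- `u` and `w` are locally square-integrable signals with `w = u - u(· - τ)`, where `u` vanishes
at negative times. -/
structure IsDelayPair {nu : ℕ} (τ : ℝ → ℝ) (u w : ℝ → Fin nu → ℝ) : Prop where
  u_L2 : LocL2 u
  w_L2 : LocL2 w
  rest : ∀ t, t < 0 → u t = 0
  delay : ∀ t, 0 ≤ t → w t = u t - u (t - τ t)

/-- `x` is the state of the filter driven by `(u, w)` from zero initial state. -/
def IsFilterState {nψ nu L : ℕ} (F : IQCFilter nψ nu L) (u w : ℝ → Fin nu → ℝ)
    (x : ℝ → Fin nψ → ℝ) : Prop :=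
  ContinuousOn x (Set.Ici 0) ∧
    ∀ t, 0 ≤ t → x t = ∫ r in (0 : ℝ)..t, (F.A *ᵥ x r + F.Bu *ᵥ u r + F.Bw *ᵥ w r)

/-- The operator `u ↦ u - u(· - τ)` satisfies, for each `k` and each admissible delay, the hard
integral quadratic constraint with filter `Ψ_k` and weight `diag(X_k⁻¹, -X_k⁻¹)`, with `X_k`
evaluated along the parameter trajectory. -/
def DelayIQC {s nψ nu L : ℕ} (F : IQCFilter nψ nu L)
    (Xk : (Fin s → ℝ) → Fin L → Matrix (Fin nu) (Fin nu) ℝ) (Ω : Set (Fin s → ℝ))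
    (νlo νhi : Fin s → ℝ) (τmax r : ℝ) : Prop :=
  ∀ (τ : ℝ → ℝ) (ρ ρd : ℝ → Fin s → ℝ) (u w : ℝ → Fin nu → ℝ) (x : ℝ → Fin nψ → ℝ),
    IsDelay τmax r τ → IsParamTraj Ω νlo νhi ρ ρd → IsDelayPair τ u w → IsFilterState F u w x →
    ∀ (k : Fin L) (T : ℝ), 0 ≤ T →
      0 ≤ ∫ t in (0 : ℝ)..T,
        ((F.C k *ᵥ x t + F.Du k *ᵥ u t + F.Dw k *ᵥ w t) ⬝ᵥ
            ((Xk (ρ t) k)⁻¹ *ᵥ (F.C k *ᵥ x t + F.Du k *ᵥ u t + F.Dw k *ᵥ w t))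
          - w t ⬝ᵥ ((Xk (ρ t) k)⁻¹ *ᵥ w t))

/-- The closed-loop output `e = C_cl2 x + D_cl21 w + D_cl22 d`. -/
def clOutput {s np nψ nd nu ne ny L : ℕ} (G : Plant s np nd nu ne ny) (F : IQCFilter nψ nu L)
    (K : LPVGains (Fin s) (Fin np ⊕ Fin nψ) (Fin nu) (Fin ny)) (ρ ρd : ℝ → Fin s → ℝ)
    (x : ℝ → (Fin np ⊕ Fin nψ) ⊕ (Fin np ⊕ Fin nψ) → ℝ) (w : ℝ → Fin nu → ℝ)
    (d : ℝ → Fin nd → ℝ) (t : ℝ) : Fin ne → ℝ :=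
  clC2 (augment G F (ρ t)) (K.eval (ρ t) (ρd t)) *ᵥ x t
    + clD21 (augment G F (ρ t)) (K.eval (ρ t) (ρd t)) *ᵥ w t
    + clD22 (augment G F (ρ t)) (K.eval (ρ t) (ρd t)) *ᵥ d t

/-- The right-hand side `A_cl x + B_cl1 w + B_cl2 d` of the closed-loop state equation. -/
def clField {s np nψ nd nu ne ny L : ℕ} (G : Plant s np nd nu ne ny) (F : IQCFilter nψ nu L)
    (K : LPVGains (Fin s) (Fin np ⊕ Fin nψ) (Fin nu) (Fin ny)) (ρ ρd : ℝ → Fin s → ℝ)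
    (x : ℝ → (Fin np ⊕ Fin nψ) ⊕ (Fin np ⊕ Fin nψ) → ℝ) (w : ℝ → Fin nu → ℝ)
    (d : ℝ → Fin nd → ℝ) (t : ℝ) : (Fin np ⊕ Fin nψ) ⊕ (Fin np ⊕ Fin nψ) → ℝ :=
  clA (augment G F (ρ t)) (K.eval (ρ t) (ρd t)) *ᵥ x t
    + clB1 (augment G F (ρ t)) (K.eval (ρ t) (ρd t)) *ᵥ w t
    + clB2 (augment G F (ρ t)) (K.eval (ρ t) (ρd t)) *ᵥ d t

/-- `(x, u, w)` is a (Carathéodory) solution on `[0, ∞)` of the closed loop of plant, filter and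
controller, with disturbance `d`, delay `τ` and parameter trajectory `ρ`.  The state is
`x = ((x_p, x_ψ), x_c)`, the filter starts at zero, `w = u - u(· - τ)`, and
`u = C_c x_c + D_c1 y + D_c2 w` with `y = C2 (x_p, x_ψ) + D21 d`. -/
structure IsClosedLoop {s np nψ nd nu ne ny L : ℕ} (G : Plant s np nd nu ne ny)
    (F : IQCFilter nψ nu L) (K : LPVGains (Fin s) (Fin np ⊕ Fin nψ) (Fin nu) (Fin ny))
    (τ : ℝ → ℝ) (ρ ρd : ℝ → Fin s → ℝ) (d : ℝ → Fin nd → ℝ)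
    (x : ℝ → (Fin np ⊕ Fin nψ) ⊕ (Fin np ⊕ Fin nψ) → ℝ) (u w : ℝ → Fin nu → ℝ) : Prop where
  d_L2 : LocL2 d
  pair : IsDelayPair τ u w
  input : ∀ᵐ t ∂(volume.restrict (Set.Ici (0 : ℝ))),
    u t = K.C (ρ t) *ᵥ (fun i => x t (Sum.inr i))
      + K.D1 (ρ t) *ᵥ ((augment G F (ρ t)).C2 *ᵥ (fun i => x t (Sum.inl i)) + G.D21 (ρ t) *ᵥ d t)
      + K.D2 (ρ t) *ᵥ w t
  filter_rest : ∀ i, x 0 (Sum.inl (Sum.inr i)) = 0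
  integrable : ∀ t, 0 ≤ t → IntervalIntegrable (clField G F K ρ ρd x w d) volume 0 t
  ode : ∀ t, 0 ≤ t → x t = x 0 + ∫ r in (0 : ℝ)..t, clField G F K ρ ρd x w d r

/-- Asymptotic stability of the undisturbed closed loop: for all admissible delays and parameter
trajectories, the state is bounded by a fixed multiple of its initial value and tends to zero. -/
def AsympStable {s np nψ nd nu ne ny L : ℕ} (G : Plant s np nd nu ne ny) (F : IQCFilter nψ nu L)
    (K : LPVGains (Fin s) (Fin np ⊕ Fin nψ) (Fin nu) (Fin ny)) (Ω : Set (Fin s → ℝ))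
    (νlo νhi : Fin s → ℝ) (τmax r : ℝ) : Prop :=
  ∃ c : ℝ, ∀ (τ : ℝ → ℝ) (ρ ρd : ℝ → Fin s → ℝ)
    (x : ℝ → (Fin np ⊕ Fin nψ) ⊕ (Fin np ⊕ Fin nψ) → ℝ) (u w : ℝ → Fin nu → ℝ),
    IsDelay τmax r τ → IsParamTraj Ω νlo νhi ρ ρd → IsClosedLoop G F K τ ρ ρd 0 x u w →
    (∀ t, 0 ≤ t → ‖x t‖ ≤ c * ‖x 0‖) ∧ Tendsto x atTop (𝓝 0)

/-- The `L₂` gain from `d` to `e` is less than `γ`, uniformly in the admissible delays and parameter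
trajectories: from zero initial state, `‖e_T‖ ≤ γ' ‖d_T‖` for all `T ≥ 0`, for some `γ' < γ`. -/
def L2GainLT {s np nψ nd nu ne ny L : ℕ} (G : Plant s np nd nu ne ny) (F : IQCFilter nψ nu L)
    (K : LPVGains (Fin s) (Fin np ⊕ Fin nψ) (Fin nu) (Fin ny)) (Ω : Set (Fin s → ℝ))
    (νlo νhi : Fin s → ℝ) (τmax r γ : ℝ) : Prop :=
  ∃ γ' : ℝ, 0 ≤ γ' ∧ γ' < γ ∧ ∀ (τ : ℝ → ℝ) (ρ ρd : ℝ → Fin s → ℝ) (d : ℝ → Fin nd → ℝ)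
    (x : ℝ → (Fin np ⊕ Fin nψ) ⊕ (Fin np ⊕ Fin nψ) → ℝ) (u w : ℝ → Fin nu → ℝ),
    IsDelay τmax r τ → IsParamTraj Ω νlo νhi ρ ρd → IsClosedLoop G F K τ ρ ρd d x u w →
    x 0 = 0 → ∀ T : ℝ, 0 ≤ T →
      ∫ t in (0 : ℝ)..T, clOutput G F K ρ ρd x w d t ⬝ᵥ clOutput G F K ρ ρd x w d t ≤
        γ' ^ 2 * ∫ t in (0 : ℝ)..T, d t ⬝ᵥ d t

end

end DelayLPV

open DelayLPV

/-!
The controller is the one for which the closed-loop inequality, after a congruence, has a Schur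
complement that is block diagonal, with the two synthesis inequalities on its diagonal.

*Elimination.*  Both kernel conditions, tested at vectors without state component, are the
hypotheses of the elimination (projection) lemma `exists_eliminate`, which Finsler's lemma reduces
to a definite inner product; hence feedthrough terms with `Π > 0` exist at each parameter.  They
form an open condition and a convex set, so a partition of unity yields a continuous choice
(`Feasible.exists_continuous_step1`).

*The saddle-point systems.*  The rank conditions on `D_{p12}` and `D_{p21}` and `Π > 0` make the
equations for `B̂_c` and `Ĉ_c` uniquely solvable (`saddle_iff`).  The auxiliary unknown `Ξ` of each
system maps a state `x` to a vector `(x, Ξ x)` in the kernel spanned by `𝒩_R` or `𝒩_S`, and the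
synthesis inequality at that vector says that the corresponding Schur complement with respect to
`Π` is negative (`quad_schurR_neg`, `quad_schurS_neg`).

*Reconstruction.*  Congruence with `[R I; Mᵀ 0]` (`lyapT`) turns `P` into
`[R I; I S]` and makes the closed-loop inequality affine in the transformed gains (`clLMI_quad`).
The formula for `Â_c` cancels the off-diagonal block of the Schur complement with respect to `Π`,
which leaves the two negative forms above (`clLMI_neg`).  The dependence on the parameter rate is
affine, so that the vertices of the rate box suffice (`Feasible.lmi_R_box`, `Feasible.lmi_S_box`).
Completion of squares, `X + Xᵀ - X_k ≤ Xᵀ X_k⁻¹ X`, passes to the dissipation inequality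
(`clDissip_neg`).  `Reconstructs.certificate` collects these conclusions.

*Stability and gain.*  With continuous gains, the certificate is uniform, with a margin `ε`, on a
compact parameter set times the compact rate box (`Reconstructs.exists_uniformCertificate`).  The
storage function `xᵀ P x` is absolutely continuous along Carathéodory solutions
(`integral_energy`), and integration together with the integral quadratic constraints gives
`IsClosedLoop.dissipation`.  This yields boundedness, integrability of `|x|² + |w|²` over all times,
and, with the margin absorbed into `γ' = √(γ (γ - min ε γ))`, the gain bound.  Since `ẋ` need not
be bounded, convergence to zero does not follow from integrability alone; but the storage
function grows at most by a multiple of `∫ |w|²` (`IsClosedLoop.storage_sub_le`), so averaging over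
`[t - 1, t]` bounds `|x(t)|²` by a multiple of `∫_{t-1}^t (|x|² + |w|²)`, which tends to zero.
-/

set_option linter.unusedSectionVars false

namespace DelayLPV

/-! ### Quadratic forms and block matrices -/

theorem symBlock_transpose {n k : Type} {A : Matrix n n ℝ} (B : Matrix k n ℝ) {D : Matrix k k ℝ}
    (hA : Aᵀ = A) (hD : Dᵀ = D) : (symBlock A B D)ᵀ = symBlock A B D := by
  rw [symBlock, fromBlocks_transpose, hA, hD, transpose_transpose]

theorem He_transpose {n : Type} (A : Matrix n n ℝ) : (He A)ᵀ = He A := by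
  rw [He, transpose_add, transpose_transpose, add_comm]

section Quadratic

variable {n k : Type} [Fintype n] [Fintype k]

theorem dotProduct_transpose_mulVec (A : Matrix k n ℝ) (x : n → ℝ) (y : k → ℝ) :
    x ⬝ᵥ (Aᵀ *ᵥ y) = y ⬝ᵥ (A *ᵥ x) := by
  rw [mulVec_transpose, dotProduct_comm, dotProduct_mulVec]

theorem dotProduct_mulVec_comm {A : Matrix n n ℝ} (hA : Aᵀ = A) (x y : n → ℝ) :
    x ⬝ᵥ (A *ᵥ y) = y ⬝ᵥ (A *ᵥ x) := by
  conv_lhs => rw [← hA]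
  exact dotProduct_transpose_mulVec A x y

theorem zero_le_dotProduct_self (v : n → ℝ) : 0 ≤ v ⬝ᵥ v :=
  Finset.sum_nonneg fun i _ => mul_self_nonneg (v i)

theorem dotProduct_self_pos {v : n → ℝ} (hv : v ≠ 0) : 0 < v ⬝ᵥ v :=
  lt_of_le_of_ne (zero_le_dotProduct_self v) fun h => hv (dotProduct_self_eq_zero.1 h.symm)

theorem posDef_iff_dotProduct {A : Matrix n n ℝ} :
    A.PosDef ↔ Aᵀ = A ∧ ∀ v : n → ℝ, v ≠ 0 → 0 < v ⬝ᵥ (A *ᵥ v) := by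
  constructor
  · intro h
    refine ⟨by simpa [IsHermitian, conjTranspose_eq_transpose_of_trivial] using h.1, fun v hv => ?_⟩
    simpa using h.dotProduct_mulVec_pos hv
  · rintro ⟨h1, h2⟩
    refine PosDef.of_dotProduct_mulVec_pos
      (by simpa [IsHermitian, conjTranspose_eq_transpose_of_trivial] using h1) fun v hv => ?_
    simpa using h2 v hv

theorem PosDef.transpose_eq {A : Matrix n n ℝ} (hA : A.PosDef) : Aᵀ = A :=
  (posDef_iff_dotProduct.1 hA).1

theorem PosDef.dotProduct_pos {A : Matrix n n ℝ} (hA : A.PosDef) {v : n → ℝ} (hv : v ≠ 0) :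
    0 < v ⬝ᵥ (A *ᵥ v) :=
  (posDef_iff_dotProduct.1 hA).2 v hv

theorem PosDef.dotProduct_nonneg {A : Matrix n n ℝ} (hA : A.PosDef) (v : n → ℝ) :
    0 ≤ v ⬝ᵥ (A *ᵥ v) := by
  simpa using hA.posSemidef.dotProduct_mulVec_nonneg v

theorem isUnit_of_mulVec_injective [DecidableEq n] {A : Matrix n n ℝ}
    (h : ∀ v, A *ᵥ v = 0 → v = 0) : IsUnit A :=
  mulVec_injective_iff_isUnit.1 fun v w hvw =>
    sub_eq_zero.1 (h _ (by rw [mulVec_sub, hvw, sub_self]))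

theorem He_quad (A : Matrix n n ℝ) (v : n → ℝ) : v ⬝ᵥ (He A *ᵥ v) = 2 * (v ⬝ᵥ (A *ᵥ v)) := by
  rw [He, add_mulVec, dotProduct_add, dotProduct_transpose_mulVec]; ring

theorem symBlock_mulVec_elim (A : Matrix n n ℝ) (B : Matrix k n ℝ) (D : Matrix k k ℝ)
    (x : n → ℝ) (y : k → ℝ) :
    symBlock A B D *ᵥ Sum.elim x y = Sum.elim (A *ᵥ x + Bᵀ *ᵥ y) (B *ᵥ x + D *ᵥ y) := by
  rw [symBlock, fromBlocks_mulVec]; rfl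

theorem symBlock_quad (A : Matrix n n ℝ) (B : Matrix k n ℝ) (D : Matrix k k ℝ)
    (x : n → ℝ) (y : k → ℝ) :
    Sum.elim x y ⬝ᵥ (symBlock A B D *ᵥ Sum.elim x y) =
      x ⬝ᵥ (A *ᵥ x) + 2 * (y ⬝ᵥ (B *ᵥ x)) + y ⬝ᵥ (D *ᵥ y) := by
  rw [symBlock_mulVec_elim, sumElim_dotProduct_sumElim, dotProduct_add, dotProduct_add,
    dotProduct_transpose_mulVec]
  ring

end Quadratic

/-! ### Compactness of the unit sphere -/

section Compactness

variable {n k : Type} [Fintype n] [Fintype k]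

theorem isCompact_unitSphere : IsCompact {v : n → ℝ | v ⬝ᵥ v = 1} := by
  refine Metric.isCompact_of_isClosed_isBounded
    (isClosed_eq (by simp only [dotProduct]; fun_prop) continuous_const) ?_
  refine (Metric.isBounded_closedBall (x := (0 : n → ℝ)) (r := 1)).subset fun v hv => ?_
  rw [mem_closedBall_zero_iff, pi_norm_le_iff_of_nonneg zero_le_one]
  intro i
  have h : v i * v i ≤ 1 := by
    rw [← show v ⬝ᵥ v = 1 from hv]
    exact Finset.single_le_sum (f := fun i => v i * v i) (fun j _ => mul_self_nonneg (v j))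
      (Finset.mem_univ i)
  rw [Real.norm_eq_abs]
  exact abs_le_one_iff_mul_self_le_one.2 h

theorem exists_smul_unitSphere {v : n → ℝ} (hv : v ≠ 0) :
    ∃ t : ℝ, 0 < t ∧ ∃ u : n → ℝ, u ⬝ᵥ u = 1 ∧ v = t • u := by
  have h := dotProduct_self_pos hv
  have ht := Real.sqrt_pos.2 h
  refine ⟨√(v ⬝ᵥ v), ht, (√(v ⬝ᵥ v))⁻¹ • v, ?_, ?_⟩
  · rw [smul_dotProduct, dotProduct_smul, smul_eq_mul, smul_eq_mul]
    have h2 := Real.mul_self_sqrt h.le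
    field_simp
    nlinarith
  · rw [smul_smul, mul_inv_cancel₀ ht.ne', one_smul]

theorem smul_quad (A : Matrix n n ℝ) (t : ℝ) (u : n → ℝ) :
    (t • u) ⬝ᵥ (A *ᵥ (t • u)) = t ^ 2 * (u ⬝ᵥ (A *ᵥ u)) := by
  rw [mulVec_smul, smul_dotProduct, dotProduct_smul, smul_eq_mul, smul_eq_mul]; ring

/-- Finsler's lemma. -/
theorem exists_finsler_multiplier {K : Matrix k n ℝ} {Q : Matrix n n ℝ} (h : NegDefOnKer K Q) :
    ∃ r : ℝ, 0 < r ∧ ∀ v : n → ℝ, v ≠ 0 → v ⬝ᵥ (Q *ᵥ v) < r * ((K *ᵥ v) ⬝ᵥ (K *ᵥ v)) := by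
  have hq : Continuous fun v : n → ℝ => v ⬝ᵥ (Q *ᵥ v) := by
    simp only [dotProduct, mulVec]; fun_prop
  have hf : Continuous fun v : n → ℝ => (K *ᵥ v) ⬝ᵥ (K *ᵥ v) := by
    simp only [dotProduct, mulVec]; fun_prop
  obtain ⟨δ, hδ, hδK⟩ := (isCompact_unitSphere (n := n)).inter_right
    (isClosed_le continuous_const hq : IsClosed {v : n → ℝ | 0 ≤ v ⬝ᵥ (Q *ᵥ v)})
    |>.exists_forall_le' (a := 0) hf.continuousOn (fun v hv => dotProduct_self_pos fun h0 => by
      have hne : v ≠ 0 := by rintro rfl; simp at hv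
      exact absurd hv.2 (not_le.2 (h v hne h0)))
  obtain ⟨M, hM⟩ := (isCompact_unitSphere (n := n)).exists_bound_of_continuousOn hq.continuousOn
  refine ⟨(|M| + 1) / δ, by positivity, fun v hv => ?_⟩
  obtain ⟨t, ht, u, hu, rfl⟩ := exists_smul_unitSphere hv
  rw [smul_quad, mulVec_smul, smul_dotProduct, dotProduct_smul, smul_eq_mul, smul_eq_mul]
  have key : u ⬝ᵥ (Q *ᵥ u) < (|M| + 1) / δ * ((K *ᵥ u) ⬝ᵥ (K *ᵥ u)) := by
    by_cases h0 : 0 ≤ u ⬝ᵥ (Q *ᵥ u)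
    · have h1 := hδK u ⟨hu, h0⟩
      have h2 := (le_abs_self _).trans ((hM u hu).trans (le_abs_self M))
      calc u ⬝ᵥ (Q *ᵥ u) < |M| + 1 := by linarith
        _ = (|M| + 1) / δ * δ := by field_simp
        _ ≤ _ := by gcongr
    · exact (not_le.1 h0).trans_le
        (mul_nonneg (by positivity) (zero_le_dotProduct_self _))
  nlinarith [mul_lt_mul_of_pos_left key (pow_pos ht 2)]

variable {T : Type} [TopologicalSpace T]

theorem continuous_quad_prod {A : T → Matrix n n ℝ} (hA : Continuous A) :
    Continuous fun z : T × (n → ℝ) => z.2 ⬝ᵥ (A z.1 *ᵥ z.2) := by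
  have h : ∀ i j, Continuous fun z : T × (n → ℝ) => A z.1 i j := fun i j =>
    (continuous_apply_apply i j).comp (hA.comp continuous_fst)
  have h2 : ∀ i, Continuous fun z : T × (n → ℝ) => z.2 i := fun i =>
    (continuous_apply i).comp continuous_snd
  exact continuous_finsetSum _ fun i _ => (h2 i).mul
    (continuous_finsetSum _ fun j _ => (h i j).mul (h2 j))

variable [CompactSpace T]

theorem exists_uniform_quad_upper {A : T → Matrix n n ℝ} (hA : Continuous A) :
    ∃ C : ℝ, 0 ≤ C ∧ ∀ τ v, v ⬝ᵥ (A τ *ᵥ v) ≤ C * (v ⬝ᵥ v) := by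
  obtain ⟨M, hM⟩ := (isCompact_univ.prod
    (isCompact_unitSphere (n := n))).exists_bound_of_continuousOn
    (continuous_quad_prod hA).continuousOn
  refine ⟨|M|, abs_nonneg _, fun τ v => ?_⟩
  rcases eq_or_ne v 0 with rfl | hv
  · simp
  obtain ⟨t, ht, u, hu, rfl⟩ := exists_smul_unitSphere hv
  have h2 := (le_abs_self _).trans ((hM (τ, u) ⟨Set.mem_univ _, hu⟩).trans (le_abs_self M))
  rw [smul_quad, smul_dotProduct, dotProduct_smul, hu, smul_eq_mul, smul_eq_mul]
  nlinarith [mul_le_mul_of_nonneg_left h2 (sq_nonneg t)]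

theorem exists_uniform_quad_lower {A : T → Matrix n n ℝ} (hA : Continuous A)
    (hpos : ∀ τ v, v ≠ 0 → 0 < v ⬝ᵥ (A τ *ᵥ v)) :
    ∃ ε : ℝ, 0 < ε ∧ ∀ τ v, ε * (v ⬝ᵥ v) ≤ v ⬝ᵥ (A τ *ᵥ v) := by
  obtain ⟨ε, hε, hle⟩ := (isCompact_univ.prod (isCompact_unitSphere (n := n))).exists_forall_le'
    (a := 0) (continuous_quad_prod hA).continuousOn (fun z hz => hpos z.1 z.2 (by
      intro h0; have h1 : z.2 ⬝ᵥ z.2 = 1 := hz.2; simp [h0] at h1))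
  refine ⟨ε, hε, fun τ v => ?_⟩
  rcases eq_or_ne v 0 with rfl | hv
  · simp
  obtain ⟨t, ht, u, hu, rfl⟩ := exists_smul_unitSphere hv
  have h2 : ε ≤ u ⬝ᵥ (A τ *ᵥ u) := hle (τ, u) ⟨Set.mem_univ _, hu⟩
  rw [smul_quad, smul_dotProduct, dotProduct_smul, hu, smul_eq_mul, smul_eq_mul]
  nlinarith [mul_le_mul_of_nonneg_left h2 (sq_nonneg t)]

end Compactness

/-! ### Elimination of a full-block unknown, and saddle-point systems -/

section Elimination

variable {n k p q : Type} [Fintype n] [Fintype k] [Fintype p]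
  [DecidableEq n]

theorem posDef_compression {B : Matrix n n ℝ} (hB : B.PosDef) {V : Matrix p n ℝ}
    (hV : ∀ y, Vᵀ *ᵥ y = 0 → y = 0) : (V * B⁻¹ * Vᵀ).PosDef := by
  have hB' := hB.inv
  refine posDef_iff_dotProduct.2 ⟨?_, fun y hy => ?_⟩
  · rw [transpose_mul, transpose_mul, transpose_transpose, PosDef.transpose_eq hB',
      Matrix.mul_assoc]
  · rw [← mulVec_mulVec, ← mulVec_mulVec, ← transpose_transpose V, dotProduct_transpose_mulVec,
      transpose_transpose, dotProduct_comm]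
    exact PosDef.dotProduct_pos hB' fun h => hy (hV y h)

variable [DecidableEq p]

/-- The elimination (projection) lemma for a full-row-rank `V`.  With `B = r UᵀU - Q > 0`, every `v`
splits `B`-orthogonally into `x ∈ ker V` and `s = W V v`; for `D = -r U W` the form on the left is
`x·Qx - s·Bs - r |U s|²`. -/
theorem exists_eliminate {Q : Matrix n n ℝ} (hQ : Qᵀ = Q) {U : Matrix k n ℝ} {V : Matrix p n ℝ}
    (hU : NegDefOnKer U Q) (hVQ : NegDefOnKer V Q) (hV : ∀ y, Vᵀ *ᵥ y = 0 → y = 0) :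
    ∃ D : Matrix k p ℝ, ∀ v : n → ℝ, v ≠ 0 →
      v ⬝ᵥ (Q *ᵥ v) + 2 * ((U *ᵥ v) ⬝ᵥ (D *ᵥ (V *ᵥ v))) < 0 := by
  obtain ⟨r, hr, hrU⟩ := exists_finsler_multiplier hU
  set B : Matrix n n ℝ := r • (Uᵀ * U) - Q with hBdef
  have hBv : ∀ x y : n → ℝ, x ⬝ᵥ (B *ᵥ y) = r * ((U *ᵥ x) ⬝ᵥ (U *ᵥ y)) - x ⬝ᵥ (Q *ᵥ y) := by
    intro x y
    rw [hBdef, sub_mulVec, smul_mulVec, dotProduct_sub, dotProduct_smul, ← mulVec_mulVec,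
      dotProduct_transpose_mulVec, smul_eq_mul, dotProduct_comm (U *ᵥ y)]
  have hB : B.PosDef := by
    refine posDef_iff_dotProduct.2 ⟨?_, fun v hv => ?_⟩
    · rw [hBdef, transpose_sub, transpose_smul, transpose_mul, transpose_transpose, hQ]
    · rw [hBv]; linarith [hrU v hv]
  have hC := posDef_compression hB hV
  have hBu : IsUnit B.det := (isUnit_iff_isUnit_det _).1 hB.isUnit
  have hCu : IsUnit (V * B⁻¹ * Vᵀ).det := (isUnit_iff_isUnit_det _).1 hC.isUnit
  set W : Matrix n p ℝ := B⁻¹ * Vᵀ * (V * B⁻¹ * Vᵀ)⁻¹ with hW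
  have hVW : V * W = 1 := by
    rw [hW, ← Matrix.mul_assoc, ← Matrix.mul_assoc, mul_nonsing_inv _ hCu]
  have hBW : B * W = Vᵀ * (V * B⁻¹ * Vᵀ)⁻¹ := by
    rw [hW, ← Matrix.mul_assoc, ← Matrix.mul_assoc, mul_nonsing_inv _ hBu, Matrix.one_mul]
  refine ⟨-(r • (U * W)), fun v hv => ?_⟩
  set s : n → ℝ := W *ᵥ (V *ᵥ v) with hs
  set x : n → ℝ := v - s with hx
  have hVx : V *ᵥ x = 0 := by
    rw [hx, mulVec_sub, hs, mulVec_mulVec, hVW, one_mulVec, sub_self]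
  have hvxs : v = x + s := by rw [hx, sub_add_cancel]
  have horth : x ⬝ᵥ (B *ᵥ s) = 0 := by
    rw [hs, mulVec_mulVec, hBW, ← mulVec_mulVec, dotProduct_transpose_mulVec, hVx, dotProduct_zero]
  have hDv : (-(r • (U * W))) *ᵥ (V *ᵥ v) = -(r • (U *ᵥ s)) := by
    rw [neg_mulVec, smul_mulVec, ← mulVec_mulVec]
  rw [hDv, hvxs]
  simp only [mulVec_add, dotProduct_add, add_dotProduct, dotProduct_neg, dotProduct_smul,
    smul_eq_mul]
  have e1 := hBv x s
  have e2 := hBv s s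
  have e3 := dotProduct_mulVec_comm hQ s x
  have hUs := mul_nonneg hr.le (zero_le_dotProduct_self (U *ᵥ s))
  rcases eq_or_ne x 0 with hx0 | hx0
  · have hs0 : s ≠ 0 := by
      intro h; apply hv; rw [hvxs, hx0, h, add_zero]
    have := PosDef.dotProduct_pos hB hs0
    simp only [hx0, mulVec_zero, dotProduct_zero, zero_dotProduct] at *
    linarith
  · have h1 := hVQ x hx0 hVx
    have h2 := PosDef.dotProduct_nonneg hB s
    linarith

/-- Explicit solution of the saddle-point system `[0 V; Vᵀ -Π] [Y; Ξ] = [c₁; c₂]`. -/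
theorem saddle_iff {P : Matrix n n ℝ} (hP : P.PosDef) {V : Matrix p n ℝ}
    (hV : ∀ y, Vᵀ *ᵥ y = 0 → y = 0) (c₁ : Matrix p q ℝ) (c₂ : Matrix n q ℝ) (Y : Matrix p q ℝ) :
    (∃ Ξ : Matrix n q ℝ, V * Ξ = c₁ ∧ Vᵀ * Y - P * Ξ = c₂) ↔
      Y = (V * P⁻¹ * Vᵀ)⁻¹ * (c₁ + V * P⁻¹ * c₂) := by
  have hPu : IsUnit P.det := (isUnit_iff_isUnit_det _).1 hP.isUnit
  have hCu : IsUnit (V * P⁻¹ * Vᵀ).det :=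
    (isUnit_iff_isUnit_det _).1 (posDef_compression hP hV).isUnit
  constructor
  · rintro ⟨Ξ, h1, h2⟩
    have h3 : c₁ + V * P⁻¹ * c₂ = V * P⁻¹ * Vᵀ * Y := by
      rw [← h1, ← h2, Matrix.mul_sub, ← Matrix.mul_assoc, ← Matrix.mul_assoc,
        Matrix.mul_assoc V P⁻¹ P, nonsing_inv_mul _ hPu, Matrix.mul_one, add_sub_cancel]
    rw [h3, ← Matrix.mul_assoc, nonsing_inv_mul _ hCu, Matrix.one_mul]
  · rintro rfl
    set Y := (V * P⁻¹ * Vᵀ)⁻¹ * (c₁ + V * P⁻¹ * c₂) with hY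
    have h3 : V * P⁻¹ * Vᵀ * Y = c₁ + V * P⁻¹ * c₂ := by
      rw [hY, ← Matrix.mul_assoc, mul_nonsing_inv _ hCu, Matrix.one_mul]
    refine ⟨P⁻¹ * (Vᵀ * Y - c₂), ?_, ?_⟩
    · rw [← Matrix.mul_assoc, Matrix.mul_sub, ← Matrix.mul_assoc, h3, add_sub_cancel_right]
    · rw [mul_nonsing_inv_cancel_left _ _ hPu, sub_sub_cancel]

end Elimination

/-! ### Block vectors -/

theorem exists_sumElim {n k : Type} (v : n ⊕ k → ℝ) : ∃ x y, v = Sum.elim x y :=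
  ⟨v ∘ Sum.inl, v ∘ Sum.inr, (Sum.elim_comp_inl_inr v).symm⟩

theorem sumElim_inj {n k : Type} {x x' : n → ℝ} {y y' : k → ℝ} :
    Sum.elim x y = Sum.elim x' y' ↔ x = x' ∧ y = y' :=
  ⟨fun h => ⟨funext fun i => congrFun h (Sum.inl i), funext fun i => congrFun h (Sum.inr i)⟩,
    fun h => by rw [h.1, h.2]⟩

theorem sumElim_eq_zero_iff {n k : Type} {x : n → ℝ} {y : k → ℝ} :
    Sum.elim x y = 0 ↔ x = 0 ∧ y = 0 := by
  rw [← Sum.elim_zero_zero, sumElim_inj]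

theorem fromRows_add_fromRows {n k q : Type} (A A' : Matrix n q ℝ) (B B' : Matrix k q ℝ) :
    fromRows A B + fromRows A' B' = fromRows (A + A') (B + B') := by
  ext (i | i) j <;> rfl

theorem fromCols_add_fromCols {n k q : Type} (A A' : Matrix q n ℝ) (B B' : Matrix q k ℝ) :
    fromCols A B + fromCols A' B' = fromCols (A + A') (B + B') := by
  ext i (j | j) <;> rfl

theorem transpose_mulVec_dotProduct {n k : Type} [Fintype n] [Fintype k] (A : Matrix k n ℝ)
    (x : k → ℝ) (y : n → ℝ) : (Aᵀ *ᵥ x) ⬝ᵥ y = x ⬝ᵥ (A *ᵥ y) := by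
  rw [mulVec_transpose, dotProduct_mulVec]

theorem inv_mulVec_mulVec {n : Type} [Fintype n] [DecidableEq n] {A : Matrix n n ℝ}
    (hA : IsUnit A.det) (v : n → ℝ) : A⁻¹ *ᵥ (A *ᵥ v) = v := by
  rw [mulVec_mulVec, nonsing_inv_mul _ hA, one_mulVec]

theorem mulVec_inv_mulVec {n : Type} [Fintype n] [DecidableEq n] {A : Matrix n n ℝ}
    (hA : IsUnit A.det) (v : n → ℝ) : A *ᵥ (A⁻¹ *ᵥ v) = v := by
  rw [mulVec_mulVec, mul_nonsing_inv _ hA, one_mulVec]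

theorem quad_congr {n k : Type} [Fintype n] [Fintype k] (A : Matrix n n ℝ) (T : Matrix n k ℝ)
    (v : k → ℝ) : (T *ᵥ v) ⬝ᵥ (A *ᵥ (T *ᵥ v)) = v ⬝ᵥ ((Tᵀ * A * T) *ᵥ v) := by
  rw [Matrix.mul_assoc, ← mulVec_mulVec, dotProduct_transpose_mulVec, ← mulVec_mulVec,
    dotProduct_comm]

section Pointwise

variable {n d m e y l : Type}
  [Fintype n] [DecidableEq n] [Fintype d] [DecidableEq d] [Fintype m] [DecidableEq m]
  [Fintype e] [DecidableEq e] [Fintype y] [DecidableEq y] [Fintype l] [DecidableEq l]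

/-! ### The feedthrough block and the equations for the transformed gains -/

/-- The matrix `U = [0 0 Dψ1ᵀ D12ᵀ]` through which the control input acts on the blocks
`(w, d, z, e)`. -/
def inputMat (a : AugPlant n d m e y l) : Matrix m (m ⊕ (d ⊕ ((m × l) ⊕ e))) ℝ :=
  fromCols 0 (fromCols 0 (fromCols a.Dψ1ᵀ a.D12ᵀ))

/-- The matrix `V = [I 0 0 0; 0 D21 0 0]` of the signals `(w, D21 d)` available for feedback. -/
def measMat (a : AugPlant n d m e y l) : Matrix (m ⊕ y) (m ⊕ (d ⊕ ((m × l) ⊕ e))) ℝ :=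
  fromRows (fromCols 1 0) (fromCols 0 (fromCols a.D21 0))

/-- The right-hand side of the equation for `B̂_{c1}`, `B̂_{c2}`, without its upper part
`[0; C2]` and up to sign. -/
def rhsB (a : AugPlant n d m e y l) (S : Matrix n n ℝ) (D1 : Matrix m y ℝ) :
    Matrix (m ⊕ (d ⊕ ((m × l) ⊕ e))) n ℝ :=
  fromRows 0 (fromRows (a.B1ᵀ * S)
    (fromRows (a.C0 + a.Dψ1 * D1 * a.C2) (a.C1 + a.D12 * D1 * a.C2)))

/-- The right-hand side of the equation for `Ĉ_c`, without its upper part `B2ᵀ` and up to sign. -/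
def rhsC (a : AugPlant n d m e y l) (R : Matrix n n ℝ) (X : Matrix m m ℝ) (D1 : Matrix m y ℝ)
    (D2 : Matrix m m ℝ) : Matrix (m ⊕ (d ⊕ ((m × l) ⊕ e))) n ℝ :=
  fromRows (Xᵀ * a.B0ᵀ + D2ᵀ * a.B2ᵀ) (fromRows (a.B1ᵀ + a.D21ᵀ * D1ᵀ * a.B2ᵀ)
    (fromRows (a.C0 * R) (a.C1 * R)))

theorem saddle_mul_eq_neg_iff {p q k : Type} [Fintype p] [Fintype k] (V : Matrix p k ℝ)
    (P : Matrix k k ℝ) (Y : Matrix p q ℝ) (Ξ : Matrix k q ℝ) (c₁ : Matrix p q ℝ)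
    (c₂ : Matrix k q ℝ) :
    fromBlocks 0 V Vᵀ (-P) * fromRows Y Ξ = -fromRows c₁ c₂ ↔
      V * Ξ = -c₁ ∧ Vᵀ * Y - P * Ξ = -c₂ := by
  rw [fromBlocks_mul_fromRows, fromRows_neg, fromRows_inj.eq_iff]
  simp [sub_eq_add_neg]

variable (a : AugPlant n d m e y l) (γ : ℝ) (R S : Matrix n n ℝ) (X : Matrix m m ℝ)
  (Xk : l → Matrix m m ℝ)

theorem eqB_iff_exists (D1 : Matrix m y ℝ) (D2 : Matrix m m ℝ) (B1 : Matrix n y ℝ)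
    (B2 : Matrix n m ℝ) :
    EqB a γ S X Xk D1 D2 B1 B2 ↔ ∃ Ξ : Matrix (m ⊕ (d ⊕ ((m × l) ⊕ e))) n ℝ,
      measMat a * Ξ = -fromRows 0 a.C2 ∧
      (measMat a)ᵀ * fromRows B2ᵀ B1ᵀ - PiMat a γ X Xk D1 D2 * Ξ = -rhsB a S D1 :=
  exists_congr fun _ => saddle_mul_eq_neg_iff _ _ _ _ _ _

theorem eqC_iff_exists (D1 : Matrix m y ℝ) (D2 : Matrix m m ℝ) (C : Matrix m n ℝ) :
    EqC a γ R X Xk D1 D2 C ↔ ∃ Ξ : Matrix (m ⊕ (d ⊕ ((m × l) ⊕ e))) n ℝ,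
      inputMat a * Ξ = -a.B2ᵀ ∧
      (inputMat a)ᵀ * C - PiMat a γ X Xk D1 D2 * Ξ = -rhsC a R X D1 D2 :=
  exists_congr fun _ => saddle_mul_eq_neg_iff _ _ _ _ _ _

theorem L1T_eq (h : Gains n m y) : L1T a R X h = rhsC a R X h.D1 h.D2 + (inputMat a)ᵀ * h.C := by
  simp [L1T, rhsC, inputMat, transpose_fromCols, fromRows_mul, fromRows_add_fromRows]

theorem L2T_eq (h : Gains n m y) :
    L2T a S h = rhsB a S h.D1 + (measMat a)ᵀ * fromRows h.B2ᵀ h.B1ᵀ := by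
  simp [L2T, rhsB, measMat, transpose_fromRows, transpose_fromCols, fromRows_mul,
    fromCols_mul_fromRows, fromRows_add_fromRows, -fromRows_fromCols_eq_fromBlocks,
    -fromCols_fromRows_eq_fromBlocks]

/-- The block depends affinely on the feedthrough matrices, through `Uᵀ [D2 D1] V`. -/
theorem feedBlock_quad (D1 : Matrix m y ℝ) (D2 : Matrix m m ℝ)
    (ω : m ⊕ (d ⊕ ((m × l) ⊕ e)) → ℝ) :
    ω ⬝ᵥ (feedBlock a γ X Xk D1 D2 *ᵥ ω) = ω ⬝ᵥ (feedBlock a γ X Xk 0 0 *ᵥ ω)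
      + 2 * ((inputMat a *ᵥ ω) ⬝ᵥ (fromCols D2 D1 *ᵥ (measMat a *ᵥ ω))) := by
  obtain ⟨w, ω, rfl⟩ := exists_sumElim ω
  obtain ⟨dd, ω, rfl⟩ := exists_sumElim ω
  obtain ⟨z, ee, rfl⟩ := exists_sumElim ω
  simp only [feedBlock, symBlock_quad, fromRows_mulVec, sumElim_dotProduct_sumElim, inputMat,
    measMat, fromCols_mulVec_sumElim, zero_mulVec, add_mulVec, dotProduct_add, add_dotProduct,
    transpose_mulVec_dotProduct, Matrix.mul_zero, Matrix.zero_mul, ← mulVec_mulVec, one_mulVec,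
    dotProduct_zero, add_zero, zero_add]
  ring

theorem PiMat_quad (D1 : Matrix m y ℝ) (D2 : Matrix m m ℝ)
    (ω : m ⊕ (d ⊕ ((m × l) ⊕ e)) → ℝ) :
    ω ⬝ᵥ (PiMat a γ X Xk D1 D2 *ᵥ ω) = -(ω ⬝ᵥ (feedBlock a γ X Xk D1 D2 *ᵥ ω)) := by
  rw [PiMat, neg_mulVec, dotProduct_neg]

variable {a γ R S X Xk}

theorem feedBlock_transpose (hXk : ∀ k, (Xk k)ᵀ = Xk k) (D1 : Matrix m y ℝ) (D2 : Matrix m m ℝ) :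
    (feedBlock a γ X Xk D1 D2)ᵀ = feedBlock a γ X Xk D1 D2 := by
  refine symBlock_transpose _ ?_
    (symBlock_transpose _ (by simp) (symBlock_transpose _ ?_ (by simp)))
  · rw [transpose_neg, transpose_sum]
    congr 1
    refine Finset.sum_congr rfl fun k _ => ?_
    rw [transpose_sub, transpose_add, transpose_transpose, hXk, add_comm]
  · rw [transpose_neg, blockDiagonal_transpose]
    simp only [hXk]

/-- At the kernel vector `(x, Ξ x)`, with `Ξ` the auxiliary unknown of the equation for `Ĉ_c`, the
first synthesis inequality is the Schur complement of `Π` in the closed-loop inequality. -/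
theorem quad_schurR_neg {dR : Matrix n n ℝ} {h : Gains n m y}
    (hP : (PiMat a γ X Xk h.D1 h.D2).PosDef) (hker : NegDefOnKer (kerR a) (lmiR a γ R dR X Xk))
    (hC : EqC a γ R X Xk h.D1 h.D2 h.C) {x : n → ℝ} (hx : x ≠ 0) :
    x ⬝ᵥ ((He (a.A * R + a.B2 * h.C) - dR) *ᵥ x)
      + (L1T a R X h *ᵥ x) ⬝ᵥ ((PiMat a γ X Xk h.D1 h.D2)⁻¹ *ᵥ (L1T a R X h *ᵥ x)) < 0 := by
  obtain ⟨Ξ, h1, h2⟩ := (eqC_iff_exists a γ R X Xk h.D1 h.D2 h.C).1 hC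
  have hPu : IsUnit (PiMat a γ X Xk h.D1 h.D2).det := (isUnit_iff_isUnit_det _).1 hP.isUnit
  have hL : L1T a R X h = PiMat a γ X Xk h.D1 h.D2 * Ξ := by
    rw [L1T_eq, ← sub_eq_zero, ← sub_eq_zero.2 h2]; abel
  set ξ := Ξ *ᵥ x with hξ
  have hLx : L1T a R X h *ᵥ x = PiMat a γ X Xk h.D1 h.D2 *ᵥ ξ := by rw [hL, mulVec_mulVec]
  have hUξ : inputMat a *ᵥ ξ = -(a.B2ᵀ *ᵥ x) := by rw [hξ, mulVec_mulVec, h1, neg_mulVec]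
  have hneg := hker (Sum.elim x ξ) (by simp [sumElim_eq_zero_iff, hx]) (by
    change fromCols a.B2ᵀ (inputMat a) *ᵥ Sum.elim x ξ = 0
    rw [fromCols_mulVec_sumElim, hUξ, add_neg_cancel])
  rw [lmiR, symBlock_quad] at hneg
  -- `c` is the block column of the synthesis inequality; `L₁ᵀ` adds the feedthrough terms to it
  have hc : ξ ⬝ᵥ (L1T a R X h *ᵥ x) =
      ξ ⬝ᵥ (fromRows (Xᵀ * a.B0ᵀ) (fromRows a.B1ᵀ (fromRows (a.C0 * R) (a.C1 * R))) *ᵥ x)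
        + (fromCols h.D2 h.D1 *ᵥ (measMat a *ᵥ ξ)) ⬝ᵥ (a.B2ᵀ *ᵥ x)
        + (inputMat a *ᵥ ξ) ⬝ᵥ (h.C *ᵥ x) := by
    clear_value ξ
    clear hneg hLx hUξ
    obtain ⟨w, ω, rfl⟩ := exists_sumElim ξ
    obtain ⟨dd, ω, rfl⟩ := exists_sumElim ω
    obtain ⟨z, ee, rfl⟩ := exists_sumElim ω
    simp only [L1T, fromRows_mulVec, sumElim_dotProduct_sumElim, inputMat,
      measMat, fromCols_mulVec_sumElim, zero_mulVec, add_mulVec, dotProduct_add, add_dotProduct,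
      transpose_mulVec_dotProduct, ← mulVec_mulVec, one_mulVec, Matrix.mul_assoc,
      add_zero, zero_add]
    rw [dotProduct_transpose_mulVec h.D2, dotProduct_transpose_mulVec a.D21,
      transpose_mulVec_dotProduct h.D1, dotProduct_comm (h.D2 *ᵥ w), dotProduct_comm (h.D1 *ᵥ _)]
    ring
  have hfeed := feedBlock_quad a γ X Xk h.D1 h.D2 ξ
  have hPi := PiMat_quad a γ X Xk h.D1 h.D2 ξ
  rw [hLx, inv_mulVec_mulVec hPu, dotProduct_comm (_ *ᵥ _)]
  rw [hLx, hUξ] at hc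
  rw [hUξ] at hfeed
  simp only [neg_dotProduct, transpose_mulVec_dotProduct] at hc hfeed
  rw [sub_mulVec, dotProduct_sub, He_quad] at hneg ⊢
  rw [add_mulVec, dotProduct_add, ← mulVec_mulVec x a.B2]
  rw [dotProduct_comm (fromCols h.D2 h.D1 *ᵥ (measMat a *ᵥ ξ)), transpose_mulVec_dotProduct] at hc
  linarith

theorem lmiS_quad (S dS : Matrix n n ℝ) (x : n → ℝ) (dd : d → ℝ) (z : m × l → ℝ) (ee : e → ℝ) :
    Sum.elim x (Sum.elim z (Sum.elim ee dd)) ⬝ᵥ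
        (lmiS a γ S dS Xk *ᵥ Sum.elim x (Sum.elim z (Sum.elim ee dd))) =
      x ⬝ᵥ ((He (S * a.A) + dS) *ᵥ x)
        + 2 * (Sum.elim 0 (Sum.elim dd (Sum.elim z ee)) ⬝ᵥ (rhsB a S 0 *ᵥ x))
        + Sum.elim 0 (Sum.elim dd (Sum.elim z ee)) ⬝ᵥ
          (feedBlock a γ X Xk 0 0 *ᵥ Sum.elim 0 (Sum.elim dd (Sum.elim z ee))) := by
  simp only [lmiS, rhsB, feedBlock, symBlock_quad, fromRows_mulVec, sumElim_dotProduct_sumElim,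
    zero_mulVec, add_mulVec, dotProduct_add, Matrix.mul_zero, Matrix.zero_mul, ← mulVec_mulVec,
    dotProduct_transpose_mulVec, dotProduct_zero, add_zero, zero_add, mulVec_zero]
  ring

/-- The counterpart of `quad_schurR_neg` for the second synthesis inequality. -/
theorem quad_schurS_neg {dS : Matrix n n ℝ} {h : Gains n m y}
    (hP : (PiMat a γ X Xk h.D1 h.D2).PosDef) (hker : NegDefOnKer (kerS a) (lmiS a γ S dS Xk))
    (hB : EqB a γ S X Xk h.D1 h.D2 h.B1 h.B2) {x : n → ℝ} (hx : x ≠ 0) :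
    x ⬝ᵥ ((He (S * a.A + h.B1 * a.C2) + dS) *ᵥ x)
      + (L2T a S h *ᵥ x) ⬝ᵥ ((PiMat a γ X Xk h.D1 h.D2)⁻¹ *ᵥ (L2T a S h *ᵥ x)) < 0 := by
  obtain ⟨Ξ, h1, h2⟩ := (eqB_iff_exists a γ S X Xk h.D1 h.D2 h.B1 h.B2).1 hB
  have hPu : IsUnit (PiMat a γ X Xk h.D1 h.D2).det := (isUnit_iff_isUnit_det _).1 hP.isUnit
  have hL : L2T a S h = PiMat a γ X Xk h.D1 h.D2 * Ξ := by
    rw [L2T_eq, ← sub_eq_zero, ← sub_eq_zero.2 h2]; abel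
  have hLx : L2T a S h *ᵥ x = PiMat a γ X Xk h.D1 h.D2 *ᵥ (Ξ *ᵥ x) := by rw [hL, mulVec_mulVec]
  have hV : measMat a *ᵥ (Ξ *ᵥ x) = -(fromRows 0 a.C2 *ᵥ x) := by
    rw [mulVec_mulVec, h1, neg_mulVec]
  rw [hLx, inv_mulVec_mulVec hPu, dotProduct_comm (_ *ᵥ _)]
  generalize Ξ *ᵥ x = ξ at *
  have hc : ξ ⬝ᵥ (L2T a S h *ᵥ x) = ξ ⬝ᵥ (rhsB a S 0 *ᵥ x)
      + (inputMat a *ᵥ ξ) ⬝ᵥ (h.D1 *ᵥ (a.C2 *ᵥ x))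
      + (fromRows h.B2ᵀ h.B1ᵀ *ᵥ x) ⬝ᵥ (measMat a *ᵥ ξ) := by
    rw [L2T_eq, add_mulVec, dotProduct_add, ← mulVec_mulVec, dotProduct_transpose_mulVec]
    congr 1
    obtain ⟨w, ω, rfl⟩ := exists_sumElim ξ
    obtain ⟨dd, ω, rfl⟩ := exists_sumElim ω
    obtain ⟨z, ee, rfl⟩ := exists_sumElim ω
    simp only [rhsB, fromRows_mulVec, sumElim_dotProduct_sumElim, inputMat,
      fromCols_mulVec_sumElim, zero_mulVec, add_mulVec, dotProduct_add, add_dotProduct,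
      transpose_mulVec_dotProduct, ← mulVec_mulVec, Matrix.mul_zero, Matrix.zero_mul,
      dotProduct_zero, add_zero, zero_add]
    ring
  have hfeed := feedBlock_quad a γ X Xk h.D1 h.D2 ξ
  have hPi := PiMat_quad a γ X Xk h.D1 h.D2 ξ
  obtain ⟨w, ω, rfl⟩ := exists_sumElim ξ
  obtain ⟨dd, ω, rfl⟩ := exists_sumElim ω
  obtain ⟨z, ee, rfl⟩ := exists_sumElim ω
  have hV' : w = 0 ∧ a.D21 *ᵥ dd = -(a.C2 *ᵥ x) := by
    simp only [measMat, fromRows_mulVec, fromCols_mulVec_sumElim, one_mulVec, zero_mulVec,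
      add_zero, zero_add] at hV
    rw [← Sum.elim_neg_neg, sumElim_inj] at hV
    simpa using hV
  obtain ⟨rfl, hD21⟩ := hV'
  have hneg := hker (Sum.elim x (Sum.elim z (Sum.elim ee dd)))
    (by simp [sumElim_eq_zero_iff, hx])
    (by simp [kerS, hD21])
  rw [lmiS_quad (X := X)] at hneg
  rw [hLx, hV] at hc
  rw [hV] at hfeed
  generalize (Sum.elim 0 (Sum.elim dd (Sum.elim z ee)) : m ⊕ (d ⊕ ((m × l) ⊕ e)) → ℝ) = ξ at *
  have e1 : fromCols h.D2 h.D1 *ᵥ (-(fromRows (0 : Matrix m n ℝ) a.C2 *ᵥ x)) =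
      -(h.D1 *ᵥ (a.C2 *ᵥ x)) := by
    rw [mulVec_neg, fromRows_mulVec, fromCols_mulVec_sumElim, zero_mulVec, mulVec_zero, zero_add]
  have e2 : (fromRows h.B2ᵀ h.B1ᵀ *ᵥ x) ⬝ᵥ (-(fromRows (0 : Matrix m n ℝ) a.C2 *ᵥ x)) =
      -(x ⬝ᵥ (h.B1 *ᵥ (a.C2 *ᵥ x))) := by
    rw [dotProduct_neg, fromRows_mulVec, fromRows_mulVec, sumElim_dotProduct_sumElim, zero_mulVec,
      dotProduct_zero, zero_add, transpose_mulVec_dotProduct]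
  rw [e1, dotProduct_neg] at hfeed
  rw [e2] at hc
  rw [add_mulVec, dotProduct_add, He_quad] at hneg ⊢
  rw [add_mulVec, dotProduct_add, ← mulVec_mulVec x h.B1]
  linarith

/-! ### The Lyapunov matrix -/

/-- The matrix `[R I; Mᵀ 0]`, which transforms the closed-loop state. -/
def lyapT (R M : Matrix n n ℝ) : Matrix (n ⊕ n) (n ⊕ n) ℝ := fromBlocks R 1 Mᵀ 0

/-- The matrix `[I S; 0 Nᵀ] = P [R I; Mᵀ 0]`. -/
def lyapY (S N : Matrix n n ℝ) : Matrix (n ⊕ n) (n ⊕ n) ℝ := fromBlocks 1 S 0 Nᵀ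

variable {M N : Matrix n n ℝ}

theorem factor_transpose (hR : Rᵀ = R) (hS : Sᵀ = S) (hMN : M * Nᵀ = 1 - R * S) :
    S * R + N * Mᵀ = 1 := by
  have h := congrArg transpose hMN
  rw [transpose_mul, transpose_transpose, transpose_sub, transpose_mul, hR, hS, transpose_one] at h
  rw [h, add_sub_cancel]

theorem lyap_mul_lyapT (hR : Rᵀ = R) (hS : Sᵀ = S) (hMN : M * Nᵀ = 1 - R * S)
    (hM : IsUnit M) : lyap R S M N * lyapT R M = lyapY S N := by
  have hMt : IsUnit Mᵀ.det := by rw [det_transpose]; exact (isUnit_iff_isUnit_det _).1 hM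
  rw [lyap, lyapT, lyapY, fromBlocks_multiply, factor_transpose hR hS hMN]
  congr 1
  · rw [Matrix.mul_one, Matrix.mul_zero, add_zero]
  · rw [Matrix.neg_mul, Matrix.mul_assoc _ _ Mᵀ, nonsing_inv_mul _ hMt, Matrix.mul_one,
      add_neg_cancel]
  · rw [Matrix.mul_one, Matrix.mul_zero, add_zero]

theorem lyapT_mulVec_eq_zero (hM : IsUnit M) {ξ : n ⊕ n → ℝ} (h : lyapT R M *ᵥ ξ = 0) : ξ = 0 := by
  obtain ⟨x, z, rfl⟩ := exists_sumElim ξ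
  rw [lyapT, fromBlocks_mulVec] at h
  obtain ⟨h1, h2⟩ := sumElim_eq_zero_iff.1 h
  simp only [Sum.elim_comp_inl, Sum.elim_comp_inr, zero_mulVec, add_zero, one_mulVec] at h1 h2
  have hx : x = 0 := by
    have hMt : IsUnit Mᵀ := by rwa [isUnit_transpose]
    exact mulVec_injective_iff_isUnit.2 hMt (by rw [h2, mulVec_zero])
  subst hx
  rw [mulVec_zero, zero_add] at h1
  rw [h1, Sum.elim_zero_zero]

theorem isUnit_lyapT (hM : IsUnit M) : IsUnit (lyapT R M) :=
  isUnit_of_mulVec_injective fun _ => lyapT_mulVec_eq_zero hM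

theorem lyapT_transpose_mul_lyapY (hR : Rᵀ = R) (hMN : M * Nᵀ = 1 - R * S) :
    (lyapT R M)ᵀ * lyapY S N = fromBlocks R 1 1 S := by
  rw [lyapT, lyapY, fromBlocks_transpose, fromBlocks_multiply, hR, transpose_transpose, hMN]
  simp

theorem lyap_transpose (hR : Rᵀ = R) (hS : Sᵀ = S) (hMN : M * Nᵀ = 1 - R * S)
    (hM : IsUnit M) : (lyap R S M N)ᵀ = lyap R S M N := by
  have hT : IsUnit (lyapT R M).det := (isUnit_iff_isUnit_det _).1 (isUnit_lyapT hM)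
  have h1 := lyap_mul_lyapT hR hS hMN hM
  have h2 := lyapT_transpose_mul_lyapY hR hMN
  rw [← h1, ← Matrix.mul_assoc] at h2
  have h3 := congrArg transpose h2
  rw [transpose_mul, transpose_mul, transpose_transpose, fromBlocks_transpose, hR, hS,
    transpose_one, ← h2, ← Matrix.mul_assoc] at h3
  have hTt : IsUnit (lyapT R M)ᵀ.det := by rwa [det_transpose]
  have h4 := congrArg (fun Z => (lyapT R M)ᵀ⁻¹ * (Z * (lyapT R M)⁻¹)) h3
  simpa only [mul_nonsing_inv_cancel_right _ _ hT, nonsing_inv_mul_cancel_left _ _ hTt] using h4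

/-- `P` is positive definite because it is congruent, by `[R I; Mᵀ 0]`, to the coupling matrix
`[R I; I S]`. -/
theorem lyap_posDef (hR : Rᵀ = R) (hS : Sᵀ = S) (hMN : M * Nᵀ = 1 - R * S)
    (hM : IsUnit M) (hRS : (fromBlocks R 1 1 S).PosDef) : (lyap R S M N).PosDef := by
  refine posDef_iff_dotProduct.2 ⟨lyap_transpose hR hS hMN hM, fun v hv => ?_⟩
  have hT : IsUnit (lyapT R M).det := (isUnit_iff_isUnit_det _).1 (isUnit_lyapT hM)
  obtain ⟨ξ, rfl⟩ : ∃ ξ, lyapT R M *ᵥ ξ = v := ⟨_, mulVec_inv_mulVec hT v⟩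
  have hξ : ξ ≠ 0 := by rintro rfl; exact hv (mulVec_zero _)
  rw [mulVec_mulVec, lyap_mul_lyapT hR hS hMN hM, dotProduct_comm, ← dotProduct_transpose_mulVec,
    mulVec_mulVec, lyapT_transpose_mul_lyapY hR hMN]
  exact PosDef.dotProduct_pos hRS hξ

/-! ### From the transformed gains to the closed loop -/

/-- The block equations that relate the gains `g` to the transformed gains `h`. -/
structure GainRelation (a : AugPlant n d m e y l) (R S M N : Matrix n n ℝ) (X : Matrix m m ℝ)
    (h g : Gains n m y) : Prop where
  A : (N * g.A + S * a.B2 * g.C) * Mᵀ + (N * g.B1 + S * a.B2 * g.D1) * (a.C2 * R) =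
    h.A - S * a.A * R
  B2 : (N * g.B2 + S * a.B2 * g.D2) * X = h.B2 - S * a.B0 * X
  B1 : N * g.B1 + S * a.B2 * g.D1 = h.B1
  C : g.C * Mᵀ + g.D1 * (a.C2 * R) = h.C
  D2 : g.D2 * X = h.D2
  D1 : g.D1 = h.D1

theorem gainRelation_iff {h g : Gains n m y} : GainRelation a R S M N X h g ↔
    leftT a S N * g.toMatrix * rightT a R M X =
      h.toMatrix - fromBlocks (S * a.A * R) (fromCols (S * a.B0 * X) 0) 0 0 := by
  rw [sub_eq_add_neg]
  simp only [leftT, rightT, Gains.toMatrix, fromBlocks_multiply, mul_fromCols,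
    fromCols_add_fromCols, fromCols_mul_fromRows, fromCols_mul_fromBlocks, fromBlocks_neg,
    fromBlocks_add, neg_zero, Matrix.mul_zero, Matrix.zero_mul, Matrix.mul_one, Matrix.one_mul,
    zero_add, add_zero, fromCols_neg, fromBlocks_inj, fromCols_inj.eq_iff, ← sub_eq_add_neg]
  exact ⟨fun ⟨h1, h2, h3, h4, h5, h6⟩ => ⟨h1, ⟨h2, h3⟩, h4, h5, h6⟩,
    fun ⟨h1, ⟨h2, h3⟩, h4, h5, h6⟩ => ⟨h1, h2, h3, h4, h5, h6⟩⟩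

theorem eqGains_iff_relation {h g : Gains n m y} (hL : IsUnit (leftT a S N))
    (hRt : IsUnit (rightT a R M X)) :
    EqGains a R S M N X h g ↔ GainRelation a R S M N X h g := by
  have hL' := (isUnit_iff_isUnit_det _).1 hL
  have hR' := (isUnit_iff_isUnit_det _).1 hRt
  rw [gainRelation_iff, EqGains]
  constructor
  · intro hg
    rw [hg, Matrix.mul_assoc _ _ (rightT a R M X)⁻¹, mul_nonsing_inv_cancel_left _ _ hL',
      nonsing_inv_mul_cancel_right _ _ hR']
  · intro hg
    rw [← hg, Matrix.mul_assoc (leftT a S N), nonsing_inv_mul_cancel_left _ _ hL',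
      mul_nonsing_inv_cancel_right _ _ hR']

/-- The gains in terms of the transformed gains; all but `A` are independent of `h.A`. -/
noncomputable def gainsOfTransformed (a : AugPlant n d m e y l) (R S M N : Matrix n n ℝ)
    (X : Matrix m m ℝ) (h : Gains n m y) : Gains n m y where
  A := N⁻¹ * ((h.A - S * a.A * R - h.B1 * (a.C2 * R)) * (Mᵀ)⁻¹
    - S * a.B2 * ((h.C - h.D1 * (a.C2 * R)) * (Mᵀ)⁻¹))
  B1 := N⁻¹ * (h.B1 - S * a.B2 * h.D1)
  B2 := N⁻¹ * ((h.B2 - S * a.B0 * X) * X⁻¹ - S * a.B2 * (h.D2 * X⁻¹))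
  C := (h.C - h.D1 * (a.C2 * R)) * (Mᵀ)⁻¹
  D1 := h.D1
  D2 := h.D2 * X⁻¹

theorem gainRelation_gainsOfTransformed (hM : IsUnit M) (hN : IsUnit N) (hX : IsUnit X)
    (h : Gains n m y) : GainRelation a R S M N X h (gainsOfTransformed a R S M N X h) := by
  have hM' : IsUnit Mᵀ.det := by rw [det_transpose]; exact (isUnit_iff_isUnit_det _).1 hM
  have hN' := (isUnit_iff_isUnit_det _).1 hN
  have hX' := (isUnit_iff_isUnit_det _).1 hX
  constructor
  · simp only [gainsOfTransformed, mul_nonsing_inv_cancel_left _ _ hN', sub_add_cancel,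
      nonsing_inv_mul_cancel_right _ _ hM']
  · simp only [gainsOfTransformed, mul_nonsing_inv_cancel_left _ _ hN', sub_add_cancel,
      nonsing_inv_mul_cancel_right _ _ hX']
  · simp only [gainsOfTransformed, mul_nonsing_inv_cancel_left _ _ hN', sub_add_cancel]
  · simp only [gainsOfTransformed, nonsing_inv_mul_cancel_right _ _ hM', sub_add_cancel]
  · simp only [gainsOfTransformed, nonsing_inv_mul_cancel_right _ _ hX']
  · rfl

/-- In the transformed state, the off-diagonal block column of the closed-loop inequality is
`[L₁ᵀ L₂ᵀ]`: the products of the gains with `R`, `S`, `M`, `N` combine to the transformed gains. -/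
theorem clRows_mul_lyapT {P : Matrix (n ⊕ n) (n ⊕ n) ℝ} {h g : Gains n m y}
    (hg : GainRelation a R S M N X h g) (hS : Sᵀ = S) (hP : P * lyapT R M = lyapY S N) :
    fromRows (Xᵀ * (clB1 a g)ᵀ * P) (fromRows ((clB2 a g)ᵀ * P)
      (fromRows (clC1 a g) (clC2 a g))) * lyapT R M = fromCols (L1T a R X h) (L2T a S h) := by
  have hB2 := congrArg transpose hg.B2
  have hB1 := congrArg transpose hg.B1
  have hD2 := congrArg transpose hg.D2
  simp only [transpose_mul, transpose_add, transpose_sub, hS] at hB2 hB1 hD2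
  rw [fromRows_mul, fromRows_mul, fromRows_mul, Matrix.mul_assoc _ P, Matrix.mul_assoc _ P, hP]
  have e1 : Xᵀ * (clB1 a g)ᵀ * lyapY S N =
      fromCols (Xᵀ * a.B0ᵀ + h.D2ᵀ * a.B2ᵀ) h.B2ᵀ := by
    rw [clB1, lyapY, transpose_fromRows, mul_fromCols, fromCols_mul_fromBlocks]
    congr 1
    · rw [← hD2]
      simp only [transpose_add, transpose_mul, Matrix.mul_add, Matrix.mul_one, Matrix.mul_zero,
        add_zero, Matrix.mul_assoc]
    · have e : h.B2ᵀ = Xᵀ * (g.B2ᵀ * Nᵀ + g.D2ᵀ * (a.B2ᵀ * S)) + Xᵀ * (a.B0ᵀ * S) := by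
        rw [hB2, sub_add_cancel]
      rw [e]
      simp only [transpose_add, transpose_mul, Matrix.mul_add, Matrix.add_mul, Matrix.mul_assoc]
      abel
  have e2 : (clB2 a g)ᵀ * lyapY S N =
      fromCols (a.B1ᵀ + a.D21ᵀ * h.D1ᵀ * a.B2ᵀ) (a.B1ᵀ * S + a.D21ᵀ * h.B1ᵀ) := by
    rw [clB2, lyapY, transpose_fromRows, fromCols_mul_fromBlocks]
    congr 1
    · rw [← hg.D1]
      simp only [transpose_add, transpose_mul, Matrix.mul_one, Matrix.mul_zero,
        add_zero, Matrix.mul_assoc]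
    · rw [← hB1]
      simp only [transpose_add, transpose_mul, Matrix.mul_add, Matrix.add_mul, Matrix.mul_assoc]
      abel
  have e3 : clC1 a g * lyapT R M =
      fromCols (a.C0 * R + a.Dψ1 * h.C) (a.C0 + a.Dψ1 * h.D1 * a.C2) := by
    rw [clC1, lyapT, fromCols_mul_fromBlocks, ← hg.C, ← hg.D1]
    congr 1
    · simp only [Matrix.mul_add, Matrix.add_mul, Matrix.mul_assoc]
      abel
    · rw [Matrix.mul_one, Matrix.mul_zero, add_zero]
  have e4 : clC2 a g * lyapT R M =
      fromCols (a.C1 * R + a.D12 * h.C) (a.C1 + a.D12 * h.D1 * a.C2) := by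
    rw [clC2, lyapT, fromCols_mul_fromBlocks, ← hg.C, ← hg.D1]
    congr 1
    · simp only [Matrix.mul_add, Matrix.add_mul, Matrix.mul_assoc]
      abel
    · rw [Matrix.mul_one, Matrix.mul_zero, add_zero]
  rw [e1, e2, e3, e4, L1T, L2T]
  ext (i | i | i | i) (j | j) <;> rfl

/-- The transformation of `P A_cl` by `[R I; Mᵀ 0]` is affine in the transformed gains. -/
theorem lyapY_transpose_mul_clA_mul_lyapT {h g : Gains n m y}
    (hg : GainRelation a R S M N X h g) (hS : Sᵀ = S) :
    (lyapY S N)ᵀ * (clA a g * lyapT R M) =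
      fromBlocks (a.A * R + a.B2 * h.C) (a.A + a.B2 * h.D1 * a.C2) h.A
        (S * a.A + h.B1 * a.C2) := by
  rw [lyapY, clA, lyapT, fromBlocks_multiply, fromBlocks_transpose, fromBlocks_multiply,
    transpose_one, transpose_zero, transpose_transpose, hS]
  have hA : h.A = (N * g.A + S * a.B2 * g.C) * Mᵀ + (N * g.B1 + S * a.B2 * g.D1) * (a.C2 * R)
      + S * a.A * R := by rw [hg.A, sub_add_cancel]
  rw [hA, ← hg.C, ← hg.D1, ← hg.B1]
  congr 1
  · simp only [Matrix.mul_add, Matrix.add_mul, Matrix.mul_assoc, Matrix.one_mul, Matrix.zero_mul,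
      add_zero]
    abel
  · simp only [Matrix.mul_add, Matrix.mul_assoc, Matrix.one_mul, Matrix.zero_mul,
      Matrix.mul_one, Matrix.mul_zero, add_zero]
  · simp only [Matrix.mul_add, Matrix.add_mul, Matrix.mul_assoc]
    abel
  · simp only [Matrix.mul_add, Matrix.add_mul, Matrix.mul_assoc, Matrix.mul_one, Matrix.mul_zero,
      add_zero]
    abel

theorem clFeed_eq {h g : Gains n m y} (hg : GainRelation a R S M N X h g) :
    symBlock (-∑ k, (X + Xᵀ - Xk k)) (fromRows 0 (fromRows (clD11 a g * X) (clD21 a g * X)))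
      (symBlock (-(γ • 1)) (fromRows (clD12 a g) (clD22 a g))
        (symBlock (-blockDiagonal Xk) 0 (-(γ • 1)))) = feedBlock a γ X Xk h.D1 h.D2 := by
  have e1 : clD11 a g * X = a.Dψ2 * X + a.Dψ1 * h.D2 := by
    rw [clD11, Matrix.add_mul, Matrix.mul_assoc, hg.D2]
  have e2 : clD21 a g * X = -(a.D12 * X) + a.D12 * h.D2 := by
    rw [clD21, Matrix.add_mul, Matrix.mul_assoc, hg.D2, Matrix.neg_mul]
  rw [e1, e2, clD12, clD22, hg.D1, feedBlock]

/-- The closed-loop inequality in the transformed state `ξ = [R I; Mᵀ 0]⁻¹ x`. -/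
theorem clLMI_quad {P dP : Matrix (n ⊕ n) (n ⊕ n) ℝ} {dR dS dM dN : Matrix n n ℝ}
    {h g : Gains n m y} (hg : GainRelation a R S M N X h g) (hR : Rᵀ = R) (hS : Sᵀ = S)
    (hPt : Pᵀ = P) (hdPt : dPᵀ = dP)
    (hP : P * lyapT R M = lyapY S N)
    (hdP : dP * lyapT R M + P * fromBlocks dR 0 dMᵀ 0 = fromBlocks 0 dS 0 dNᵀ)
    (x z : n → ℝ) (ω : m ⊕ (d ⊕ ((m × l) ⊕ e)) → ℝ) :
    Sum.elim (lyapT R M *ᵥ Sum.elim x z) ω ⬝ᵥ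
        (clLMI a g γ P dP X Xk *ᵥ Sum.elim (lyapT R M *ᵥ Sum.elim x z) ω) =
      x ⬝ᵥ ((He (a.A * R + a.B2 * h.C) - dR) *ᵥ x)
        + z ⬝ᵥ ((He (S * a.A + h.B1 * a.C2) + dS) *ᵥ z)
        + 2 * (z ⬝ᵥ ((h.A + a.Aᵀ + a.C2ᵀ * h.D1ᵀ * a.B2ᵀ - S * dR - N * dMᵀ) *ᵥ x))
        + 2 * (ω ⬝ᵥ (L1T a R X h *ᵥ x + L2T a S h *ᵥ z))
        + ω ⬝ᵥ (feedBlock a γ X Xk h.D1 h.D2 *ᵥ ω) := by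
  have hTP : (lyapT R M)ᵀ * P = (lyapY S N)ᵀ := by
    rw [← hP, transpose_mul, hPt]
  have hHe := lyapY_transpose_mul_clA_mul_lyapT hg hS
  have hdQ : (lyapT R M)ᵀ * dP * lyapT R M =
      fromBlocks (-dR) (R * dS + M * dNᵀ) (-(S * dR + N * dMᵀ)) dS := by
    have e : dP * lyapT R M = fromBlocks 0 dS 0 dNᵀ - P * fromBlocks dR 0 dMᵀ 0 := by
      rw [← hdP, add_sub_cancel_right]
    rw [Matrix.mul_assoc, e, Matrix.mul_sub, ← Matrix.mul_assoc, hTP, lyapT, lyapY,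
      fromBlocks_transpose, fromBlocks_transpose, fromBlocks_multiply, fromBlocks_multiply,
      sub_eq_add_neg, fromBlocks_neg, fromBlocks_add, hR, hS]
    simp [add_comm]
  have hsym : R * dS + M * dNᵀ = (-(S * dR + N * dMᵀ))ᵀ := by
    have e := congrArg transpose hdQ
    rw [transpose_mul, transpose_mul, transpose_transpose, hdPt, ← Matrix.mul_assoc, hdQ,
      fromBlocks_transpose, fromBlocks_inj] at e
    exact e.2.1
  rw [clLMI, symBlock_quad, clFeed_eq hg, mulVec_mulVec _ (fromRows _ _), clRows_mul_lyapT hg hS hP,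
    fromCols_mulVec_sumElim, add_mulVec, dotProduct_add, He_quad, quad_congr, quad_congr, hdQ,
    ← Matrix.mul_assoc, hTP, Matrix.mul_assoc, hHe, hsym]
  simp only [fromBlocks_mulVec, Sum.elim_comp_inl, Sum.elim_comp_inr, sumElim_dotProduct_sumElim,
    dotProduct_add, add_mulVec, sub_mulVec, dotProduct_sub, He_quad, neg_mulVec, dotProduct_neg,
    dotProduct_transpose_mulVec]
  have e : x ⬝ᵥ ((a.B2 * h.D1 * a.C2) *ᵥ z) = z ⬝ᵥ ((a.C2ᵀ * h.D1ᵀ * a.B2ᵀ) *ᵥ x) := by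
    rw [← dotProduct_transpose_mulVec, transpose_mul, transpose_mul, Matrix.mul_assoc]
  rw [e]
  ring

/-- The closed-loop inequality.  In the transformed state the choice of `Â_c` makes the Schur
complement with respect to `Π` block diagonal. -/
theorem clLMI_neg {P dP : Matrix (n ⊕ n) (n ⊕ n) ℝ} {dR dS dM dN : Matrix n n ℝ}
    {h g : Gains n m y} (hg : GainRelation a R S M N X h g) (hR : Rᵀ = R) (hS : Sᵀ = S)
    (hM : IsUnit M) (hPt : Pᵀ = P) (hdPt : dPᵀ = dP)
    (hP : P * lyapT R M = lyapY S N)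
    (hdP : dP * lyapT R M + P * fromBlocks dR 0 dMᵀ 0 = fromBlocks 0 dS 0 dNᵀ)
    (hPi : (PiMat a γ X Xk h.D1 h.D2).PosDef)
    (hkerR : NegDefOnKer (kerR a) (lmiR a γ R dR X Xk))
    (hkerS : NegDefOnKer (kerS a) (lmiS a γ S dS Xk))
    (hB : EqB a γ S X Xk h.D1 h.D2 h.B1 h.B2) (hC : EqC a γ R X Xk h.D1 h.D2 h.C)
    (hA : EqA a γ R S dR N dM X Xk h) {v : (n ⊕ n) ⊕ (m ⊕ (d ⊕ ((m × l) ⊕ e))) → ℝ}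
    (hv : v ≠ 0) : v ⬝ᵥ (clLMI a g γ P dP X Xk *ᵥ v) < 0 := by
  obtain ⟨ζ, ω, rfl⟩ := exists_sumElim v
  have hT : IsUnit (lyapT R M).det := (isUnit_iff_isUnit_det _).1 (isUnit_lyapT hM)
  obtain ⟨ξ, rfl⟩ : ∃ ξ, lyapT R M *ᵥ ξ = ζ := ⟨_, mulVec_inv_mulVec hT ζ⟩
  obtain ⟨x, z, rfl⟩ := exists_sumElim ξ
  rw [clLMI_quad hg hR hS hPt hdPt hP hdP]
  have hPu : IsUnit (PiMat a γ X Xk h.D1 h.D2).det := (isUnit_iff_isUnit_det _).1 hPi.isUnit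
  have hω := PiMat_quad a γ X Xk h.D1 h.D2 ω
  set Pm := PiMat a γ X Xk h.D1 h.D2
  have hcross : h.A + a.Aᵀ + a.C2ᵀ * h.D1ᵀ * a.B2ᵀ - S * dR - N * dMᵀ =
      -((L2T a S h)ᵀ * Pm⁻¹ * L1T a R X h) := by
    rw [hA]; abel
  rw [hcross, neg_mulVec, dotProduct_neg, ← mulVec_mulVec, ← mulVec_mulVec,
    dotProduct_transpose_mulVec, dotProduct_comm (Pm⁻¹ *ᵥ _), dotProduct_add]
  have hx : x ⬝ᵥ ((He (a.A * R + a.B2 * h.C) - dR) *ᵥ x)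
      + (L1T a R X h *ᵥ x) ⬝ᵥ (Pm⁻¹ *ᵥ (L1T a R X h *ᵥ x)) ≤ 0 := by
    rcases eq_or_ne x 0 with rfl | h0
    · simp
    · exact (quad_schurR_neg hPi hkerR hC h0).le
  have hz : z ⬝ᵥ ((He (S * a.A + h.B1 * a.C2) + dS) *ᵥ z)
      + (L2T a S h *ᵥ z) ⬝ᵥ (Pm⁻¹ *ᵥ (L2T a S h *ᵥ z)) ≤ 0 := by
    rcases eq_or_ne z 0 with rfl | h0
    · simp
    · exact (quad_schurS_neg hPi hkerS hB h0).le
  -- complete the square in `ω`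
  set p := L1T a R X h *ᵥ x with hp
  set q := L2T a S h *ᵥ z with hq
  have hsq : (ω - Pm⁻¹ *ᵥ (p + q)) ⬝ᵥ (Pm *ᵥ (ω - Pm⁻¹ *ᵥ (p + q))) =
      ω ⬝ᵥ (Pm *ᵥ ω) - 2 * (ω ⬝ᵥ p + ω ⬝ᵥ q) + p ⬝ᵥ (Pm⁻¹ *ᵥ p) + q ⬝ᵥ (Pm⁻¹ *ᵥ q)
        + 2 * (p ⬝ᵥ (Pm⁻¹ *ᵥ q)) := by
    rw [mulVec_sub, mulVec_inv_mulVec hPu, sub_dotProduct, dotProduct_sub, dotProduct_sub,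
      dotProduct_mulVec_comm (PosDef.transpose_eq hPi) (Pm⁻¹ *ᵥ _), mulVec_inv_mulVec hPu]
    simp only [mulVec_add, dotProduct_add, add_dotProduct]
    rw [dotProduct_comm (Pm⁻¹ *ᵥ p) p, dotProduct_comm (Pm⁻¹ *ᵥ p) q,
      dotProduct_comm (Pm⁻¹ *ᵥ q) p, dotProduct_comm (Pm⁻¹ *ᵥ q) q,
      dotProduct_mulVec_comm (PosDef.transpose_eq hPi.inv) q p]
    ring
  have hqp := dotProduct_mulVec_comm (PosDef.transpose_eq hPi.inv) q p
  have hsq0 := PosDef.dotProduct_nonneg hPi (ω - Pm⁻¹ *ᵥ (p + q))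
  by_cases hxz : x = 0 ∧ z = 0
  · obtain ⟨rfl, rfl⟩ := hxz
    have hω0 : ω ≠ 0 := by
      rintro rfl
      apply hv
      simp
    have := PosDef.dotProduct_pos hPi hω0
    simp only [hp, hq, mulVec_zero, dotProduct_zero]
    linarith
  · have : x ⬝ᵥ ((He (a.A * R + a.B2 * h.C) - dR) *ᵥ x) + p ⬝ᵥ (Pm⁻¹ *ᵥ p)
        + (z ⬝ᵥ ((He (S * a.A + h.B1 * a.C2) + dS) *ᵥ z) + q ⬝ᵥ (Pm⁻¹ *ᵥ q)) < 0 := by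
      rcases not_and_or.1 hxz with h0 | h0
      · exact add_neg_of_neg_of_nonpos (quad_schurR_neg hPi hkerR hC h0) hz
      · exact add_neg_of_nonpos_of_neg hx (quad_schurS_neg hPi hkerS hB h0)
    linarith

theorem clLMI_transpose {P dP : Matrix (n ⊕ n) (n ⊕ n) ℝ} {g : Gains n m y}
    (hdPt : dPᵀ = dP) (hXk : ∀ k, (Xk k)ᵀ = Xk k) :
    (clLMI a g γ P dP X Xk)ᵀ = clLMI a g γ P dP X Xk := by
  refine symBlock_transpose _ (by rw [transpose_add, He_transpose, hdPt]) (symBlock_transpose _ ?_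
    (symBlock_transpose _ (by simp) (symBlock_transpose _ ?_ (by simp))))
  · rw [transpose_neg, transpose_sum]
    congr 1
    refine Finset.sum_congr rfl fun k _ => ?_
    rw [transpose_sub, transpose_add, transpose_transpose, hXk, add_comm]
  · rw [transpose_neg, blockDiagonal_transpose]
    simp only [hXk]

/-! ### The dissipation inequality -/

/-- The dissipation form is the derivative of the storage function `xᵀ P x` minus the supply
`γ |d|² - γ⁻¹ |e|²`, plus the supply of the integral quadratic constraints. -/
theorem clDissip_quad {P dP : Matrix (n ⊕ n) (n ⊕ n) ℝ} (hPt : Pᵀ = P) (g : Gains n m y)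
    (x : n ⊕ n → ℝ) (w : m → ℝ) (dd : d → ℝ) :
    Sum.elim x (Sum.elim w dd) ⬝ᵥ (clDissip a g γ P dP Xk *ᵥ Sum.elim x (Sum.elim w dd)) =
      2 * (x ⬝ᵥ (P *ᵥ (clA a g *ᵥ x + clB1 a g *ᵥ w + clB2 a g *ᵥ dd))) + x ⬝ᵥ (dP *ᵥ x)
        - γ * (dd ⬝ᵥ dd)
        + γ⁻¹ * ((clC2 a g *ᵥ x + clD21 a g *ᵥ w + clD22 a g *ᵥ dd) ⬝ᵥ
            (clC2 a g *ᵥ x + clD21 a g *ᵥ w + clD22 a g *ᵥ dd))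
        + (clC1 a g *ᵥ x + clD11 a g *ᵥ w + clD12 a g *ᵥ dd) ⬝ᵥ
            (blockDiagonal (fun k => (Xk k)⁻¹) *ᵥ
              (clC1 a g *ᵥ x + clD11 a g *ᵥ w + clD12 a g *ᵥ dd))
        - w ⬝ᵥ ((∑ k, (Xk k)⁻¹) *ᵥ w) := by
  have hP : ∀ v : n ⊕ n → ℝ, v ⬝ᵥ (P *ᵥ x) = x ⬝ᵥ (P *ᵥ v) := fun v =>
    dotProduct_mulVec_comm hPt v x
  simp only [clDissip, add_mulVec, sub_mulVec, dotProduct_add, dotProduct_sub, ← quad_congr]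
  simp only [symBlock_quad, add_mulVec, dotProduct_add,
    smul_mulVec, dotProduct_smul, fromCols_mulVec_sumElim, fromRows_mulVec,
    sumElim_dotProduct_sumElim, He_quad, ← mulVec_mulVec, dotProduct_transpose_mulVec,
    zero_mulVec, one_mulVec, zero_add, add_zero, smul_eq_mul,
    dotProduct_zero, neg_mulVec, dotProduct_neg, mulVec_add, add_dotProduct]
  rw [dotProduct_comm (P *ᵥ x) (clB1 a g *ᵥ w), dotProduct_comm (P *ᵥ x) (clB2 a g *ᵥ dd),
    hP, hP]
  ring

theorem blockDiagonal_quad (Y : l → Matrix m m ℝ) (v : m × l → ℝ) :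
    v ⬝ᵥ (blockDiagonal Y *ᵥ v) = ∑ k, (fun i => v (i, k)) ⬝ᵥ (Y k *ᵥ fun i => v (i, k)) := by
  simp only [dotProduct, mulVec, Fintype.sum_prod_type, blockDiagonal_apply]
  rw [Finset.sum_comm]
  simp

/-- The dissipation inequality is a Schur complement of the closed-loop inequality, after the
substitution `w = X w'` and the slack estimate `X + Xᵀ - X_k ≤ Xᵀ X_k⁻¹ X`, which is the
nonnegativity of the form of `X_k` at `w' - X_k⁻¹ X w'`. -/
theorem clDissip_neg {P dP : Matrix (n ⊕ n) (n ⊕ n) ℝ} (hPt : Pᵀ = P) {g : Gains n m y}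
    (hγ : 0 < γ) (hX : IsUnit X) (hXk : ∀ k, (Xk k).PosDef)
    (hneg : ∀ v, v ≠ 0 → v ⬝ᵥ (clLMI a g γ P dP X Xk *ᵥ v) < 0)
    {v : (n ⊕ n) ⊕ (m ⊕ d) → ℝ} (hv : v ≠ 0) :
    v ⬝ᵥ (clDissip a g γ P dP Xk *ᵥ v) < 0 := by
  obtain ⟨x, v, rfl⟩ := exists_sumElim v
  obtain ⟨w, dd, rfl⟩ := exists_sumElim v
  rw [clDissip_quad hPt]
  obtain ⟨w', rfl⟩ : ∃ w', X *ᵥ w' = w :=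
    ⟨_, mulVec_inv_mulVec ((isUnit_iff_isUnit_det _).1 hX) w⟩
  have hu : ∀ k, IsUnit (Xk k).det := fun k => (isUnit_iff_isUnit_det _).1 (hXk k).isUnit
  have hΛ : ∀ v, blockDiagonal Xk *ᵥ (blockDiagonal (fun k => (Xk k)⁻¹) *ᵥ v) = v := fun v => by
    rw [mulVec_mulVec, ← blockDiagonal_mul]
    simp only [mul_nonsing_inv _ (hu _)]
    rw [show (fun _ => 1 : l → Matrix m m ℝ) = 1 from rfl, blockDiagonal_one, one_mulVec]
  set z := clC1 a g *ᵥ x + clD11 a g *ᵥ (X *ᵥ w') + clD12 a g *ᵥ dd with hz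
  set ee := clC2 a g *ᵥ x + clD21 a g *ᵥ (X *ᵥ w') + clD22 a g *ᵥ dd with he
  set zi := blockDiagonal (fun k => (Xk k)⁻¹) *ᵥ z with hzi
  -- the maximizers `z ↦ Λ⁻¹ z`, `e ↦ γ⁻¹ e` of the closed-loop form in its last two blocks
  have key := hneg (Sum.elim x (Sum.elim w' (Sum.elim dd (Sum.elim zi (γ⁻¹ • ee))))) (by
    intro h0
    apply hv
    simp only [sumElim_eq_zero_iff] at h0 ⊢
    exact ⟨h0.1, by rw [h0.2.1, mulVec_zero], h0.2.2.1⟩)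
  have hP : ∀ v : n ⊕ n → ℝ, v ⬝ᵥ (P *ᵥ x) = x ⬝ᵥ (P *ᵥ v) := fun v =>
    dotProduct_mulVec_comm hPt v x
  have hzz : zi ⬝ᵥ z = zi ⬝ᵥ (clC1 a g *ᵥ x) + zi ⬝ᵥ (clD11 a g *ᵥ (X *ᵥ w'))
      + zi ⬝ᵥ (clD12 a g *ᵥ dd) := by rw [hz, dotProduct_add, dotProduct_add]
  have hee : ee ⬝ᵥ ee = ee ⬝ᵥ (clC2 a g *ᵥ x) + ee ⬝ᵥ (clD21 a g *ᵥ (X *ᵥ w'))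
      + ee ⬝ᵥ (clD22 a g *ᵥ dd) := by
    rw [← dotProduct_add, ← dotProduct_add, ← he]
  have hslack : w' ⬝ᵥ ((∑ k, (X + Xᵀ - Xk k)) *ᵥ w') ≤
      (X *ᵥ w') ⬝ᵥ ((∑ k, (Xk k)⁻¹) *ᵥ (X *ᵥ w')) := by
    simp only [sum_mulVec, dotProduct_sum]
    refine Finset.sum_le_sum fun k _ => ?_
    have h := PosDef.dotProduct_nonneg (hXk k) (w' - (Xk k)⁻¹ *ᵥ (X *ᵥ w'))
    rw [mulVec_sub, mulVec_inv_mulVec (hu k), sub_dotProduct, dotProduct_sub, dotProduct_sub,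
      dotProduct_mulVec_comm (PosDef.transpose_eq (hXk k)) (_ *ᵥ _), mulVec_inv_mulVec (hu k),
      dotProduct_comm (_ *ᵥ _)] at h
    rw [sub_mulVec, add_mulVec, dotProduct_sub, dotProduct_add, dotProduct_transpose_mulVec]
    linarith
  simp only [clLMI, add_mulVec, dotProduct_add, symBlock_quad, smul_mulVec, dotProduct_smul,
    smul_dotProduct, fromRows_mulVec, sumElim_dotProduct_sumElim, He_quad, ← mulVec_mulVec,
    dotProduct_transpose_mulVec, transpose_mulVec_dotProduct, zero_mulVec, one_mulVec, zero_add,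
    smul_eq_mul, dotProduct_zero, neg_mulVec, dotProduct_neg] at key
  rw [hzi, hΛ, ← hzi] at key
  rw [dotProduct_comm (P *ᵥ x) (clB1 a g *ᵥ _), dotProduct_comm (P *ᵥ x) (clB2 a g *ᵥ dd),
    hP, hP] at key
  rw [dotProduct_comm z zi]
  simp only [mulVec_add, dotProduct_add]
  have hγγ : γ * γ⁻¹ = 1 := mul_inv_cancel₀ hγ.ne'
  have e1 : γ * (γ⁻¹ * (γ⁻¹ * (ee ⬝ᵥ ee))) = γ⁻¹ * (ee ⬝ᵥ ee) := by
    rw [← mul_assoc, hγγ, one_mul]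
  have e2 : γ⁻¹ * (ee ⬝ᵥ ee) = γ⁻¹ * (ee ⬝ᵥ (clC2 a g *ᵥ x))
      + γ⁻¹ * (ee ⬝ᵥ (clD21 a g *ᵥ (X *ᵥ w'))) + γ⁻¹ * (ee ⬝ᵥ (clD22 a g *ᵥ dd)) := by
    rw [hee]; ring
  linarith

theorem clDissip_transpose {P dP : Matrix (n ⊕ n) (n ⊕ n) ℝ} {g : Gains n m y}
    (hdPt : dPᵀ = dP) (hXk : ∀ k, (Xk k)ᵀ = Xk k) :
    (clDissip a g γ P dP Xk)ᵀ = clDissip a g γ P dP Xk := by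
  have h1 : (blockDiagonal fun k => (Xk k)⁻¹)ᵀ = blockDiagonal fun k => (Xk k)⁻¹ := by
    rw [blockDiagonal_transpose]
    simp only [transpose_nonsing_inv, hXk]
  have h2 : (∑ k, (Xk k)⁻¹)ᵀ = ∑ k, (Xk k)⁻¹ := by
    rw [transpose_sum]
    simp only [transpose_nonsing_inv, hXk]
  rw [clDissip]
  simp only [transpose_add, transpose_sub, transpose_smul, transpose_mul, transpose_transpose, h1,
    h2, Matrix.mul_assoc]
  congr 2
  exact symBlock_transpose _ (by rw [transpose_add, He_transpose, hdPt])
    (symBlock_transpose _ (by simp) (by simp))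

/-- `X` is nonsingular, since `∑ k, (X + Xᵀ - X_k)` is positive definite as a block of `Π`. -/
theorem isUnit_of_slack {D1 : Matrix m y ℝ} {D2 : Matrix m m ℝ} (hXk : ∀ k, (Xk k).PosDef)
    (hPi : (PiMat a γ X Xk D1 D2).PosDef) : IsUnit X := by
  refine isUnit_of_mulVec_injective fun w hw => ?_
  by_contra h0
  have h := PosDef.dotProduct_pos hPi (v := Sum.elim w 0) (by simp [sumElim_eq_zero_iff, h0])
  rw [PiMat_quad, feedBlock, symBlock_quad] at h
  simp only [zero_dotProduct, mulVec_zero, dotProduct_zero, mul_zero, add_zero, neg_mulVec,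
    dotProduct_neg, neg_neg, sum_mulVec, dotProduct_sum] at h
  refine h.not_ge (Finset.sum_nonpos fun k _ => ?_)
  rw [sub_mulVec, add_mulVec, dotProduct_sub, dotProduct_add, dotProduct_transpose_mulVec, hw,
    dotProduct_zero]
  linarith [PosDef.dotProduct_nonneg (hXk k) w]

/-! ### Nonsingularity of the matrices inverted in the reconstruction -/

/-- If `R S v = v`, the form of the coupling matrix vanishes at `(S v, -v)`. -/
theorem isUnit_one_sub_mul (hRS : (fromBlocks R 1 1 S).PosDef) :
    IsUnit (1 - R * S) := by
  refine isUnit_of_mulVec_injective fun v hv => ?_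
  rw [sub_mulVec, one_mulVec, ← mulVec_mulVec, sub_eq_zero] at hv
  by_contra h0
  have hSv : S *ᵥ v ≠ 0 := fun h => by rw [h, mulVec_zero] at hv; exact h0 hv
  have h := PosDef.dotProduct_pos hRS (v := Sum.elim (S *ᵥ v) (-v))
    (by simp [sumElim_eq_zero_iff, h0])
  rw [fromBlocks_mulVec, Sum.elim_comp_inl, Sum.elim_comp_inr, ← hv, one_mulVec, one_mulVec,
    mulVec_neg, sumElim_dotProduct_sumElim] at h
  simp at h

theorem isUnit_factors (h : IsUnit (1 - R * S)) (hMN : M * Nᵀ = 1 - R * S) :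
    IsUnit M ∧ IsUnit N := by
  rw [← hMN, isUnit_iff_isUnit_det, det_mul, IsUnit.mul_iff, det_transpose] at h
  exact ⟨(isUnit_iff_isUnit_det _).2 h.1, (isUnit_iff_isUnit_det _).2 h.2⟩

theorem isUnit_leftT (hN : IsUnit N) : IsUnit (leftT a S N) := by
  rw [isUnit_iff_isUnit_det, leftT, det_fromBlocks_zero₂₁, det_one, mul_one]
  exact (isUnit_iff_isUnit_det _).1 hN

theorem isUnit_rightT (hM : IsUnit M) (hX : IsUnit X) : IsUnit (rightT a R M X) := by
  rw [isUnit_iff_isUnit_det, rightT, det_fromBlocks_zero₁₂, det_fromBlocks_zero₁₂, det_one, mul_one,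
    det_transpose]
  exact ((isUnit_iff_isUnit_det _).1 hM).mul ((isUnit_iff_isUnit_det _).1 hX)

end Pointwise

/-! ### Continuously differentiable matrix functions -/

section Calculus

variable {s : ℕ} {m n k : Type}

/-- `F` is continuously differentiable on a neighbourhood of `ρ`. -/
def C1At (F : (Fin s → ℝ) → Matrix m n ℝ) (ρ : Fin s → ℝ) : Prop :=
  ∀ i j, ContDiffAt ℝ 1 (fun q => F q i j) ρ

variable {ρ ν : Fin s → ℝ} {F F' : (Fin s → ℝ) → Matrix m n ℝ}

theorem C1At.differentiableAt (hF : C1At F ρ) (i : m) (j : n) :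
    DifferentiableAt ℝ (fun q => F q i j) ρ :=
  (hF i j).differentiableAt one_ne_zero

theorem C1At.continuousAt (hF : C1At F ρ) : ContinuousAt F ρ :=
  continuousAt_pi.2 fun i => continuousAt_pi.2 fun j => (hF i j).continuousAt

theorem C1At.const (A : Matrix m n ℝ) : C1At (fun _ => A) ρ := fun _ _ => contDiffAt_const

theorem C1At.sub (hF : C1At F ρ) (hF' : C1At F' ρ) : C1At (fun q => F q - F' q) ρ :=
  fun i j => (hF i j).sub (hF' i j)

theorem C1At.neg (hF : C1At F ρ) : C1At (fun q => -F q) ρ := fun i j => (hF i j).neg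

theorem C1At.transpose (hF : C1At F ρ) : C1At (fun q => (F q)ᵀ) ρ := fun i j => hF j i

theorem C1At.congr (hF : C1At F ρ) (h : F' =ᶠ[𝓝 ρ] F) : C1At F' ρ := fun i j =>
  (hF i j).congr_of_eventuallyEq (h.mono fun q hq => by simp only [hq])

theorem C1At.mul [Fintype n] {H : (Fin s → ℝ) → Matrix n k ℝ} (hF : C1At F ρ) (hH : C1At H ρ) :
    C1At (fun q => F q * H q) ρ := fun i j => by
  simp only [mul_apply]
  exact ContDiffAt.sum fun l _ => (hF i l).mul (hH l j)

theorem C1At.fromBlocks {m' n' : Type} {B : (Fin s → ℝ) → Matrix m n' ℝ}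
    {C : (Fin s → ℝ) → Matrix m' n ℝ} {D : (Fin s → ℝ) → Matrix m' n' ℝ} (hF : C1At F ρ)
    (hB : C1At B ρ) (hC : C1At C ρ) (hD : C1At D ρ) :
    C1At (fun q => Matrix.fromBlocks (F q) (B q) (C q) (D q)) ρ := by
  rintro (i | i) (j | j)
  exacts [hF i j, hB i j, hC i j, hD i j]

theorem C1At.det [Fintype n] [DecidableEq n] {H : (Fin s → ℝ) → Matrix n n ℝ} (hH : C1At H ρ) :
    ContDiffAt ℝ 1 (fun q => (H q).det) ρ := by
  simp only [det_apply']
  refine ContDiffAt.sum fun σ _ => ?_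
  exact contDiffAt_const.mul (contDiffAt_prod fun i _ => hH (σ i) i)

theorem C1At.inv [Fintype n] [DecidableEq n] {H : (Fin s → ℝ) → Matrix n n ℝ} (hH : C1At H ρ)
    (h0 : IsUnit (H ρ)) : C1At (fun q => (H q)⁻¹) ρ := by
  intro i j
  have hdet : (H ρ).det ≠ 0 := ((isUnit_iff_isUnit_det _).1 h0).ne_zero
  have e : (fun q => (H q)⁻¹ i j) =
      fun q => ((H q).det)⁻¹ * ((H q).updateRow j (Pi.single i 1)).det := by
    funext q
    rw [inv_def, Matrix.smul_apply, adjugate_apply, Ring.inverse_eq_inv', smul_eq_mul]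
  rw [e]
  refine (hH.det.inv hdet).mul (C1At.det fun a b => ?_)
  by_cases hab : a = j
  · simp only [hab, updateRow_self]
    exact contDiffAt_const
  · simp only [updateRow_ne hab]
    exact hH a b

theorem C1At.eventually_isUnit [Fintype n] [DecidableEq n] {H : (Fin s → ℝ) → Matrix n n ℝ}
    (hH : C1At H ρ) (h0 : IsUnit (H ρ)) : ∀ᶠ q in 𝓝 ρ, IsUnit (H q) := by
  have hdet : (H ρ).det ≠ 0 := ((isUnit_iff_isUnit_det _).1 h0).ne_zero
  filter_upwards [hH.det.continuousAt.eventually_ne hdet] with q hq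
  exact (isUnit_iff_isUnit_det _).2 (isUnit_iff_ne_zero.2 hq)

theorem dirDeriv_congr (h : F' =ᶠ[𝓝 ρ] F) : dirDeriv F' ρ ν = dirDeriv F ρ ν := by
  ext i j
  have : (fun q => F' q i j) =ᶠ[𝓝 ρ] fun q => F q i j := h.mono fun q hq => by simp only [hq]
  simp only [dirDeriv, of_apply, this.fderiv_eq]

theorem dirDeriv_transpose : dirDeriv (fun q => (F q)ᵀ) ρ ν = (dirDeriv F ρ ν)ᵀ := rfl

theorem dirDeriv_const (A : Matrix m n ℝ) : dirDeriv (fun _ => A) ρ ν = 0 := by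
  ext i j
  simp [dirDeriv]

theorem dirDeriv_mul [Fintype n] {H : (Fin s → ℝ) → Matrix n k ℝ} (hF : C1At F ρ)
    (hH : C1At H ρ) : dirDeriv (fun q => F q * H q) ρ ν =
      dirDeriv F ρ ν * H ρ + F ρ * dirDeriv H ρ ν := by
  ext i j
  have h : HasFDerivAt (fun q => ∑ l, F q i l * H q l j) _ ρ :=
    HasFDerivAt.fun_sum (u := Finset.univ) fun l _ =>
      (hF.differentiableAt i l).hasFDerivAt.mul (hH.differentiableAt l j).hasFDerivAt
  simp only [dirDeriv, of_apply, Matrix.add_apply, mul_apply, h.fderiv, ← Finset.sum_add_distrib]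
  rw [_root_.sum_apply]
  refine Finset.sum_congr rfl fun l _ => ?_
  simp only [_root_.add_apply, _root_.smul_apply, smul_eq_mul]
  ring

theorem dirDeriv_fromBlocks {m' n' : Type} (B : (Fin s → ℝ) → Matrix m n' ℝ)
    (C : (Fin s → ℝ) → Matrix m' n ℝ) (D : (Fin s → ℝ) → Matrix m' n' ℝ) :
    dirDeriv (fun q => Matrix.fromBlocks (F q) (B q) (C q) (D q)) ρ ν =
      Matrix.fromBlocks (dirDeriv F ρ ν) (dirDeriv B ρ ν) (dirDeriv C ρ ν) (dirDeriv D ρ ν) := by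
  ext (i | i) (j | j) <;> rfl

/-- A linear functional on a box is bounded by its value at some vertex. -/
theorem exists_rateVertex_le {νlo νhi : Fin s → ℝ} (hν : ν ∈ RateBox νlo νhi)
    (f : (Fin s → ℝ) →ₗ[ℝ] ℝ) : ∃ ν' ∈ RateVertices νlo νhi, f ν ≤ f ν' := by
  refine ⟨fun i => if 0 ≤ f (Pi.single i 1) then νhi i else νlo i, fun i => ?_, ?_⟩
  · by_cases h : 0 ≤ f (Pi.single i 1)
    · right; simp [h]
    · left; simp [h]
  · rw [LinearMap.pi_apply_eq_sum_univ f ν, LinearMap.pi_apply_eq_sum_univ f]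
    refine Finset.sum_le_sum fun i _ => ?_
    have e : (fun j => if i = j then (1 : ℝ) else 0) = Pi.single i 1 := by
      ext j; simp [Pi.single_apply, eq_comm]
    rw [e, smul_eq_mul, smul_eq_mul]
    by_cases h : 0 ≤ f (Pi.single i 1)
    · simp only [h, if_true]
      exact mul_le_mul_of_nonneg_right (hν i).2 h
    · simp only [h, if_false]
      exact mul_le_mul_of_nonpos_right (hν i).1 (not_le.1 h).le

/-- The quadratic form of a directional derivative, as a linear functional of the direction. -/
noncomputable def dirDerivQuad [Fintype n] (H : (Fin s → ℝ) → Matrix n n ℝ) (ρ : Fin s → ℝ)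
    (x : n → ℝ) : (Fin s → ℝ) →ₗ[ℝ] ℝ :=
  ∑ i, ∑ j, (x i * x j) • (fderiv ℝ (fun q => H q i j) ρ).toLinearMap

theorem dirDerivQuad_apply [Fintype n] (H : (Fin s → ℝ) → Matrix n n ℝ) (ρ ν : Fin s → ℝ)
    (x : n → ℝ) : dirDerivQuad H ρ x ν = x ⬝ᵥ (dirDeriv H ρ ν *ᵥ x) := by
  simp only [dirDerivQuad, LinearMap.sum_apply, LinearMap.smul_apply, dotProduct, mulVec, dirDeriv,
    of_apply, Finset.mul_sum, smul_eq_mul]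
  refine Finset.sum_congr rfl fun i _ => Finset.sum_congr rfl fun j _ => ?_
  simp only [ContinuousLinearMap.coe_coe]
  ring

end Calculus

/-! ### Closed-loop inequalities on the parameter set -/

section Certificate

variable {s np nψ nd nu ne ny L : ℕ}
    {G : Plant s np nd nu ne ny} {F : IQCFilter nψ nu L}
    {Ω : Set (Fin s → ℝ)} {νlo νhi : Fin s → ℝ} {γ : ℝ}
    {Q : Decision (Fin s) (Fin np ⊕ Fin nψ) (Fin nu) (Fin L)}
    {M N : (Fin s → ℝ) → Matrix (Fin np ⊕ Fin nψ) (Fin np ⊕ Fin nψ) ℝ}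
    {h K : LPVGains (Fin s) (Fin np ⊕ Fin nψ) (Fin nu) (Fin ny)}

/-- The inequality is affine in the rate, so it extends from the vertices to the whole box. -/
theorem Feasible.lmi_R_box (hQ : Feasible G F Ω νlo νhi γ Q) {ρ ν : Fin s → ℝ} (hρ : ρ ∈ Ω)
    (hν : ν ∈ RateBox νlo νhi) : NegDefOnKer (kerR (augment G F ρ))
      (lmiR (augment G F ρ) γ (Q.R ρ) (dirDeriv Q.R ρ ν) (Q.X ρ) (Q.Xk ρ)) := by
  intro v hv hker
  obtain ⟨x, ω, rfl⟩ := exists_sumElim v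
  obtain ⟨ν', hν', hle⟩ := exists_rateVertex_le hν (-dirDerivQuad Q.R ρ x)
  have h := hQ.lmi_R ρ hρ ν' hν' _ hv hker
  rw [LinearMap.neg_apply, LinearMap.neg_apply, dirDerivQuad_apply, dirDerivQuad_apply] at hle
  rw [lmiR, symBlock_quad, sub_mulVec, dotProduct_sub] at h ⊢
  linarith

theorem Feasible.lmi_S_box (hQ : Feasible G F Ω νlo νhi γ Q) {ρ ν : Fin s → ℝ} (hρ : ρ ∈ Ω)
    (hν : ν ∈ RateBox νlo νhi) : NegDefOnKer (kerS (augment G F ρ))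
      (lmiS (augment G F ρ) γ (Q.S ρ) (dirDeriv Q.S ρ ν) (Q.Xk ρ)) := by
  intro v hv hker
  obtain ⟨x, ω, rfl⟩ := exists_sumElim v
  obtain ⟨ν', hν', hle⟩ := exists_rateVertex_le hν (dirDerivQuad Q.S ρ x)
  have h := hQ.lmi_S ρ hρ ν' hν' _ hv hker
  rw [dirDerivQuad_apply, dirDerivQuad_apply] at hle
  rw [lmiS, symBlock_quad, add_mulVec, dotProduct_add] at h ⊢
  linarith

theorem IsFactor.isUnit (hQ : Feasible G F Ω νlo νhi γ Q) (hf : IsFactor Ω Q.R Q.S M N)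
    {ρ : Fin s → ℝ} (hρ : ρ ∈ Ω) : IsUnit (M ρ) ∧ IsUnit (N ρ) :=
  isUnit_factors (isUnit_one_sub_mul (hQ.coupling ρ hρ)) (hf.2 ρ hρ).self_of_nhds

/-- `N` inherits differentiability from `R`, `S` and `M`. -/
theorem IsFactor.C1At_N (hQ : Feasible G F Ω νlo νhi γ Q) (hf : IsFactor Ω Q.R Q.S M N)
    {ρ : Fin s → ℝ} (hρ : ρ ∈ Ω) : C1At N ρ := by
  have hM : C1At M ρ := hf.1 ρ hρ
  have hR : C1At Q.R ρ := hQ.R_C1 ρ hρ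
  have hS : C1At Q.S ρ := hQ.S_C1 ρ hρ
  have hu := (hf.isUnit hQ hρ).1
  refine ((hM.inv hu).mul ((C1At.const 1).sub (hR.mul hS))).transpose.congr ?_
  filter_upwards [hM.eventually_isUnit hu, hf.2 ρ hρ] with q h1 h2
  rw [← h2, nonsing_inv_mul_cancel_left _ _ ((isUnit_iff_isUnit_det _).1 h1), transpose_transpose]

theorem IsFactor.C1At_lyap (hQ : Feasible G F Ω νlo νhi γ Q) (hf : IsFactor Ω Q.R Q.S M N)
    {ρ : Fin s → ℝ} (hρ : ρ ∈ Ω) : C1At (fun q => lyap (Q.R q) (Q.S q) (M q) (N q)) ρ := by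
  have hM : C1At M ρ := hf.1 ρ hρ
  have hR : C1At Q.R ρ := hQ.R_C1 ρ hρ
  have hS : C1At Q.S ρ := hQ.S_C1 ρ hρ
  have hN := hf.C1At_N hQ hρ
  have hu := (hf.isUnit hQ hρ).1
  exact hS.fromBlocks hN hN.transpose
    ((hN.transpose.mul hR).mul (hM.transpose.inv (by rwa [isUnit_transpose]))).neg

theorem IsFactor.eventually_lyap (hQ : Feasible G F Ω νlo νhi γ Q) (hf : IsFactor Ω Q.R Q.S M N)
    {ρ : Fin s → ℝ} (hρ : ρ ∈ Ω) : ∀ᶠ q in 𝓝 ρ,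
      (lyap (Q.R q) (Q.S q) (M q) (N q))ᵀ = lyap (Q.R q) (Q.S q) (M q) (N q) ∧
      lyap (Q.R q) (Q.S q) (M q) (N q) * lyapT (Q.R q) (M q) = lyapY (Q.S q) (N q) := by
  filter_upwards [C1At.eventually_isUnit (hf.1 ρ hρ) (hf.isUnit hQ hρ).1, hf.2 ρ hρ] with q h1 h2
  exact ⟨lyap_transpose (hQ.R_symm q) (hQ.S_symm q) h2 h1,
    lyap_mul_lyapT (hQ.R_symm q) (hQ.S_symm q) h2 h1⟩

theorem IsFactor.dirDeriv_lyap_transpose (hQ : Feasible G F Ω νlo νhi γ Q)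
    (hf : IsFactor Ω Q.R Q.S M N) {ρ : Fin s → ℝ} (hρ : ρ ∈ Ω) (ν : Fin s → ℝ) :
    (dirDeriv (fun q => lyap (Q.R q) (Q.S q) (M q) (N q)) ρ ν)ᵀ =
      dirDeriv (fun q => lyap (Q.R q) (Q.S q) (M q) (N q)) ρ ν := by
  rw [← dirDeriv_transpose]
  exact dirDeriv_congr ((hf.eventually_lyap hQ hρ).mono fun q hq => hq.1)

/-- The derivative of `P [R I; Mᵀ 0] = [I S; 0 Nᵀ]`. -/
theorem IsFactor.dirDeriv_lyap_mul (hQ : Feasible G F Ω νlo νhi γ Q)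
    (hf : IsFactor Ω Q.R Q.S M N) {ρ : Fin s → ℝ} (hρ : ρ ∈ Ω) (ν : Fin s → ℝ) :
    dirDeriv (fun q => lyap (Q.R q) (Q.S q) (M q) (N q)) ρ ν * lyapT (Q.R ρ) (M ρ)
        + lyap (Q.R ρ) (Q.S ρ) (M ρ) (N ρ)
          * fromBlocks (dirDeriv Q.R ρ ν) 0 (dirDeriv M ρ ν)ᵀ 0 =
      fromBlocks 0 (dirDeriv Q.S ρ ν) 0 (dirDeriv N ρ ν)ᵀ := by
  have hM : C1At M ρ := hf.1 ρ hρ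
  have hR : C1At Q.R ρ := hQ.R_C1 ρ hρ
  have hT : C1At (fun q => lyapT (Q.R q) (M q)) ρ :=
    hR.fromBlocks (C1At.const 1) hM.transpose (C1At.const 0)
  have h1 : dirDeriv (fun q => lyapT (Q.R q) (M q)) ρ ν =
      fromBlocks (dirDeriv Q.R ρ ν) 0 (dirDeriv M ρ ν)ᵀ 0 := by
    refine (dirDeriv_fromBlocks (fun _ => 1) (fun q => (M q)ᵀ) fun _ => 0).trans ?_
    rw [dirDeriv_const, dirDeriv_const, dirDeriv_transpose]
  have h2 : dirDeriv (fun q => lyapY (Q.S q) (N q)) ρ ν =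
      fromBlocks 0 (dirDeriv Q.S ρ ν) 0 (dirDeriv N ρ ν)ᵀ := by
    refine (dirDeriv_fromBlocks Q.S (fun _ => 0) fun q => (N q)ᵀ).trans ?_
    rw [dirDeriv_const, dirDeriv_const, dirDeriv_transpose]
  rw [← h1, ← h2, ← dirDeriv_mul (hf.C1At_lyap hQ hρ) hT]
  exact dirDeriv_congr ((hf.eventually_lyap hQ hρ).mono fun q hq => hq.2)

theorem Reconstructs.isUnit_X (hQ : Feasible G F Ω νlo νhi γ Q)
    (hK : Reconstructs G F Ω νlo νhi γ Q M N h K) {ρ : Fin s → ℝ} (hρ : ρ ∈ Ω) :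
    IsUnit (Q.X ρ) :=
  isUnit_of_slack (hQ.Xk_pos ρ hρ) (hK.step1 ρ hρ)

/-- Positivity of `P` and the two closed-loop inequalities, at every rate in the box. -/
theorem Reconstructs.certificate (hγ : 0 < γ) (hQ : Feasible G F Ω νlo νhi γ Q)
    (hK : Reconstructs G F Ω νlo νhi γ Q M N h K) {ρ ν : Fin s → ℝ} (hρ : ρ ∈ Ω)
    (hν : ν ∈ RateBox νlo νhi) :
    (lyap (Q.R ρ) (Q.S ρ) (M ρ) (N ρ)).PosDef ∧
      (-clLMI (augment G F ρ) (K.eval ρ ν) γ (lyap (Q.R ρ) (Q.S ρ) (M ρ) (N ρ))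
        (dirDeriv (fun q => lyap (Q.R q) (Q.S q) (M q) (N q)) ρ ν) (Q.X ρ) (Q.Xk ρ)).PosDef ∧
      (-clDissip (augment G F ρ) (K.eval ρ ν) γ (lyap (Q.R ρ) (Q.S ρ) (M ρ) (N ρ))
        (dirDeriv (fun q => lyap (Q.R q) (Q.S q) (M q) (N q)) ρ ν) (Q.Xk ρ)).PosDef := by
  have hf := hK.factor
  obtain ⟨hM, hN⟩ := hf.isUnit hQ hρ
  have hX := hK.isUnit_X hQ hρ
  have hXk := hQ.Xk_pos ρ hρ
  have hMN := (hf.2 ρ hρ).self_of_nhds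
  have hPt := lyap_transpose (hQ.R_symm ρ) (hQ.S_symm ρ) hMN hM
  have hdPt := hf.dirDeriv_lyap_transpose hQ hρ ν
  have hg := (eqGains_iff_relation (isUnit_leftT hN) (isUnit_rightT hM hX)).1 (hK.step4 ρ hρ ν hν)
  have hneg : ∀ v, v ≠ 0 → v ⬝ᵥ (clLMI (augment G F ρ) (K.eval ρ ν) γ
      (lyap (Q.R ρ) (Q.S ρ) (M ρ) (N ρ))
      (dirDeriv (fun q => lyap (Q.R q) (Q.S q) (M q) (N q)) ρ ν) (Q.X ρ) (Q.Xk ρ) *ᵥ v) < 0 :=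
    fun v hv => clLMI_neg hg (hQ.R_symm ρ) (hQ.S_symm ρ) hM hPt hdPt
      (lyap_mul_lyapT (hQ.R_symm ρ) (hQ.S_symm ρ) hMN hM) (hf.dirDeriv_lyap_mul hQ hρ ν)
      (hK.step1 ρ hρ) (hQ.lmi_R_box hρ hν) (hQ.lmi_S_box hρ hν) (hK.step2B ρ hρ) (hK.step2C ρ hρ)
      (hK.step3 ρ hρ ν hν) hv
  refine ⟨lyap_posDef (hQ.R_symm ρ) (hQ.S_symm ρ) hMN hM (hQ.coupling ρ hρ),
    posDef_iff_dotProduct.2 ⟨?_, fun v hv => ?_⟩, posDef_iff_dotProduct.2 ⟨?_, fun v hv => ?_⟩⟩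
  · rw [transpose_neg, clLMI_transpose hdPt fun k => PosDef.transpose_eq (hXk k)]
  · rw [neg_mulVec, dotProduct_neg]
    exact neg_pos.2 (hneg v hv)
  · rw [transpose_neg, clDissip_transpose hdPt fun k => PosDef.transpose_eq (hXk k)]
  · rw [neg_mulVec, dotProduct_neg]
    exact neg_pos.2 (clDissip_neg hPt hγ hX hXk hneg hv)

end Certificate

/-! ### Continuity of block matrices and gains -/

section ContinuousBlocks

variable {T m n k q : Type} [TopologicalSpace T]

@[fun_prop]
theorem continuous_fromRows {A : T → Matrix m n ℝ} {B : T → Matrix k n ℝ} (hA : Continuous A)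
    (hB : Continuous B) : Continuous fun t => fromRows (A t) (B t) := by
  refine continuous_matrix fun i j => ?_
  rcases i with i | i
  exacts [hA.matrix_elem i j, hB.matrix_elem i j]

@[fun_prop]
theorem continuous_fromCols {A : T → Matrix m n ℝ} {B : T → Matrix m k ℝ} (hA : Continuous A)
    (hB : Continuous B) : Continuous fun t => fromCols (A t) (B t) := by
  refine continuous_matrix fun i j => ?_
  rcases j with j | j
  exacts [hA.matrix_elem i j, hB.matrix_elem i j]

@[fun_prop]
theorem continuous_symBlock {A : T → Matrix m m ℝ} {B : T → Matrix n m ℝ} {D : T → Matrix n n ℝ}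
    (hA : Continuous A) (hB : Continuous B) (hD : Continuous D) :
    Continuous fun t => symBlock (A t) (B t) (D t) :=
  hA.matrix_fromBlocks hB.matrix_transpose hB hD

@[fun_prop]
theorem continuous_He {A : T → Matrix m m ℝ} (hA : Continuous A) :
    Continuous fun t => He (A t) :=
  hA.add hA.matrix_transpose

theorem continuous_of_fromRows {A : T → Matrix m n ℝ} {B : T → Matrix k n ℝ}
    (h : Continuous fun t => fromRows (A t) (B t)) : Continuous A ∧ Continuous B :=
  ⟨continuous_matrix fun i j => h.matrix_elem (Sum.inl i) j,
    continuous_matrix fun i j => h.matrix_elem (Sum.inr i) j⟩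

theorem continuous_of_fromCols {A : T → Matrix m n ℝ} {B : T → Matrix m k ℝ}
    (h : Continuous fun t => fromCols (A t) (B t)) : Continuous A ∧ Continuous B :=
  ⟨continuous_matrix fun i j => h.matrix_elem i (Sum.inl j),
    continuous_matrix fun i j => h.matrix_elem i (Sum.inr j)⟩

theorem continuous_of_fromBlocks {A : T → Matrix m n ℝ} {B : T → Matrix m k ℝ}
    {C : T → Matrix q n ℝ} {D : T → Matrix q k ℝ}
    (h : Continuous fun t => fromBlocks (A t) (B t) (C t) (D t)) :
    Continuous A ∧ Continuous B ∧ Continuous C ∧ Continuous D :=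
  ⟨continuous_matrix fun i j => h.matrix_elem (Sum.inl i) (Sum.inl j),
    continuous_matrix fun i j => h.matrix_elem (Sum.inl i) (Sum.inr j),
    continuous_matrix fun i j => h.matrix_elem (Sum.inr i) (Sum.inl j),
    continuous_matrix fun i j => h.matrix_elem (Sum.inr i) (Sum.inr j)⟩

theorem continuous_matrix_inv [Fintype n] [DecidableEq n] {A : T → Matrix n n ℝ}
    (hA : Continuous A) (hu : ∀ t, IsUnit (A t)) : Continuous fun t => (A t)⁻¹ := by
  have h0 : ∀ t, (A t).det ≠ 0 := fun t => ((isUnit_iff_isUnit_det _).1 (hu t)).ne_zero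
  have e : (fun t => (A t)⁻¹) = fun t => ((A t).det)⁻¹ • (A t).adjugate := by
    funext t
    rw [inv_def, Ring.inverse_eq_inv']
  rw [e]
  exact (hA.matrix_det.inv₀ h0).smul hA.matrix_adjugate

end ContinuousBlocks

section ContinuousGains

variable {T n d m e y l : Type} [TopologicalSpace T]
  [Fintype n] [DecidableEq n] [Fintype d] [DecidableEq d] [Fintype m] [DecidableEq m]
  [Fintype e] [DecidableEq e] [Fintype y] [DecidableEq y] [Fintype l] [DecidableEq l]

/-- All coefficients of a family of augmented plants are continuous. -/
structure AugPlant.ContinuousFamily (a : T → AugPlant n d m e y l) : Prop where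
  A : Continuous fun t => (a t).A
  B0 : Continuous fun t => (a t).B0
  B1 : Continuous fun t => (a t).B1
  B2 : Continuous fun t => (a t).B2
  C0 : Continuous fun t => (a t).C0
  Dψ1 : Continuous fun t => (a t).Dψ1
  Dψ2 : Continuous fun t => (a t).Dψ2
  C1 : Continuous fun t => (a t).C1
  D11 : Continuous fun t => (a t).D11
  D12 : Continuous fun t => (a t).D12
  C2 : Continuous fun t => (a t).C2
  D21 : Continuous fun t => (a t).D21

/-- All gains of a family of controllers are continuous. -/
structure Gains.ContinuousFamily (g : T → Gains n m y) : Prop where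
  A : Continuous fun t => (g t).A
  B1 : Continuous fun t => (g t).B1
  B2 : Continuous fun t => (g t).B2
  C : Continuous fun t => (g t).C
  D1 : Continuous fun t => (g t).D1
  D2 : Continuous fun t => (g t).D2

variable {a : T → AugPlant n d m e y l} {γ : ℝ} {R S M N dR dM : T → Matrix n n ℝ}
  {X : T → Matrix m m ℝ} {Xk : T → l → Matrix m m ℝ} {D1 : T → Matrix m y ℝ}
  {D2 : T → Matrix m m ℝ}

theorem continuous_PiMat (ha : AugPlant.ContinuousFamily a) (hX : Continuous X)
    (hXk : Continuous Xk) (hD1 : Continuous D1) (hD2 : Continuous D2) :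
    Continuous fun t => PiMat (a t) γ (X t) (Xk t) (D1 t) (D2 t) := by
  obtain ⟨-, -, -, -, -, h6, h7, -, h9, h10, -, h12⟩ := ha
  have hXk' : ∀ k, Continuous fun t => Xk t k := fun k => (continuous_apply k).comp hXk
  unfold PiMat feedBlock
  fun_prop

theorem continuous_B_of_eqB (ha : AugPlant.ContinuousFamily a) (hS : Continuous S)
    (hX : Continuous X)
    (hXk : Continuous Xk) (hD1 : Continuous D1) (hD2 : Continuous D2) {B1 : T → Matrix n y ℝ}
    {B2 : T → Matrix n m ℝ}
    (hP : ∀ t, (PiMat (a t) γ (X t) (Xk t) (D1 t) (D2 t)).PosDef)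
    (hV : ∀ t z, (measMat (a t))ᵀ *ᵥ z = 0 → z = 0)
    (h : ∀ t, EqB (a t) γ (S t) (X t) (Xk t) (D1 t) (D2 t) (B1 t) (B2 t)) :
    Continuous B1 ∧ Continuous B2 := by
  have hPc := continuous_PiMat (γ := γ) ha hX hXk hD1 hD2
  have hPi := continuous_matrix_inv hPc fun t => (hP t).isUnit
  obtain ⟨h1, h2, h3, h4, h5, h6, h7, h8, h9, h10, h11, h12⟩ := ha
  have hVc : Continuous fun t => measMat (a t) := by unfold measMat; fun_prop
  have hrhs : Continuous fun t => rhsB (a t) (S t) (D1 t) := by unfold rhsB; fun_prop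
  have hC := continuous_matrix_inv (by fun_prop)
    fun t => (posDef_compression (hP t) (hV t)).isUnit
  have hY : Continuous fun t => fromRows (B2 t)ᵀ (B1 t)ᵀ := by
    have e := fun t => (saddle_iff (hP t) (hV t) _ _ _).1
      ((eqB_iff_exists _ _ _ _ _ _ _ _ _).1 (h t))
    simp only [e]
    fun_prop
  obtain ⟨h2, h1⟩ := continuous_of_fromRows hY
  exact ⟨by simpa using h1.matrix_transpose, by simpa using h2.matrix_transpose⟩

theorem continuous_C_of_eqC (ha : AugPlant.ContinuousFamily a) (hR : Continuous R)
    (hX : Continuous X)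
    (hXk : Continuous Xk) (hD1 : Continuous D1) (hD2 : Continuous D2) {C : T → Matrix m n ℝ}
    (hP : ∀ t, (PiMat (a t) γ (X t) (Xk t) (D1 t) (D2 t)).PosDef)
    (hU : ∀ t z, (inputMat (a t))ᵀ *ᵥ z = 0 → z = 0)
    (h : ∀ t, EqC (a t) γ (R t) (X t) (Xk t) (D1 t) (D2 t) (C t)) : Continuous C := by
  have hPc := continuous_PiMat (γ := γ) ha hX hXk hD1 hD2
  have hPi := continuous_matrix_inv hPc fun t => (hP t).isUnit
  obtain ⟨h1, h2, h3, h4, h5, h6, h7, h8, h9, h10, h11, h12⟩ := ha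
  have hUc : Continuous fun t => inputMat (a t) := by unfold inputMat; fun_prop
  have hrhs : Continuous fun t => rhsC (a t) (R t) (X t) (D1 t) (D2 t) := by
    unfold rhsC; fun_prop
  have hC := continuous_matrix_inv (by fun_prop)
    fun t => (posDef_compression (hP t) (hU t)).isUnit
  have e := fun t => (saddle_iff (hP t) (hU t) _ _ _).1 ((eqC_iff_exists _ _ _ _ _ _ _ _).1 (h t))
  have e' : C = _ := funext e
  rw [e']
  fun_prop

theorem continuous_A_of_eqA (ha : AugPlant.ContinuousFamily a) {h : T → Gains n m y}
    (hR : Continuous R) (hS : Continuous S) (hN : Continuous N) (hdR : Continuous dR)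
    (hdM : Continuous dM) (hX : Continuous X) (hXk : Continuous Xk)
    (hB1 : Continuous fun t => (h t).B1) (hB2 : Continuous fun t => (h t).B2)
    (hC : Continuous fun t => (h t).C)
    (hD1 : Continuous fun t => (h t).D1) (hD2 : Continuous fun t => (h t).D2)
    (hP : ∀ t, (PiMat (a t) γ (X t) (Xk t) (h t).D1 (h t).D2).PosDef)
    (hA : ∀ t, EqA (a t) γ (R t) (S t) (dR t) (N t) (dM t) (X t) (Xk t) (h t)) :
    Continuous fun t => (h t).A := by
  have hPi := continuous_matrix_inv (continuous_PiMat (γ := γ) ha hX hXk hD1 hD2)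
    fun t => (hP t).isUnit
  obtain ⟨h1, h2, h3, h4, h5, h6, h7, h8, h9, h10, h11, h12⟩ := ha
  have e : (fun t => (h t).A) = _ := funext hA
  rw [e]
  unfold L1T L2T
  fun_prop

theorem continuous_gains_of_eqGains (ha : AugPlant.ContinuousFamily a) {h g : T → Gains n m y}
    (hh : Gains.ContinuousFamily h) (hR : Continuous R) (hS : Continuous S) (hM : Continuous M)
    (hN : Continuous N) (hX : Continuous X)
    (hL : ∀ t, IsUnit (leftT (a t) (S t) (N t)))
    (hRt : ∀ t, IsUnit (rightT (a t) (R t) (M t) (X t)))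
    (hg : ∀ t, EqGains (a t) (R t) (S t) (M t) (N t) (X t) (h t) (g t)) :
    Gains.ContinuousFamily g := by
  obtain ⟨h1, h2, h3, h4, h5, h6, h7, h8, h9, h10, h11, h12⟩ := ha
  obtain ⟨k1, k2, k3, k4, k5, k6⟩ := hh
  have hLc := continuous_matrix_inv (by unfold leftT; fun_prop) hL
  have hRc := continuous_matrix_inv (by unfold rightT; fun_prop) hRt
  have hgc : Continuous fun t => (g t).toMatrix := by
    have e : (fun t => (g t).toMatrix) = _ := funext hg
    rw [e]
    unfold Gains.toMatrix
    fun_prop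
  obtain ⟨q1, q2, q3, q4⟩ := continuous_of_fromBlocks hgc
  obtain ⟨q5, q6⟩ := continuous_of_fromCols q2
  obtain ⟨q7, q8⟩ := continuous_of_fromCols q4
  exact ⟨q1, q6, q5, q3, q8, q7⟩

theorem continuous_clDissip (ha : AugPlant.ContinuousFamily a) {g : T → Gains n m y}
    (hg : Gains.ContinuousFamily g) {P dP : T → Matrix (n ⊕ n) (n ⊕ n) ℝ} (hP : Continuous P)
    (hdP : Continuous dP) (hXk : ∀ k, Continuous fun t => (Xk t k)⁻¹) :
    Continuous fun t => clDissip (a t) (g t) γ (P t) (dP t) (Xk t) := by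
  obtain ⟨h1, h2, h3, h4, h5, h6, h7, h8, h9, h10, h11, h12⟩ := ha
  obtain ⟨k1, k2, k3, k4, k5, k6⟩ := hg
  have hX : Continuous fun t => fun k => (Xk t k)⁻¹ := continuous_pi hXk
  unfold clDissip clA clB1 clB2 clC1 clC2 clD11 clD12 clD21 clD22
  dsimp only
  fun_prop

end ContinuousGains

/-! ### Feasibility of the reconstruction steps -/

theorem mulVec_eq_zero_of_rank {k p : ℕ} {A : Matrix (Fin k) (Fin p) ℝ} (hA : A.rank = p)
    {z : Fin p → ℝ} (hz : A *ᵥ z = 0) : z = 0 := by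
  have h := LinearMap.finrank_range_add_finrank_ker A.mulVecLin
  rw [← Matrix.rank, hA, Module.finrank_fin_fun] at h
  have h0 : LinearMap.ker A.mulVecLin = ⊥ := Submodule.finrank_eq_zero.1 (by omega)
  have : z ∈ LinearMap.ker A.mulVecLin := hz
  rwa [h0, Submodule.mem_bot] at this

section Feasibility

variable {s np nψ nd nu ne ny L : ℕ}
    {G : Plant s np nd nu ne ny} {F : IQCFilter nψ nu L}
    {Ω : Set (Fin s → ℝ)} {νlo νhi : Fin s → ℝ} {γ : ℝ}
    {Q : Decision (Fin s) (Fin np ⊕ Fin nψ) (Fin nu) (Fin L)}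
    {M N : (Fin s → ℝ) → Matrix (Fin np ⊕ Fin nψ) (Fin np ⊕ Fin nψ) ℝ}
    {h K : LPVGains (Fin s) (Fin np ⊕ Fin nψ) (Fin nu) (Fin ny)}

theorem Plant.Regular.inputMat_injective (hG : G.Regular Ω) {ρ : Fin s → ℝ} (hρ : ρ ∈ Ω)
    (z : Fin nu → ℝ) (hz : (inputMat (augment G F ρ))ᵀ *ᵥ z = 0) : z = 0 := by
  simp only [inputMat, transpose_fromCols, fromRows_mulVec, sumElim_eq_zero_iff,
    transpose_transpose] at hz
  exact mulVec_eq_zero_of_rank (hG.rank_D12 ρ hρ) hz.2.2.2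

theorem Plant.Regular.measMat_injective (hG : G.Regular Ω) {ρ : Fin s → ℝ} (hρ : ρ ∈ Ω)
    (z : Fin nu ⊕ Fin ny → ℝ) (hz : (measMat (augment G F ρ))ᵀ *ᵥ z = 0) : z = 0 := by
  obtain ⟨w, y, rfl⟩ := exists_sumElim z
  simp only [measMat, transpose_fromRows, fromCols_mulVec_sumElim] at hz
  simp only [transpose_fromCols, fromRows_mulVec, transpose_one, transpose_zero, one_mulVec,
    zero_mulVec, ← Sum.elim_add_add, sumElim_eq_zero_iff, add_zero, zero_add] at hz
  rw [sumElim_eq_zero_iff]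
  exact ⟨hz.1, mulVec_eq_zero_of_rank (by rw [rank_transpose]; exact hG.rank_D21 ρ hρ) hz.2.1⟩

/-- Pointwise solvability of `Π > 0`, by elimination of `[D̂_{c2} D̂_{c1}]`; the two synthesis
inequalities at vectors with vanishing state component are its solvability conditions. -/
theorem Feasible.exists_posDef_PiMat (hG : G.Regular Ω) (hQ : Feasible G F Ω νlo νhi γ Q)
    {ρ : Fin s → ℝ} (hρ : ρ ∈ Ω) : ∃ (D1 : Matrix (Fin nu) (Fin ny) ℝ)
      (D2 : Matrix (Fin nu) (Fin nu) ℝ),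
      (PiMat (augment G F ρ) γ (Q.X ρ) (Q.Xk ρ) D1 D2).PosDef := by
  have hXk : ∀ k, (Q.Xk ρ k)ᵀ = Q.Xk ρ k := fun k => PosDef.transpose_eq (hQ.Xk_pos ρ hρ k)
  have hv : νlo ∈ RateVertices νlo νhi := fun k => Or.inl rfl
  obtain ⟨D, hD⟩ := exists_eliminate (Q := feedBlock (augment G F ρ) γ (Q.X ρ) (Q.Xk ρ) 0 0)
    (U := inputMat (augment G F ρ)) (V := measMat (augment G F ρ))
    (feedBlock_transpose hXk 0 0) (fun ω hω hker => by
      have h := hQ.lmi_R ρ hρ νlo hv (Sum.elim 0 ω) (by simp [sumElim_eq_zero_iff, hω]) (by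
        change fromCols _ (inputMat (augment G F ρ)) *ᵥ Sum.elim 0 ω = 0
        rw [fromCols_mulVec_sumElim, mulVec_zero, zero_add, hker])
      rw [lmiR, symBlock_quad] at h
      simpa using h) (fun ω hω hker => by
      obtain ⟨w, ω, rfl⟩ := exists_sumElim ω
      obtain ⟨dd, ω, rfl⟩ := exists_sumElim ω
      obtain ⟨z, ee, rfl⟩ := exists_sumElim ω
      simp only [measMat, fromRows_mulVec, fromCols_mulVec_sumElim, one_mulVec, zero_mulVec,
        add_zero, zero_add, sumElim_eq_zero_iff] at hker
      obtain ⟨rfl, hd⟩ := hker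
      simp only [ne_eq, sumElim_eq_zero_iff, true_and] at hω
      have h := hQ.lmi_S ρ hρ νlo hv (Sum.elim 0 (Sum.elim z (Sum.elim ee dd)))
        (by simp only [ne_eq, sumElim_eq_zero_iff, true_and]; tauto)
        (by simp [kerS, hd])
      rw [lmiS_quad (X := Q.X ρ)] at h
      simpa using h) (hG.measMat_injective hρ)
  have hD' : D = fromCols D.toCols₁ D.toCols₂ := (fromCols_toCols D).symm
  refine ⟨D.toCols₂, D.toCols₁, posDef_iff_dotProduct.2 ⟨?_, fun ω hω => ?_⟩⟩
  · rw [PiMat, transpose_neg, feedBlock_transpose hXk]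
  · rw [PiMat_quad, feedBlock_quad, ← hD']
    linarith [hD ω hω]

theorem Plant.Regular.continuousFamily_augment (hG : G.Regular Ω) {T : Type} [TopologicalSpace T]
    {p : T → Fin s → ℝ} (hp : Continuous p) (hpΩ : ∀ t, p t ∈ Ω) :
    AugPlant.ContinuousFamily fun t => augment G F (p t) := by
  have hA := hG.A.comp_continuous hp hpΩ
  have hB1 := hG.B1.comp_continuous hp hpΩ
  have hB2 := hG.B2.comp_continuous hp hpΩ
  have hC1 := hG.C1.comp_continuous hp hpΩ
  have hD11 := hG.D11.comp_continuous hp hpΩ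
  have hD12 := hG.D12.comp_continuous hp hpΩ
  have hC2 := hG.C2.comp_continuous hp hpΩ
  have hD21 := hG.D21.comp_continuous hp hpΩ
  constructor <;> simp only [augment] <;> first | assumption | fun_prop

theorem eventually_quad_pos {T n : Type} [TopologicalSpace T] [Fintype n] {A : T → Matrix n n ℝ}
    (hA : Continuous A) {t₀ : T} (h0 : ∀ v, v ≠ 0 → 0 < v ⬝ᵥ (A t₀ *ᵥ v)) :
    ∀ᶠ t in 𝓝 t₀, ∀ v, v ≠ 0 → 0 < v ⬝ᵥ (A t *ᵥ v) := by
  have hopen : IsOpen {z : T × (n → ℝ) | 0 < z.2 ⬝ᵥ (A z.1 *ᵥ z.2)} :=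
    isOpen_lt continuous_const (continuous_quad_prod hA)
  obtain ⟨U, V, hU, -, htU, hSV, hUV⟩ := generalized_tube_lemma (isCompact_singleton (x := t₀))
    (isCompact_unitSphere (n := n)) hopen (by
      rintro ⟨t, v⟩ ⟨ht, hv⟩
      obtain rfl : t = t₀ := ht
      exact h0 v (by rintro rfl; simp at hv))
  filter_upwards [hU.mem_nhds (htU rfl)] with t ht v hv
  obtain ⟨c, hc, u, hu, rfl⟩ := exists_smul_unitSphere hv
  rw [smul_quad]
  exact mul_pos (pow_pos hc 2) (hUV (show (t, u) ∈ U ×ˢ V from ⟨ht, hSV hu⟩))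

/-- The condition `Π > 0` is solvable by continuous feedthrough terms: it is convex in them, and a
pointwise solution remains one at nearby parameters. -/
theorem Feasible.exists_continuous_step1 (hG : G.Regular Ω) (hQ : Feasible G F Ω νlo νhi γ Q) :
    ∃ (Dh1 : (Fin s → ℝ) → Matrix (Fin nu) (Fin ny) ℝ)
      (Dh2 : (Fin s → ℝ) → Matrix (Fin nu) (Fin nu) ℝ),
      ContinuousOn Dh1 Ω ∧ ContinuousOn Dh2 Ω ∧ Step1 G F Ω γ Q Dh1 Dh2 := by
  have hXk : ∀ (ρ : Ω) k, (Q.Xk ρ k)ᵀ = Q.Xk ρ k := fun ρ k =>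
    PosDef.transpose_eq (hQ.Xk_pos ρ ρ.2 k)
  let t : Ω → Set (Matrix (Fin nu) (Fin ny) ℝ × Matrix (Fin nu) (Fin nu) ℝ) := fun ρ =>
    {D | ∀ ω, ω ≠ 0 → 0 < ω ⬝ᵥ (PiMat (augment G F ρ) γ (Q.X ρ) (Q.Xk ρ) D.1 D.2 *ᵥ ω)}
  have hconv : ∀ ρ, Convex ℝ (t ρ) := by
    intro ρ D hD D' hD' α β hα hβ hαβ ω hω
    have h1 := hD ω hω
    have h2 := hD' ω hω
    rw [PiMat_quad, feedBlock_quad] at h1 h2 ⊢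
    have e : fromCols (α • D + β • D').2 (α • D + β • D').1 =
        α • fromCols D.2 D.1 + β • fromCols D'.2 D'.1 := by
      ext i (j | j) <;> rfl
    rw [e, add_mulVec, smul_mulVec, smul_mulVec, dotProduct_add, dotProduct_smul, dotProduct_smul,
      smul_eq_mul, smul_eq_mul]
    obtain rfl : β = 1 - α := by linarith
    rcases hα.eq_or_lt with rfl | hα
    · linarith
    · nlinarith [mul_pos hα h1, mul_nonneg hβ h2.le]
  obtain ⟨g, hg⟩ := exists_continuous_forall_mem_convex_of_local_const hconv fun ρ => by
    obtain ⟨D1, D2, hD⟩ := hQ.exists_posDef_PiMat hG ρ.2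
    refine ⟨(D1, D2), eventually_quad_pos (A := fun ρ : Ω =>
      PiMat (augment G F ρ) γ (Q.X ρ) (Q.Xk ρ) D1 D2) ?_ fun v hv => PosDef.dotProduct_pos hD hv⟩
    exact continuous_PiMat
      (hG.continuousFamily_augment continuous_subtype_val fun t => t.2)
      (hQ.X_cont.comp_continuous continuous_subtype_val fun t => t.2)
      (hQ.Xk_cont.comp_continuous continuous_subtype_val fun t => t.2)
      continuous_const continuous_const
  classical
  refine ⟨fun ρ => if hρ : ρ ∈ Ω then (g ⟨ρ, hρ⟩).1 else 0,
    fun ρ => if hρ : ρ ∈ Ω then (g ⟨ρ, hρ⟩).2 else 0, ?_, ?_, fun ρ hρ => ?_⟩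
  · rw [continuousOn_iff_continuous_domRestrict]
    refine (continuous_fst.comp g.continuous).congr fun ρ => ?_
    simp
  · rw [continuousOn_iff_continuous_domRestrict]
    refine (continuous_snd.comp g.continuous).congr fun ρ => ?_
    simp
  · simp only [hρ, dif_pos]
    refine posDef_iff_dotProduct.2 ⟨?_, hg ⟨ρ, hρ⟩⟩
    rw [PiMat, transpose_neg, feedBlock_transpose (hXk ⟨ρ, hρ⟩)]

theorem Step1.existsUnique_B (hG : G.Regular Ω)
    {Dh1 : (Fin s → ℝ) → Matrix (Fin nu) (Fin ny) ℝ}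
    {Dh2 : (Fin s → ℝ) → Matrix (Fin nu) (Fin nu) ℝ} (h1 : Step1 G F Ω γ Q Dh1 Dh2)
    {ρ : Fin s → ℝ} (hρ : ρ ∈ Ω) :
    ∃! B : Matrix (Fin np ⊕ Fin nψ) (Fin ny) ℝ × Matrix (Fin np ⊕ Fin nψ) (Fin nu) ℝ,
      EqB (augment G F ρ) γ (Q.S ρ) (Q.X ρ) (Q.Xk ρ) (Dh1 ρ) (Dh2 ρ) B.1 B.2 := by
  simp only [eqB_iff_exists, saddle_iff (h1 ρ hρ) (hG.measMat_injective hρ)]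
  set Y := (measMat (augment G F ρ) * (PiMat (augment G F ρ) γ (Q.X ρ) (Q.Xk ρ) (Dh1 ρ)
    (Dh2 ρ))⁻¹ * (measMat (augment G F ρ))ᵀ)⁻¹ * (-fromRows 0 (augment G F ρ).C2
      + measMat (augment G F ρ) * (PiMat (augment G F ρ) γ (Q.X ρ) (Q.Xk ρ) (Dh1 ρ) (Dh2 ρ))⁻¹
        * -rhsB (augment G F ρ) (Q.S ρ) (Dh1 ρ))
  refine ⟨(Y.toRows₂ᵀ, Y.toRows₁ᵀ), ?_, ?_⟩
  · simp only [transpose_transpose, fromRows_toRows]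
  · rintro ⟨B1, B2⟩ hB
    simp only at hB
    rw [← hB, toRows₂_fromRows, toRows₁_fromRows, transpose_transpose, transpose_transpose]

theorem Step1.existsUnique_C (hG : G.Regular Ω)
    {Dh1 : (Fin s → ℝ) → Matrix (Fin nu) (Fin ny) ℝ}
    {Dh2 : (Fin s → ℝ) → Matrix (Fin nu) (Fin nu) ℝ} (h1 : Step1 G F Ω γ Q Dh1 Dh2)
    {ρ : Fin s → ℝ} (hρ : ρ ∈ Ω) :
    ∃! C : Matrix (Fin nu) (Fin np ⊕ Fin nψ) ℝ,
      EqC (augment G F ρ) γ (Q.R ρ) (Q.X ρ) (Q.Xk ρ) (Dh1 ρ) (Dh2 ρ) C := by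
  simp only [eqC_iff_exists, saddle_iff (h1 ρ hρ) (hG.inputMat_injective hρ)]
  exact existsUnique_eq

theorem exists_isFactor {n : Type} [Fintype n] [DecidableEq n]
    (R S : (Fin s → ℝ) → Matrix n n ℝ) : ∃ M N, IsFactor Ω R S M N :=
  ⟨fun _ => 1, fun q => (1 - R q * S q)ᵀ, fun _ _ => C1At.const 1, fun _ _ =>
    Eventually.of_forall fun q => by rw [transpose_transpose, Matrix.one_mul]⟩

/-- The slack variable `X` is nonsingular. -/
theorem Feasible.isUnit_X (hG : G.Regular Ω) (hQ : Feasible G F Ω νlo νhi γ Q) {ρ : Fin s → ℝ}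
    (hρ : ρ ∈ Ω) : IsUnit (Q.X ρ) := by
  obtain ⟨D1, D2, hD⟩ := hQ.exists_posDef_PiMat hG hρ
  exact isUnit_of_slack (hQ.Xk_pos ρ hρ) hD

theorem Step1.exists_reconstructs (hG : G.Regular Ω) (hQ : Feasible G F Ω νlo νhi γ Q)
    {Dh1 : (Fin s → ℝ) → Matrix (Fin nu) (Fin ny) ℝ}
    {Dh2 : (Fin s → ℝ) → Matrix (Fin nu) (Fin nu) ℝ} (h1 : Step1 G F Ω γ Q Dh1 Dh2)
    (hf : IsFactor Ω Q.R Q.S M N) :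
    ∃ h K : LPVGains (Fin s) (Fin np ⊕ Fin nψ) (Fin nu) (Fin ny),
        h.D1 = Dh1 ∧ h.D2 = Dh2 ∧ Reconstructs G F Ω νlo νhi γ Q M N h K := by
  have hB : ∀ ρ, ∃ B : Matrix (Fin np ⊕ Fin nψ) (Fin ny) ℝ × Matrix (Fin np ⊕ Fin nψ) (Fin nu) ℝ,
      ρ ∈ Ω → EqB (augment G F ρ) γ (Q.S ρ) (Q.X ρ) (Q.Xk ρ) (Dh1 ρ) (Dh2 ρ) B.1 B.2 := fun ρ => by
    by_cases hρ : ρ ∈ Ω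
    · exact (h1.existsUnique_B hG hρ).exists.imp fun _ h _ => h
    · exact ⟨0, fun h => absurd h hρ⟩
  have hC : ∀ ρ, ∃ C : Matrix (Fin nu) (Fin np ⊕ Fin nψ) ℝ,
      ρ ∈ Ω → EqC (augment G F ρ) γ (Q.R ρ) (Q.X ρ) (Q.Xk ρ) (Dh1 ρ) (Dh2 ρ) C := fun ρ => by
    by_cases hρ : ρ ∈ Ω
    · exact (h1.existsUnique_C hG hρ).exists.imp fun _ h _ => h
    · exact ⟨0, fun h => absurd h hρ⟩
  choose B hB using hB
  choose C hC using hC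
  let h₀ : LPVGains (Fin s) (Fin np ⊕ Fin nψ) (Fin nu) (Fin ny) :=
    ⟨fun _ _ => 0, fun ρ => (B ρ).1, fun ρ => (B ρ).2, C, Dh1, Dh2⟩
  let h : LPVGains (Fin s) (Fin np ⊕ Fin nψ) (Fin nu) (Fin ny) :=
    { h₀ with A := fun ρ ν =>
        -(augment G F ρ).Aᵀ - (augment G F ρ).C2ᵀ * (Dh1 ρ)ᵀ * (augment G F ρ).B2ᵀ
          + Q.S ρ * dirDeriv Q.R ρ ν + N ρ * (dirDeriv M ρ ν)ᵀ
          - (L2T (augment G F ρ) (Q.S ρ) (h₀.eval ρ ν))ᵀ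
            * (PiMat (augment G F ρ) γ (Q.X ρ) (Q.Xk ρ) (Dh1 ρ) (Dh2 ρ))⁻¹
            * L1T (augment G F ρ) (Q.R ρ) (Q.X ρ) (h₀.eval ρ ν) }
  let g : (Fin s → ℝ) → (Fin s → ℝ) → Gains (Fin np ⊕ Fin nψ) (Fin nu) (Fin ny) := fun ρ ν =>
    gainsOfTransformed (augment G F ρ) (Q.R ρ) (Q.S ρ) (M ρ) (N ρ) (Q.X ρ) (h.eval ρ ν)
  refine ⟨h, ⟨fun ρ ν => (g ρ ν).A, fun ρ => (g ρ 0).B1, fun ρ => (g ρ 0).B2, fun ρ => (g ρ 0).C,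
    fun ρ => (g ρ 0).D1, fun ρ => (g ρ 0).D2⟩, rfl, rfl, hf, h1, fun ρ hρ => hB ρ hρ,
    fun ρ hρ => hC ρ hρ, fun ρ _ ν _ => rfl, fun ρ hρ ν _ => ?_⟩
  obtain ⟨hM, hN⟩ := hf.isUnit hQ hρ
  have hX := hQ.isUnit_X hG hρ
  exact (eqGains_iff_relation (isUnit_leftT hN) (isUnit_rightT hM hX)).2
    (gainRelation_gainsOfTransformed hM hN hX (h.eval ρ ν))

end Feasibility

/-! ### Uniformity of the certificate on compact parameter sets -/

theorem continuous_of_C1At {s : ℕ} {m n T : Type} [TopologicalSpace T]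
    {F : (Fin s → ℝ) → Matrix m n ℝ} {p : T → Fin s → ℝ} (hp : Continuous p)
    (hF : ∀ t, C1At F (p t)) : Continuous fun t => F (p t) :=
  continuous_iff_continuousAt.2 fun t =>
    ContinuousAt.comp (g := F) (f := p) (hF t).continuousAt hp.continuousAt

theorem continuous_dirDeriv {s : ℕ} {m n T : Type} [TopologicalSpace T]
    {F : (Fin s → ℝ) → Matrix m n ℝ} {p v : T → Fin s → ℝ} (hp : Continuous p) (hv : Continuous v)
    (hF : ∀ t, C1At F (p t)) : Continuous fun t => dirDeriv F (p t) (v t) := by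
  refine continuous_matrix fun i j => ?_
  have h : Continuous fun t => fderiv ℝ (fun q => F q i j) (p t) :=
    continuous_iff_continuousAt.2 fun t =>
      ContinuousAt.comp (g := fderiv ℝ fun q => F q i j) (f := p)
        ((hF t i j).fderiv_right (m := 0) (by norm_num)).continuousAt hp.continuousAt
  exact h.clm_apply hv

section Uniform

variable {s np nψ nd nu ne ny L : ℕ}
    {G : Plant s np nd nu ne ny} {F : IQCFilter nψ nu L}
    {Ω Ω₀ : Set (Fin s → ℝ)} {νlo νhi : Fin s → ℝ} {γ : ℝ}
    {Q : Decision (Fin s) (Fin np ⊕ Fin nψ) (Fin nu) (Fin L)}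
    {M N : (Fin s → ℝ) → Matrix (Fin np ⊕ Fin nψ) (Fin np ⊕ Fin nψ) ℝ}
    {h K : LPVGains (Fin s) (Fin np ⊕ Fin nψ) (Fin nu) (Fin ny)}

theorem rateBox_eq_Icc : RateBox νlo νhi = Set.Icc νlo νhi := by
  ext ν
  simp only [RateBox, Set.mem_ofPred_eq, Set.mem_Icc, Pi.le_def, forall_and]

/-- A certificate of dissipativity of the closed loop, with constants that are uniform over the
parameter set `Ω₀` and the box of rates: a storage matrix `P` between `c I` and `C I` with
derivatives bounded by `C`, and the dissipation inequality with margin `ε`. -/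
structure UniformCertificate (G : Plant s np nd nu ne ny) (F : IQCFilter nψ nu L)
    (K : LPVGains (Fin s) (Fin np ⊕ Fin nψ) (Fin nu) (Fin ny)) (Ω₀ : Set (Fin s → ℝ))
    (νlo νhi : Fin s → ℝ) (γ : ℝ)
    (P : (Fin s → ℝ) →
      Matrix ((Fin np ⊕ Fin nψ) ⊕ (Fin np ⊕ Fin nψ)) ((Fin np ⊕ Fin nψ) ⊕ (Fin np ⊕ Fin nψ)) ℝ)
    (Xk : (Fin s → ℝ) → Fin L → Matrix (Fin nu) (Fin nu) ℝ) (ε c C : ℝ) : Prop where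
  symm : ∀ ρ ∈ Ω₀, (P ρ)ᵀ = P ρ
  C1 : C1On P Ω₀
  Xk_cont : ContinuousOn Xk Ω₀
  Xk_pos : ∀ ρ ∈ Ω₀, ∀ k, (Xk ρ k).PosDef
  dissip : ∀ ρ ∈ Ω₀, ∀ ν ∈ RateBox νlo νhi, ∀ v,
    v ⬝ᵥ (clDissip (augment G F ρ) (K.eval ρ ν) γ (P ρ) (dirDeriv P ρ ν) (Xk ρ) *ᵥ v) ≤
      -ε * (v ⬝ᵥ v)
  lower : ∀ ρ ∈ Ω₀, ∀ ν ∈ RateBox νlo νhi, ∀ x, c * (x ⬝ᵥ x) ≤ x ⬝ᵥ (P ρ *ᵥ x)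
  upper : ∀ ρ ∈ Ω₀, ∀ ν ∈ RateBox νlo νhi, ∀ x, x ⬝ᵥ (P ρ *ᵥ x) ≤ C * (x ⬝ᵥ x)
  weight : ∀ ρ ∈ Ω₀, ∀ ν ∈ RateBox νlo νhi, ∀ w, w ⬝ᵥ ((∑ k, (Xk ρ k)⁻¹) *ᵥ w) ≤ C * (w ⬝ᵥ w)
  rate : ∀ ρ ∈ Ω₀, ∀ ν ∈ RateBox νlo νhi, ∀ i j, |dirDeriv P ρ ν i j| ≤ C

/-- The strict inequalities of the certificate are uniform on compact parameter sets, by continuity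
of the controller. -/
theorem Reconstructs.exists_uniformCertificate (hG : G.Regular Ω) (hγ : 0 < γ)
    (hQ : Feasible G F Ω νlo νhi γ Q) (hK : Reconstructs G F Ω νlo νhi γ Q M N h K)
    (hD1 : ContinuousOn h.D1 Ω) (hD2 : ContinuousOn h.D2 Ω) (hc : IsCompact Ω₀)
    (hsub : Ω₀ ⊆ Ω) :
    ∃ ε c C : ℝ, 0 < ε ∧ 0 < c ∧ 0 ≤ C ∧ UniformCertificate G F K Ω₀ νlo νhi γ
      (fun q => lyap (Q.R q) (Q.S q) (M q) (N q)) Q.Xk ε c C := by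
  have hf := hK.factor
  have hcomp : IsCompact (Ω₀ ×ˢ RateBox νlo νhi) := by
    rw [rateBox_eq_Icc]; exact hc.prod isCompact_Icc
  let T : Type := ↥(Ω₀ ×ˢ RateBox νlo νhi)
  have : CompactSpace T := isCompact_iff_compactSpace.1 hcomp
  let p : T → Fin s → ℝ := fun t => t.1.1
  let v : T → Fin s → ℝ := fun t => t.1.2
  have hp : Continuous p := continuous_fst.comp continuous_subtype_val
  have hv : Continuous v := continuous_snd.comp continuous_subtype_val
  have hpΩ : ∀ t, p t ∈ Ω := fun t => hsub t.2.1
  have hvB : ∀ t, v t ∈ RateBox νlo νhi := fun t => t.2.2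
  have ha : AugPlant.ContinuousFamily fun t => augment G F (p t) :=
    hG.continuousFamily_augment hp hpΩ
  have hR : Continuous fun t => Q.R (p t) := continuous_of_C1At hp fun t => hQ.R_C1 _ (hpΩ t)
  have hS : Continuous fun t => Q.S (p t) := continuous_of_C1At hp fun t => hQ.S_C1 _ (hpΩ t)
  have hM : Continuous fun t => M (p t) := continuous_of_C1At hp fun t => hf.1 _ (hpΩ t)
  have hN : Continuous fun t => N (p t) :=
    continuous_of_C1At hp fun t => hf.C1At_N hQ (hpΩ t)
  have hP : Continuous fun t => lyap (Q.R (p t)) (Q.S (p t)) (M (p t)) (N (p t)) :=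
    continuous_of_C1At (F := fun q => lyap (Q.R q) (Q.S q) (M q) (N q)) hp
      fun t => hf.C1At_lyap hQ (hpΩ t)
  have hdP : Continuous fun t =>
      dirDeriv (fun q => lyap (Q.R q) (Q.S q) (M q) (N q)) (p t) (v t) :=
    continuous_dirDeriv hp hv fun t => hf.C1At_lyap hQ (hpΩ t)
  have hdR := continuous_dirDeriv hp hv fun t => hQ.R_C1 _ (hpΩ t)
  have hdM := continuous_dirDeriv hp hv fun t => hf.1 _ (hpΩ t)
  have hX := hQ.X_cont.comp_continuous hp hpΩ
  have hXk := hQ.Xk_cont.comp_continuous hp hpΩ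
  have hXki : ∀ k, Continuous fun t => (Q.Xk (p t) k)⁻¹ := fun k =>
    continuous_matrix_inv ((continuous_apply k).comp hXk)
      fun t => (hQ.Xk_pos _ (hpΩ t) k).isUnit
  have hD1c := hD1.comp_continuous hp hpΩ
  have hD2c := hD2.comp_continuous hp hpΩ
  have hPi := fun t => hK.step1 _ (hpΩ t)
  obtain ⟨hB1, hB2⟩ := continuous_B_of_eqB ha hS hX hXk hD1c hD2c hPi
    (fun t => hG.measMat_injective (hpΩ t)) (fun t => hK.step2B _ (hpΩ t))
  have hC := continuous_C_of_eqC ha hR hX hXk hD1c hD2c hPi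
    (fun t => hG.inputMat_injective (hpΩ t)) (fun t => hK.step2C _ (hpΩ t))
  have hA := continuous_A_of_eqA ha (h := fun t => h.eval (p t) (v t)) hR hS hN hdR hdM hX hXk
    hB1 hB2 hC hD1c hD2c hPi (fun t => hK.step3 _ (hpΩ t) _ (hvB t))
  have hg := continuous_gains_of_eqGains ha (h := fun t => h.eval (p t) (v t))
    (g := fun t => K.eval (p t) (v t)) ⟨hA, hB1, hB2, hC, hD1c, hD2c⟩ hR hS hM hN hX
    (fun t => isUnit_leftT (hf.isUnit hQ (hpΩ t)).2)
    (fun t => isUnit_rightT (hf.isUnit hQ (hpΩ t)).1 (hQ.isUnit_X hG (hpΩ t)))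
    (fun t => hK.step4 _ (hpΩ t) _ (hvB t))
  have hDis := continuous_clDissip (γ := γ) ha hg hP hdP hXki
  have hcert := fun t => hK.certificate hγ hQ (hpΩ t) (hvB t)
  obtain ⟨ε, hε, h1⟩ := exists_uniform_quad_lower hDis.neg
    fun t x hx => PosDef.dotProduct_pos (hcert t).2.2 hx
  obtain ⟨c, hc0, h2⟩ := exists_uniform_quad_lower hP
    fun t x hx => PosDef.dotProduct_pos (hcert t).1 hx
  obtain ⟨C₁, hC₁, h3⟩ := exists_uniform_quad_upper hP
  obtain ⟨C₂, hC₂, h4⟩ := exists_uniform_quad_upper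
    (continuous_finsetSum Finset.univ fun k _ => hXki k)
  obtain ⟨C₃, h5⟩ : ∃ C₃, ∀ t, ∀ i j,
      |dirDeriv (fun q => lyap (Q.R q) (Q.S q) (M q) (N q)) (p t) (v t) i j| ≤ C₃ := by
    have hb := fun i j => isCompact_univ.exists_bound_of_continuousOn
      (hdP.matrix_elem i j).continuousOn
    choose b hb using hb
    refine ⟨∑ i, ∑ j, |b i j|, fun t i j => (hb i j t (Set.mem_univ _)).trans ?_⟩
    refine (le_abs_self _).trans ?_
    refine (Finset.single_le_sum (f := fun j => |b i j|) (fun j _ => abs_nonneg _)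
      (Finset.mem_univ j)).trans ?_
    exact Finset.single_le_sum (f := fun i => ∑ j, |b i j|)
      (fun i _ => Finset.sum_nonneg fun j _ => abs_nonneg _) (Finset.mem_univ i)
  refine ⟨ε, c, C₁ + C₂ + |C₃|, hε, hc0, by positivity,
    fun ρ hρ => ((hf.eventually_lyap hQ (hsub hρ)).self_of_nhds).1,
    fun ρ hρ => hf.C1At_lyap hQ (hsub hρ), hQ.Xk_cont.mono hsub,
    fun ρ hρ => hQ.Xk_pos ρ (hsub hρ), fun ρ hρ ν hν v => ?_,
    fun ρ hρ ν hν => h2 ⟨(ρ, ν), hρ, hν⟩, fun ρ hρ ν hν x => (h3 ⟨(ρ, ν), hρ, hν⟩ x).trans ?_,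
    fun ρ hρ ν hν w => (h4 ⟨(ρ, ν), hρ, hν⟩ w).trans ?_,
    fun ρ hρ ν hν i j => (h5 ⟨(ρ, ν), hρ, hν⟩ i j).trans ?_⟩
  · have := h1 ⟨(ρ, ν), hρ, hν⟩ v
    rw [Pi.neg_apply, neg_mulVec, dotProduct_neg] at this
    change _ ≤ -(v ⬝ᵥ (clDissip (augment G F ρ) (K.eval ρ ν) γ _ _ _ *ᵥ v)) at this
    linarith
  · exact mul_le_mul_of_nonneg_right (by linarith [abs_nonneg C₃]) (zero_le_dotProduct_self x)
  · exact mul_le_mul_of_nonneg_right (by linarith [abs_nonneg C₃]) (zero_le_dotProduct_self w)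
  · linarith [le_abs_self C₃]

end Uniform

/-! ### Quadratic storage functions along Carathéodory solutions -/

theorem integral_of_absolutelyContinuous {T : ℝ} (hT : 0 ≤ T) {g g' : ℝ → ℝ}
    (hg : AbsolutelyContinuousOnInterval g 0 T)
    (hg' : ∀ᵐ t, t ∈ Set.Ioo 0 T → HasDerivAt g (g' t) t) :
    IntervalIntegrable g' volume 0 T ∧ ∫ t in (0 : ℝ)..T, g' t = g T - g 0 := by
  have hne : ∀ᵐ t : ℝ, t ≠ T := by simp [ae_iff, measure_singleton]
  have h : ∀ᵐ t, t ∈ Set.uIoc 0 T → deriv g t = g' t := by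
    filter_upwards [hg', hne] with t ht hT' hmem
    rw [Set.uIoc_of_le hT] at hmem
    exact (ht ⟨hmem.1, lt_of_le_of_ne hmem.2 hT'⟩).deriv
  refine ⟨hg.intervalIntegrable_deriv.congr_ae ?_, ?_⟩
  · exact (ae_restrict_iff' measurableSet_uIoc).2 h
  · rw [← hg.integral_deriv_eq_sub]
    exact (intervalIntegral.integral_congr_ae h).symm

theorem intervalIntegrable_eval {n : Type} [Fintype n] {f : ℝ → n → ℝ} {a b : ℝ}
    (hf : IntervalIntegrable f volume a b) (i : n) :
    IntervalIntegrable (fun t => f t i) volume a b :=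
  ⟨hf.1.eval i, hf.2.eval i⟩

theorem intervalIntegral_eval {n : Type} [Fintype n] {f : ℝ → n → ℝ} {a b : ℝ}
    (hf : IntervalIntegrable f volume a b) (i : n) :
    (∫ t in a..b, f t) i = ∫ t in a..b, f t i :=
  ((ContinuousLinearMap.proj (R := ℝ) (φ := fun _ : n => ℝ) i).intervalIntegral_comp_comm hf).symm

/-- The energy balance: `xᵀ P x` is absolutely continuous along a Carathéodory solution of
`ẋ = f`, and is the integral of its derivative `2 xᵀ P f + xᵀ Ṗ x`. -/
theorem integral_energy {n : Type} [Fintype n] {T B : ℝ} (hT : 0 ≤ T) {x f : ℝ → n → ℝ}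
    {P dP : ℝ → Matrix n n ℝ} (hf : IntervalIntegrable f volume 0 T)
    (hx : ∀ t ∈ Set.Icc 0 T, x t = x 0 + ∫ r in (0 : ℝ)..t, f r)
    (hP : ∀ t ∈ Set.Icc 0 T, ∀ i j,
      HasDerivWithinAt (fun t => P t i j) (dP t i j) (Set.Icc 0 T) t)
    (hB : ∀ t ∈ Set.Icc 0 T, ∀ i j, |dP t i j| ≤ B)
    (hsymm : ∀ t ∈ Set.Icc 0 T, (P t)ᵀ = P t) :
    IntervalIntegrable (fun t => 2 * (x t ⬝ᵥ (P t *ᵥ f t)) + x t ⬝ᵥ (dP t *ᵥ x t)) volume 0 T ∧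
      ∫ t in (0 : ℝ)..T, (2 * (x t ⬝ᵥ (P t *ᵥ f t)) + x t ⬝ᵥ (dP t *ᵥ x t)) =
        x T ⬝ᵥ (P T *ᵥ x T) - x 0 ⬝ᵥ (P 0 *ᵥ x 0) := by
  have hu : Set.uIcc 0 T = Set.Icc 0 T := Set.uIcc_of_le hT
  let X : n → ℝ → ℝ := fun i t => x 0 i + ∫ r in (0 : ℝ)..t, f r i
  have hxX : ∀ t ∈ Set.Icc 0 T, ∀ i, x t i = X i t := by
    intro t ht i
    rw [hx t ht, Pi.add_apply, intervalIntegral_eval (hf.mono_set ?_)]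
    rw [hu, Set.uIcc_of_le ht.1]
    exact Set.Icc_subset_Icc_right ht.2
  have hXac : ∀ i, AbsolutelyContinuousOnInterval (X i) 0 T := by
    intro i
    have h1 := (intervalIntegrable_eval hf i).absolutelyContinuousOnInterval_intervalIntegral
      (c := 0) (by simp)
    have h2 : AbsolutelyContinuousOnInterval (fun _ : ℝ => x 0 i) 0 T :=
      ((LipschitzWith.const (x 0 i)).lipschitzOnWith (s := Set.uIcc 0 T)
        ).absolutelyContinuousOnInterval
    exact h2.add h1
  have hPac : ∀ i j, AbsolutelyContinuousOnInterval (fun t => P t i j) 0 T := by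
    intro i j
    refine LipschitzOnWith.absolutelyContinuousOnInterval (K := B.toNNReal) ?_
    rw [hu]
    refine (convex_Icc 0 T).lipschitzOnWith_of_nnnorm_hasDerivWithin_le
      (fun t ht => hP t ht i j) fun t ht => ?_
    rw [← NNReal.coe_le_coe, coe_nnnorm, Real.norm_eq_abs]
    exact (hB t ht i j).trans (Real.le_coe_toNNReal B)
  have hXd : ∀ᵐ t, ∀ i, t ∈ Set.Ioo 0 T → HasDerivAt (X i) (f t i) t := by
    rw [ae_all_iff]
    intro i
    filter_upwards [(intervalIntegrable_eval hf i).ae_hasDerivAt_integral] with t ht hmem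
    exact (ht (hu ▸ Set.Ioo_subset_Icc_self hmem) 0 (by simp)).const_add _
  have key : ∀ i j, _ := fun i j => integral_of_absolutelyContinuous hT
    (g := fun t => X i t * (P t i j * X j t))
    (g' := fun t => f t i * (P t i j * X j t) +
      X i t * (dP t i j * X j t + P t i j * f t j))
    ((hXac i).mul ((hPac i j).mul (hXac j))) (by
      filter_upwards [hXd] with t ht hmem
      exact (ht i hmem).mul ((((hP t (Set.Ioo_subset_Icc_self hmem) i j).hasDerivAt
        (Icc_mem_nhds hmem.1 hmem.2)).mul (ht j hmem))))
  have e : Set.EqOn (fun t => ∑ i, ∑ j, (f t i * (P t i j * X j t) +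
      X i t * (dP t i j * X j t + P t i j * f t j)))
      (fun t => 2 * (x t ⬝ᵥ (P t *ᵥ f t)) + x t ⬝ᵥ (dP t *ᵥ x t)) (Set.uIcc 0 T) := by
    intro t ht
    rw [hu] at ht
    have h1 : x t ⬝ᵥ (P t *ᵥ f t) = f t ⬝ᵥ (P t *ᵥ x t) :=
      dotProduct_mulVec_comm (hsymm t ht) _ _
    have h2 : 2 * (x t ⬝ᵥ (P t *ᵥ f t)) = x t ⬝ᵥ (P t *ᵥ f t) + f t ⬝ᵥ (P t *ᵥ x t) := by
      rw [← h1]; ring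
    simp only [h2]
    simp only [dotProduct, mulVec, hxX t ht, Finset.mul_sum, ← Finset.sum_add_distrib]
    refine Finset.sum_congr rfl fun i _ => Finset.sum_congr rfl fun j _ => ?_
    ring
  have hint : IntervalIntegrable (fun t => ∑ i, ∑ j, (f t i * (P t i j * X j t) +
      X i t * (dP t i j * X j t + P t i j * f t j))) volume 0 T := by
    have := IntervalIntegrable.sum (Finset.univ) (fun i _ => IntervalIntegrable.sum
      (Finset.univ) (fun j _ => (key i j).1))
    convert! this using 1
    ext t
    simp only [Finset.sum_apply]
  refine ⟨hint.congr (e.mono Set.uIoc_subset_uIcc), ?_⟩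
  rw [← intervalIntegral.integral_congr e, intervalIntegral.integral_finsetSum fun i _ => ?_]
  · have h3 : ∀ t ∈ Set.Icc 0 T, x t ⬝ᵥ (P t *ᵥ x t) = ∑ i, ∑ j, X i t * (P t i j * X j t) := by
      intro t ht
      simp only [dotProduct, mulVec, hxX t ht, Finset.mul_sum]
    rw [h3 T ⟨hT, le_rfl⟩, h3 0 ⟨le_rfl, hT⟩, ← Finset.sum_sub_distrib]
    refine Finset.sum_congr rfl fun i _ => ?_
    rw [intervalIntegral.integral_finsetSum fun j _ => (key i j).1, ← Finset.sum_sub_distrib]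
    exact Finset.sum_congr rfl fun j _ => (key i j).2
  · have := IntervalIntegrable.sum (Finset.univ) (fun j _ => (key i j).1)
    convert! this using 1
    ext t
    simp only [Finset.sum_apply]

/-! ### Square-integrable signals -/

section Signals

variable {m n : Type} [Fintype m] [Fintype n] {T : ℝ}

theorem memLp_of_continuousOn {v : ℝ → n → ℝ} (hv : ContinuousOn v (Set.Icc 0 T)) :
    MemLp v 2 (volume.restrict (Set.Icc 0 T)) := by
  obtain ⟨C, hC⟩ := isCompact_Icc.exists_bound_of_continuousOn hv
  exact MemLp.of_bound (hv.aestronglyMeasurable measurableSet_Icc) C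
    ((ae_restrict_iff' measurableSet_Icc).2 (Eventually.of_forall hC))

theorem memLp_mulVec {A : ℝ → Matrix m n ℝ} {v : ℝ → n → ℝ}
    (hA : ContinuousOn A (Set.Icc 0 T)) (hv : MemLp v 2 (volume.restrict (Set.Icc 0 T))) :
    MemLp (fun t => A t *ᵥ v t) 2 (volume.restrict (Set.Icc 0 T)) := by
  refine MemLp.of_eval fun i => ?_
  simp only [mulVec, dotProduct]
  refine memLp_finsetSum _ fun j _ => ?_
  have hAij : ContinuousOn (fun t => A t i j) (Set.Icc 0 T) :=
    (continuous_apply_apply i j).comp_continuousOn hA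
  obtain ⟨C, hC⟩ := isCompact_Icc.exists_bound_of_continuousOn hAij
  exact (hv.eval j).mul' (memLp_top_of_bound (hAij.aestronglyMeasurable measurableSet_Icc) C
    ((ae_restrict_iff' measurableSet_Icc).2 (Eventually.of_forall hC)))

theorem intervalIntegrable_dotProduct (hT : 0 ≤ T) {v w : ℝ → n → ℝ}
    (hv : MemLp v 2 (volume.restrict (Set.Icc 0 T)))
    (hw : MemLp w 2 (volume.restrict (Set.Icc 0 T))) :
    IntervalIntegrable (fun t => v t ⬝ᵥ w t) volume 0 T := by
  rw [intervalIntegrable_iff_integrableOn_Icc_of_le hT]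
  simp only [dotProduct]
  exact integrable_finsetSum _ fun i _ => (hv.eval i).integrable_mul (hw.eval i)

end Signals

/-! ### Closed-loop trajectories -/

section PointwiseLoop

variable {n d m e y l : Type}
  [Fintype n] [DecidableEq n] [Fintype d] [DecidableEq d] [Fintype m] [DecidableEq m]
  [Fintype e] [DecidableEq e] [Fintype y] [DecidableEq y] [Fintype l] [DecidableEq l]
  {a : AugPlant n d m e y l} {g : Gains n m y} {x : n ⊕ n → ℝ} {u w : m → ℝ} {dd : d → ℝ}

/-- The control law at one instant, for the closed-loop state `x = (x_aug, x_c)` and the measurement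
`y = C2 x_aug + D21 d`. -/
def IsInput (a : AugPlant n d m e y l) (g : Gains n m y) (x : n ⊕ n → ℝ) (w : m → ℝ) (dd : d → ℝ)
    (u : m → ℝ) : Prop :=
  u = g.C *ᵥ (fun i => x (Sum.inr i))
    + g.D1 *ᵥ (a.C2 *ᵥ (fun i => x (Sum.inl i)) + a.D21 *ᵥ dd) + g.D2 *ᵥ w

theorem IsInput.field_inl (hu : IsInput a g x w dd u) (i : n) :
    (clA a g *ᵥ x + clB1 a g *ᵥ w + clB2 a g *ᵥ dd) (Sum.inl i) =
      (a.A *ᵥ (fun i => x (Sum.inl i)) + a.B0 *ᵥ w + a.B1 *ᵥ dd + a.B2 *ᵥ u) i := by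
  obtain ⟨xa, xc, rfl⟩ := exists_sumElim x
  rw [hu]
  simp only [clA, clB1, clB2, fromBlocks_mulVec, fromRows_mulVec, Sum.elim_comp_inl,
    Sum.elim_comp_inr, Pi.add_apply, Sum.elim_inl, Sum.elim_inr, add_mulVec, mulVec_add,
    ← mulVec_mulVec]
  ring

theorem IsInput.filter_output (hu : IsInput a g x w dd u) :
    clC1 a g *ᵥ x + clD11 a g *ᵥ w + clD12 a g *ᵥ dd =
      a.C0 *ᵥ (fun i => x (Sum.inl i)) + a.Dψ1 *ᵥ u + a.Dψ2 *ᵥ w := by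
  obtain ⟨xa, xc, rfl⟩ := exists_sumElim x
  rw [hu]
  simp only [clC1, clD11, clD12, fromCols_mulVec_sumElim, Sum.elim_inl, Sum.elim_inr, add_mulVec,
    mulVec_add, ← mulVec_mulVec]
  abel

theorem IsInput.output (hu : IsInput a g x w dd u) :
    clC2 a g *ᵥ x + clD21 a g *ᵥ w + clD22 a g *ᵥ dd =
      a.C1 *ᵥ (fun i => x (Sum.inl i)) + a.D12 *ᵥ (u - w) + a.D11 *ᵥ dd := by
  obtain ⟨xa, xc, rfl⟩ := exists_sumElim x
  rw [hu]
  simp only [clC2, clD21, clD22, fromCols_mulVec_sumElim, Sum.elim_inl, Sum.elim_inr, add_mulVec,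
    mulVec_add, mulVec_sub, neg_mulVec, ← mulVec_mulVec]
  abel

end PointwiseLoop

section Loop

variable {s np nψ nd nu ne ny L : ℕ}
    {G : Plant s np nd nu ne ny} {F : IQCFilter nψ nu L}
    {Ω Ω₀ : Set (Fin s → ℝ)} {νlo νhi : Fin s → ℝ} {γ ε c C τmax r : ℝ}
    {K : LPVGains (Fin s) (Fin np ⊕ Fin nψ) (Fin nu) (Fin ny)}
    {P : (Fin s → ℝ) →
      Matrix ((Fin np ⊕ Fin nψ) ⊕ (Fin np ⊕ Fin nψ)) ((Fin np ⊕ Fin nψ) ⊕ (Fin np ⊕ Fin nψ)) ℝ}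
    {Xk : (Fin s → ℝ) → Fin L → Matrix (Fin nu) (Fin nu) ℝ}
    {τ : ℝ → ℝ} {ρ ρd : ℝ → Fin s → ℝ} {d : ℝ → Fin nd → ℝ}
    {x : ℝ → (Fin np ⊕ Fin nψ) ⊕ (Fin np ⊕ Fin nψ) → ℝ} {u w : ℝ → Fin nu → ℝ} {T : ℝ}

theorem IsParamTraj.mono (h : IsParamTraj Ω₀ νlo νhi ρ ρd) (hsub : Ω₀ ⊆ Ω) :
    IsParamTraj Ω νlo νhi ρ ρd := fun t ht => ⟨hsub (h t ht).1, (h t ht).2⟩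

theorem IsParamTraj.continuousOn_comp {Y : Type} [TopologicalSpace Y] {f : (Fin s → ℝ) → Y}
    (h : IsParamTraj Ω νlo νhi ρ ρd) (hf : ContinuousOn f Ω) (T : ℝ) :
    ContinuousOn (fun t => f (ρ t)) (Set.Icc 0 T) :=
  hf.comp (fun t ht => ((h t ht.1).2.1.continuousWithinAt).mono Set.Icc_subset_Ici_self)
    fun t ht => (h t ht.1).1

theorem continuousOn_matrix_inv {Y n : Type} [TopologicalSpace Y] [Fintype n] [DecidableEq n]
    {A : Y → Matrix n n ℝ} {S : Set Y} (hA : ContinuousOn A S) (hu : ∀ t ∈ S, IsUnit (A t)) :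
    ContinuousOn (fun t => (A t)⁻¹) S := by
  rw [continuousOn_iff_continuous_domRestrict] at hA ⊢
  exact continuous_matrix_inv hA fun t => hu t t.2

/-- The storage matrix has the derivative `dirDeriv P ρ ρ̇` along a parameter trajectory. -/
theorem IsParamTraj.hasDerivWithinAt {n : Type} {P : (Fin s → ℝ) → Matrix n n ℝ}
    (h : IsParamTraj Ω νlo νhi ρ ρd) (hP : C1On P Ω) {t : ℝ} (ht : t ∈ Set.Icc 0 T) (i j : n) :
    HasDerivWithinAt (fun t => P (ρ t) i j) (dirDeriv P (ρ t) (ρd t) i j) (Set.Icc 0 T) t := by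
  obtain ⟨h1, h2, -⟩ := h t ht.1
  exact (C1At.differentiableAt (hP _ h1) i j).hasFDerivAt.comp_hasDerivWithinAt t
    (h2.mono Set.Icc_subset_Ici_self)

theorem IsClosedLoop.continuousOn (h : IsClosedLoop G F K τ ρ ρd d x u w) (T : ℝ) :
    ContinuousOn x (Set.Icc 0 T) := by
  rcases lt_or_ge T 0 with hT | hT
  · rw [Set.Icc_eq_empty (not_le.2 hT)]; exact continuousOn_empty x
  have h1 := intervalIntegral.continuousOn_primitive_interval' (h.integrable T hT)
    (a := 0) (by simp)
  rw [Set.uIcc_of_le hT] at h1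
  exact (continuousOn_const.add h1).congr fun t ht => h.ode t ht.1

theorem IsClosedLoop.ae_isInput (h : IsClosedLoop G F K τ ρ ρd d x u w) :
    ∀ᵐ t, 0 ≤ t → IsInput (augment G F (ρ t)) (K.eval (ρ t) (ρd t)) (x t) (w t) (d t) (u t) :=
  (ae_restrict_iff' measurableSet_Ici).1 h.input

/-- The filter component of the closed-loop state is the filter state of the delay operator. -/
theorem IsClosedLoop.isFilterState (h : IsClosedLoop G F K τ ρ ρd d x u w) :
    IsFilterState F u w fun t i => x t (Sum.inl (Sum.inr i)) := by
  constructor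
  · intro t ht
    have h1 : ContinuousWithinAt x (Set.Ici 0) t :=
      (h.continuousOn (t + 1) t ⟨ht, by linarith⟩).mono_of_mem_nhdsWithin
        (by
          rw [← Set.Ici_inter_Iic]
          exact inter_mem_nhdsWithin _ (Iic_mem_nhds (by linarith)))
    exact continuousWithinAt_pi.2 fun i => continuousWithinAt_pi.1 h1 _
  · intro t ht
    let Λ : ((Fin np ⊕ Fin nψ) ⊕ (Fin np ⊕ Fin nψ) → ℝ) →L[ℝ] (Fin nψ → ℝ) :=
      ContinuousLinearMap.pi fun i => ContinuousLinearMap.proj (Sum.inl (Sum.inr i))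
    have h1 : (∫ q in (0 : ℝ)..t, Λ (clField G F K ρ ρd x w d q)) =
        Λ (∫ q in (0 : ℝ)..t, clField G F K ρ ρd x w d q) :=
      Λ.intervalIntegral_comp_comm (h.integrable t ht)
    have h2 : (∫ q in (0 : ℝ)..t, Λ (clField G F K ρ ρd x w d q)) =
        ∫ q in (0 : ℝ)..t, (F.A *ᵥ (fun i => x q (Sum.inl (Sum.inr i))) + F.Bu *ᵥ u q
          + F.Bw *ᵥ w q) := by
      refine intervalIntegral.integral_congr_ae ?_
      filter_upwards [h.ae_isInput] with q hq hmem
      rw [Set.uIoc_of_le ht] at hmem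
      funext i
      refine ((hq hmem.1.le).field_inl (Sum.inr i)).trans ?_
      simp only [augment, fromBlocks_mulVec, fromRows_mulVec, Pi.add_apply, Sum.elim_inr,
        zero_mulVec, Pi.zero_apply, Function.comp_def]
      ring
    rw [← h2, h1]
    funext i
    have h3 := congrFun (h.ode t ht) (Sum.inl (Sum.inr i))
    rw [Pi.add_apply, h.filter_rest i, zero_add] at h3
    exact h3

theorem DelayIQC.mono (h : DelayIQC F Xk Ω νlo νhi τmax r) (hsub : Ω₀ ⊆ Ω) :
    DelayIQC F Xk Ω₀ νlo νhi τmax r := fun τ ρ ρd u w x h1 h2 =>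
  h τ ρ ρd u w x h1 (h2.mono hsub)

/-- Output `z_{1,k}` of the filter. -/
def filterOutput (F : IQCFilter nψ nu L) (k : Fin L) (xψ : Fin nψ → ℝ) (u w : Fin nu → ℝ) :
    Fin nu → ℝ :=
  F.C k *ᵥ xψ + F.Du k *ᵥ u + F.Dw k *ᵥ w

/-- The supply rate of the `k`-th integral quadratic constraint. -/
noncomputable def iqcSupply (F : IQCFilter nψ nu L)
    (Xk : (Fin s → ℝ) → Fin L → Matrix (Fin nu) (Fin nu) ℝ) (ρ : ℝ → Fin s → ℝ)
    (xψ : ℝ → Fin nψ → ℝ) (u w : ℝ → Fin nu → ℝ) (k : Fin L) (t : ℝ) : ℝ :=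
  filterOutput F k (xψ t) (u t) (w t) ⬝ᵥ ((Xk (ρ t) k)⁻¹ *ᵥ filterOutput F k (xψ t) (u t) (w t))
    - w t ⬝ᵥ ((Xk (ρ t) k)⁻¹ *ᵥ w t)

/-- The derivative of the storage function `xᵀ P x` along a trajectory. -/
noncomputable def storageRate (G : Plant s np nd nu ne ny) (F : IQCFilter nψ nu L)
    (K : LPVGains (Fin s) (Fin np ⊕ Fin nψ) (Fin nu) (Fin ny))
    (P : (Fin s → ℝ) →
      Matrix ((Fin np ⊕ Fin nψ) ⊕ (Fin np ⊕ Fin nψ)) ((Fin np ⊕ Fin nψ) ⊕ (Fin np ⊕ Fin nψ)) ℝ)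
    (ρ ρd : ℝ → Fin s → ℝ) (x : ℝ → (Fin np ⊕ Fin nψ) ⊕ (Fin np ⊕ Fin nψ) → ℝ)
    (w : ℝ → Fin nu → ℝ) (d : ℝ → Fin nd → ℝ) (t : ℝ) : ℝ :=
  2 * (x t ⬝ᵥ (P (ρ t) *ᵥ clField G F K ρ ρd x w d t))
    + x t ⬝ᵥ (dirDeriv P (ρ t) (ρd t) *ᵥ x t)

/-- The dissipation inequality at one instant. -/
theorem UniformCertificate.storageRate_le (hU : UniformCertificate G F K Ω νlo νhi γ P Xk ε c C)
    (hρ : IsParamTraj Ω νlo νhi ρ ρd) {t : ℝ} (ht : 0 ≤ t)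
    (hu : IsInput (augment G F (ρ t)) (K.eval (ρ t) (ρd t)) (x t) (w t) (d t) (u t)) :
    storageRate G F K P ρ ρd x w d t
        + γ⁻¹ * (clOutput G F K ρ ρd x w d t ⬝ᵥ clOutput G F K ρ ρd x w d t)
        + ∑ k, iqcSupply F Xk ρ (fun t i => x t (Sum.inl (Sum.inr i))) u w k t
        + ε * (x t ⬝ᵥ x t + w t ⬝ᵥ w t + d t ⬝ᵥ d t) ≤ γ * (d t ⬝ᵥ d t) := by
  obtain ⟨h1, -, h3⟩ := hρ t ht
  have h4 := hU.dissip _ h1 _ h3 (Sum.elim (x t) (Sum.elim (w t) (d t)))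
  rw [clDissip_quad (hU.symm _ h1), sumElim_dotProduct_sumElim, sumElim_dotProduct_sumElim,
    hu.filter_output, blockDiagonal_quad, sum_mulVec, dotProduct_sum] at h4
  have h5 : ∀ k, (fun i => ((augment G F (ρ t)).C0 *ᵥ (fun i => x t (Sum.inl i))
      + (augment G F (ρ t)).Dψ1 *ᵥ u t + (augment G F (ρ t)).Dψ2 *ᵥ w t) (i, k)) =
      filterOutput F k (fun i => x t (Sum.inl (Sum.inr i))) (u t) (w t) := by
    intro k
    funext i
    simp [filterOutput, augment, stack, mulVec, dotProduct, fromCols, Pi.add_apply]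
  simp only [h5] at h4
  simp only [iqcSupply, storageRate, clField, clOutput, Finset.sum_sub_distrib]
  linarith

end Loop

/-! ### Integrated dissipation inequality, stability and gain -/

theorem norm_sq_le_dotProduct {n : Type} [Fintype n] (v : n → ℝ) : ‖v‖ ^ 2 ≤ v ⬝ᵥ v := by
  have h0 := zero_le_dotProduct_self v
  rw [← Real.le_sqrt (norm_nonneg v) h0, pi_norm_le_iff_of_nonneg (Real.sqrt_nonneg _)]
  intro i
  rw [Real.norm_eq_abs]
  refine Real.abs_le_sqrt ?_
  rw [sq]
  exact Finset.single_le_sum (f := fun i => v i * v i) (fun i _ => mul_self_nonneg _)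
    (Finset.mem_univ i)

theorem dotProduct_le_card_mul_norm_sq {n : Type} [Fintype n] (v : n → ℝ) :
    v ⬝ᵥ v ≤ Fintype.card n * ‖v‖ ^ 2 := by
  refine (Finset.sum_le_card_nsmul Finset.univ (fun i => v i * v i) (‖v‖ ^ 2)
    fun i _ => ?_).trans (by simp)
  have := norm_le_pi_norm v i
  rw [← abs_mul_abs_self, sq]
  exact mul_le_mul this this (abs_nonneg _) (norm_nonneg _)

/-- The increments over unit intervals of a bounded integral of a nonnegative function vanish at
infinity. -/
theorem tendsto_integral_unit_interval {f : ℝ → ℝ} {B : ℝ} (hf0 : ∀ t, 0 ≤ f t)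
    (hf : ∀ t, 0 ≤ t → IntervalIntegrable f volume 0 t)
    (hB : ∀ t, 0 ≤ t → ∫ q in (0 : ℝ)..t, f q ≤ B) :
    Tendsto (fun t => ∫ q in (t - 1)..t, f q) atTop (𝓝 0) := by
  let E : ℝ → ℝ := fun t => ∫ q in (0 : ℝ)..(max t 0), f q
  have hmono : Monotone E := by
    intro a b hab
    have h1 := hf (max a 0) (le_max_right _ _)
    have h2 := hf (max b 0) (le_max_right _ _)
    have h3 : E b - E a = ∫ q in (max a 0)..(max b 0), f q :=
      intervalIntegral.integral_interval_sub_left h2 h1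
    have h4 : 0 ≤ ∫ q in (max a 0)..(max b 0), f q :=
      intervalIntegral.integral_nonneg (max_le_max_right 0 hab) fun q _ => hf0 q
    linarith
  have hbdd : BddAbove (Set.range E) := ⟨B, by
    rintro _ ⟨t, rfl⟩
    exact hB _ (le_max_right _ _)⟩
  have hlim := tendsto_atTop_ciSup hmono hbdd
  have hlim' := hlim.sub (hlim.comp (tendsto_atTop_add_const_right atTop (-1 : ℝ) tendsto_id))
  rw [sub_self] at hlim'
  refine hlim'.congr' ?_
  filter_upwards [eventually_ge_atTop (1 : ℝ)] with t ht
  have h1 : max t 0 = t := max_eq_left (by linarith)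
  have h2 : max (t - 1) 0 = t - 1 := max_eq_left (by linarith)
  simp only [Function.comp_apply, id_eq, ← sub_eq_add_neg, E, h1, h2]
  exact intervalIntegral.integral_interval_sub_left (hf t (by linarith)) (hf _ (by linarith))

section Loop

variable {s np nψ nd nu ne ny L : ℕ}
    {G : Plant s np nd nu ne ny} {F : IQCFilter nψ nu L}
    {Ω : Set (Fin s → ℝ)} {νlo νhi : Fin s → ℝ} {γ ε c C τmax r : ℝ}
    {K : LPVGains (Fin s) (Fin np ⊕ Fin nψ) (Fin nu) (Fin ny)}
    {P : (Fin s → ℝ) →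
      Matrix ((Fin np ⊕ Fin nψ) ⊕ (Fin np ⊕ Fin nψ)) ((Fin np ⊕ Fin nψ) ⊕ (Fin np ⊕ Fin nψ)) ℝ}
    {Xk : (Fin s → ℝ) → Fin L → Matrix (Fin nu) (Fin nu) ℝ}
    {τ : ℝ → ℝ} {ρ ρd : ℝ → Fin s → ℝ} {d : ℝ → Fin nd → ℝ}
    {x : ℝ → (Fin np ⊕ Fin nψ) ⊕ (Fin np ⊕ Fin nψ) → ℝ} {u w : ℝ → Fin nu → ℝ} {T : ℝ}

theorem Plant.Regular.mono {Ω₀ : Set (Fin s → ℝ)} (hG : G.Regular Ω) (hsub : Ω₀ ⊆ Ω) :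
    G.Regular Ω₀ where
  A := hG.A.mono hsub
  B1 := hG.B1.mono hsub
  B2 := hG.B2.mono hsub
  C1 := hG.C1.mono hsub
  D11 := hG.D11.mono hsub
  D12 := hG.D12.mono hsub
  C2 := hG.C2.mono hsub
  D21 := hG.D21.mono hsub
  rank_D12 ρ hρ := hG.rank_D12 ρ (hsub hρ)
  rank_D21 ρ hρ := hG.rank_D21 ρ (hsub hρ)

theorem UniformCertificate.integral_storageRate
    (hU : UniformCertificate G F K Ω νlo νhi γ P Xk ε c C) (hρ : IsParamTraj Ω νlo νhi ρ ρd)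
    (h : IsClosedLoop G F K τ ρ ρd d x u w) (hT : 0 ≤ T) :
    IntervalIntegrable (storageRate G F K P ρ ρd x w d) volume 0 T ∧
      ∫ t in (0 : ℝ)..T, storageRate G F K P ρ ρd x w d t =
        x T ⬝ᵥ (P (ρ T) *ᵥ x T) - x 0 ⬝ᵥ (P (ρ 0) *ᵥ x 0) :=
  integral_energy (P := fun t => P (ρ t)) (dP := fun t => dirDeriv P (ρ t) (ρd t)) (B := C) hT
    (h.integrable T hT) (fun t ht => h.ode t ht.1)
    (fun _ ht i j => hρ.hasDerivWithinAt hU.C1 ht i j)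
    (fun t ht => hU.rate _ (hρ t ht.1).1 _ (hρ t ht.1).2.2) fun t ht => hU.symm _ (hρ t ht.1).1

theorem IsClosedLoop.memLp_state (h : IsClosedLoop G F K τ ρ ρd d x u w) (T : ℝ) :
    MemLp x 2 (volume.restrict (Set.Icc 0 T)) :=
  memLp_of_continuousOn (h.continuousOn T)

theorem IsClosedLoop.intervalIntegrable_iqcSupply
    (hU : UniformCertificate G F K Ω νlo νhi γ P Xk ε c C) (hρ : IsParamTraj Ω νlo νhi ρ ρd)
    (h : IsClosedLoop G F K τ ρ ρd d x u w) (hT : 0 ≤ T) (k : Fin L) :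
    IntervalIntegrable (iqcSupply F Xk ρ (fun t i => x t (Sum.inl (Sum.inr i))) u w k)
      volume 0 T := by
  have hX : ContinuousOn (fun t => (Xk (ρ t) k)⁻¹) (Set.Icc 0 T) :=
    hρ.continuousOn_comp (f := fun q => (Xk q k)⁻¹) (continuousOn_matrix_inv
      ((continuous_apply k).comp_continuousOn hU.Xk_cont) fun q hq => (hU.Xk_pos q hq k).isUnit) T
  have hw := h.pair.w_L2 T hT
  have hx : MemLp (fun t i => x t (Sum.inl (Sum.inr i))) 2 (volume.restrict (Set.Icc 0 T)) :=
    MemLp.of_eval fun i => (h.memLp_state T).eval (Sum.inl (Sum.inr i))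
  have hz : MemLp (fun t => filterOutput F k (fun i => x t (Sum.inl (Sum.inr i))) (u t) (w t)) 2
      (volume.restrict (Set.Icc 0 T)) :=
    ((memLp_mulVec (A := fun _ => F.C k) continuousOn_const hx).add
      (memLp_mulVec (A := fun _ => F.Du k) continuousOn_const (h.pair.u_L2 T hT))).add
      (memLp_mulVec (A := fun _ => F.Dw k) continuousOn_const hw)
  have h1 := intervalIntegrable_dotProduct hT hz (memLp_mulVec hX hz)
  have h2 := intervalIntegrable_dotProduct hT hw (memLp_mulVec hX hw)
  have h3 := h1.sub h2
  exact h3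

theorem IsClosedLoop.intervalIntegrable_output (hG : G.Regular Ω)
    (hρ : IsParamTraj Ω νlo νhi ρ ρd) (h : IsClosedLoop G F K τ ρ ρd d x u w) (hT : 0 ≤ T) :
    IntervalIntegrable
      (fun t => clOutput G F K ρ ρd x w d t ⬝ᵥ clOutput G F K ρ ρd x w d t) volume 0 T := by
  have hx : MemLp (fun t i => x t (Sum.inl (Sum.inl i))) 2 (volume.restrict (Set.Icc 0 T)) :=
    MemLp.of_eval fun i => (h.memLp_state T).eval (Sum.inl (Sum.inl i))
  have he : MemLp (fun t => G.C1 (ρ t) *ᵥ (fun i => x t (Sum.inl (Sum.inl i)))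
      + G.D12 (ρ t) *ᵥ (u t - w t) + G.D11 (ρ t) *ᵥ d t) 2 (volume.restrict (Set.Icc 0 T)) :=
    ((memLp_mulVec (hρ.continuousOn_comp hG.C1 T) hx).add
      (memLp_mulVec (hρ.continuousOn_comp hG.D12 T)
        ((h.pair.u_L2 T hT).sub (h.pair.w_L2 T hT)))).add
      (memLp_mulVec (hρ.continuousOn_comp hG.D11 T) (h.d_L2 T hT))
  have hae : (fun t => G.C1 (ρ t) *ᵥ (fun i => x t (Sum.inl (Sum.inl i)))
      + G.D12 (ρ t) *ᵥ (u t - w t) + G.D11 (ρ t) *ᵥ d t)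
      =ᵐ[volume.restrict (Set.Icc 0 T)] clOutput G F K ρ ρd x w d := by
    refine (ae_restrict_iff' measurableSet_Icc).2 ?_
    filter_upwards [h.ae_isInput] with t ht hmem
    have h1 := (ht hmem.1).output
    have h2 : (augment G F (ρ t)).C1 *ᵥ (fun i => x t (Sum.inl i)) =
        G.C1 (ρ t) *ᵥ (fun i => x t (Sum.inl (Sum.inl i))) := by
      have : (fun i => x t (Sum.inl i)) = Sum.elim (fun i => x t (Sum.inl (Sum.inl i)))
          (fun i => x t (Sum.inl (Sum.inr i))) := by ext (i | i) <;> rfl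
      rw [this]
      simp [augment]
    rw [h2] at h1
    exact h1.symm
  exact intervalIntegrable_dotProduct hT (he.ae_eq hae) (he.ae_eq hae)

/-- The dissipation inequality integrated over `[0, T]`, with the terms of the integral quadratic
constraints dropped. -/
theorem IsClosedLoop.dissipation (hG : G.Regular Ω)
    (hU : UniformCertificate G F K Ω νlo νhi γ P Xk ε c C)
    (hI : DelayIQC F Xk Ω νlo νhi τmax r) (hτ : IsDelay τmax r τ)
    (hρ : IsParamTraj Ω νlo νhi ρ ρd) (h : IsClosedLoop G F K τ ρ ρd d x u w) (hT : 0 ≤ T) :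
    x T ⬝ᵥ (P (ρ T) *ᵥ x T)
        + γ⁻¹ * (∫ t in (0 : ℝ)..T, clOutput G F K ρ ρd x w d t ⬝ᵥ clOutput G F K ρ ρd x w d t)
        + ε * ((∫ t in (0 : ℝ)..T, x t ⬝ᵥ x t + w t ⬝ᵥ w t) + ∫ t in (0 : ℝ)..T, d t ⬝ᵥ d t) ≤
      x 0 ⬝ᵥ (P (ρ 0) *ᵥ x 0) + γ * ∫ t in (0 : ℝ)..T, d t ⬝ᵥ d t := by
  obtain ⟨hs, hsi⟩ := hU.integral_storageRate hρ h hT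
  have he := h.intervalIntegrable_output hG hρ hT
  have hz := fun k => h.intervalIntegrable_iqcSupply hU hρ hT k
  have hx := intervalIntegrable_dotProduct hT (h.memLp_state T) (h.memLp_state T)
  have hw := intervalIntegrable_dotProduct hT (h.pair.w_L2 T hT) (h.pair.w_L2 T hT)
  have hd := intervalIntegrable_dotProduct hT (h.d_L2 T hT) (h.d_L2 T hT)
  have hzs : IntervalIntegrable (fun t => ∑ k, iqcSupply F Xk ρ
      (fun t i => x t (Sum.inl (Sum.inr i))) u w k t) volume 0 T := by
    have := IntervalIntegrable.sum Finset.univ fun k _ => hz k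
    convert! this using 1
    ext t
    simp only [Finset.sum_apply]
  have hpos : 0 ≤ ∫ t in (0 : ℝ)..T, ∑ k, iqcSupply F Xk ρ
      (fun t i => x t (Sum.inl (Sum.inr i))) u w k t := by
    rw [intervalIntegral.integral_finsetSum fun k _ => hz k]
    exact Finset.sum_nonneg fun k _ => hI τ ρ ρd u w _ hτ hρ h.pair h.isFilterState k T hT
  have hmono := intervalIntegral.integral_mono_ae_restrict hT
    (((hs.add (he.const_mul γ⁻¹)).add hzs).add (((hx.add hw).add hd).const_mul ε))
    (hd.const_mul γ) (by
      refine (ae_restrict_iff' measurableSet_Icc).2 ?_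
      filter_upwards [h.ae_isInput] with t ht hmem
      exact hU.storageRate_le hρ hmem.1 (ht hmem.1))
  rw [intervalIntegral.integral_add ((hs.add (he.const_mul γ⁻¹)).add hzs)
      (((hx.add hw).add hd).const_mul ε),
    intervalIntegral.integral_add (hs.add (he.const_mul γ⁻¹)) hzs,
    intervalIntegral.integral_add hs (he.const_mul γ⁻¹),
    intervalIntegral.integral_const_mul, intervalIntegral.integral_const_mul,
    intervalIntegral.integral_const_mul, intervalIntegral.integral_add (hx.add hw) hd, hsi] at hmono
  linarith

/-- Without disturbance, the growth of the storage function is controlled by `w`. -/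
theorem IsClosedLoop.storage_sub_le (hγ : 0 < γ) (hε : 0 < ε)
    (hU : UniformCertificate G F K Ω νlo νhi γ P Xk ε c C)
    (hρ : IsParamTraj Ω νlo νhi ρ ρd) (h : IsClosedLoop G F K τ ρ ρd 0 x u w) {q t : ℝ}
    (hq : 0 ≤ q) (hqt : q ≤ t) :
    x t ⬝ᵥ (P (ρ t) *ᵥ x t) - x q ⬝ᵥ (P (ρ q) *ᵥ x q) ≤ C * ∫ p in q..t, w p ⬝ᵥ w p := by
  have ht := hq.trans hqt
  obtain ⟨hs, hsi⟩ := hU.integral_storageRate hρ h ht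
  obtain ⟨hs', hsi'⟩ := hU.integral_storageRate hρ h hq
  have hw := intervalIntegrable_dotProduct ht (h.pair.w_L2 t ht) (h.pair.w_L2 t ht)
  have hsub : Set.uIcc q t ⊆ Set.uIcc 0 t := by
    rw [Set.uIcc_of_le hqt, Set.uIcc_of_le ht]
    exact Set.Icc_subset_Icc_left hq
  have e : x t ⬝ᵥ (P (ρ t) *ᵥ x t) - x q ⬝ᵥ (P (ρ q) *ᵥ x q) =
      ∫ p in q..t, storageRate G F K P ρ ρd x w 0 p := by
    rw [← intervalIntegral.integral_interval_sub_left hs hs', hsi, hsi']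
    ring
  rw [e, ← intervalIntegral.integral_const_mul]
  refine intervalIntegral.integral_mono_ae_restrict hqt (hs.mono_set hsub)
    ((hw.mono_set hsub).const_mul C) ?_
  refine (ae_restrict_iff' measurableSet_Icc).2 ?_
  filter_upwards [h.ae_isInput] with p hp hmem
  have hp0 : 0 ≤ p := hq.trans hmem.1
  have h1 := hU.storageRate_le hρ hp0 (hp hp0)
  have h2 := hU.weight _ (hρ p hp0).1 _ (hρ p hp0).2.2 (w p)
  rw [sum_mulVec, dotProduct_sum] at h2
  have h3 : -∑ k, w p ⬝ᵥ ((Xk (ρ p) k)⁻¹ *ᵥ w p) ≤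
      ∑ k, iqcSupply F Xk ρ (fun t i => x t (Sum.inl (Sum.inr i))) u w k p := by
    rw [← Finset.sum_neg_distrib]
    refine Finset.sum_le_sum fun k _ => ?_
    have := PosDef.dotProduct_nonneg (hU.Xk_pos _ (hρ p hp0).1 k).inv
      (filterOutput F k (fun i => x p (Sum.inl (Sum.inr i))) (u p) (w p))
    simp only [iqcSupply]
    linarith
  have h4 : 0 ≤ γ⁻¹ * (clOutput G F K ρ ρd x w 0 p ⬝ᵥ clOutput G F K ρ ρd x w 0 p) :=
    mul_nonneg (inv_nonneg.2 hγ.le) (zero_le_dotProduct_self _)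
  have h5 : 0 ≤ ε * (x p ⬝ᵥ x p + w p ⬝ᵥ w p) :=
    mul_nonneg hε.le (add_nonneg (zero_le_dotProduct_self _) (zero_le_dotProduct_self _))
  have h6 : (0 : ℝ → Fin nd → ℝ) p = 0 := rfl
  rw [h6, dotProduct_zero, add_zero, mul_zero] at h1
  linarith

/-- Stability: boundedness from the integrated dissipation inequality, convergence from averaging
the bound `IsClosedLoop.storage_sub_le` over the starting time. -/
theorem UniformCertificate.asympStable (hγ : 0 < γ) (hε : 0 < ε) (hc : 0 < c) (hC : 0 ≤ C)
    (hG : G.Regular Ω) (hU : UniformCertificate G F K Ω νlo νhi γ P Xk ε c C)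
    (hI : DelayIQC F Xk Ω νlo νhi τmax r) : AsympStable G F K Ω νlo νhi τmax r := by
  let N : ℝ := Fintype.card ((Fin np ⊕ Fin nψ) ⊕ (Fin np ⊕ Fin nψ))
  have hN : 0 ≤ N := Nat.cast_nonneg _
  refine ⟨Real.sqrt (C * N / c), fun τ ρ ρd x u w hτ hρ h => ?_⟩
  have hlow : ∀ t, 0 ≤ t → c * ‖x t‖ ^ 2 ≤ x t ⬝ᵥ (P (ρ t) *ᵥ x t) := fun t ht =>
    (mul_le_mul_of_nonneg_left (norm_sq_le_dotProduct _) hc.le).trans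
      (hU.lower _ (hρ t ht).1 _ (hρ t ht).2.2 _)
  have hup : ∀ t, 0 ≤ t → x t ⬝ᵥ (P (ρ t) *ᵥ x t) ≤ C * (x t ⬝ᵥ x t) := fun t ht =>
    hU.upper _ (hρ t ht).1 _ (hρ t ht).2.2 _
  have hnn : ∀ t, 0 ≤ x t ⬝ᵥ x t + w t ⬝ᵥ w t := fun t =>
    add_nonneg (zero_le_dotProduct_self _) (zero_le_dotProduct_self _)
  have hdis : ∀ t, 0 ≤ t → x t ⬝ᵥ (P (ρ t) *ᵥ x t)
      + ε * (∫ q in (0 : ℝ)..t, x q ⬝ᵥ x q + w q ⬝ᵥ w q) ≤ x 0 ⬝ᵥ (P (ρ 0) *ᵥ x 0) := by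
    intro t ht
    have h1 := h.dissipation hG hU hI hτ hρ ht
    have h2 : 0 ≤ γ⁻¹ * ∫ q in (0 : ℝ)..t, clOutput G F K ρ ρd x w 0 q ⬝ᵥ
        clOutput G F K ρ ρd x w 0 q :=
      mul_nonneg (inv_nonneg.2 hγ.le)
        (intervalIntegral.integral_nonneg ht fun q _ => zero_le_dotProduct_self _)
    simp only [Pi.zero_apply, dotProduct_zero, intervalIntegral.integral_zero, mul_zero,
      add_zero] at h1
    linarith
  constructor
  · intro t ht
    have h1 := hdis t ht
    have h2 : 0 ≤ ε * ∫ q in (0 : ℝ)..t, x q ⬝ᵥ x q + w q ⬝ᵥ w q :=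
      mul_nonneg hε.le (intervalIntegral.integral_nonneg ht fun q _ => hnn q)
    have h3 : C * (x 0 ⬝ᵥ x 0) ≤ C * (N * ‖x 0‖ ^ 2) :=
      mul_le_mul_of_nonneg_left (dotProduct_le_card_mul_norm_sq _) hC
    have h4 : ‖x t‖ ^ 2 ≤ C * N / c * ‖x 0‖ ^ 2 := by
      rw [div_mul_eq_mul_div, le_div_iff₀ hc]
      linarith [hlow t ht, hup 0 le_rfl]
    have h5 := Real.sqrt_le_sqrt h4
    rwa [Real.sqrt_sq (norm_nonneg _), Real.sqrt_mul (by positivity),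
      Real.sqrt_sq (norm_nonneg _)] at h5
  · have hxi := fun t (ht : 0 ≤ t) =>
      intervalIntegrable_dotProduct ht (h.memLp_state t) (h.memLp_state t)
    have hwi := fun t (ht : 0 ≤ t) =>
      intervalIntegrable_dotProduct ht (h.pair.w_L2 t ht) (h.pair.w_L2 t ht)
    have hlim := tendsto_integral_unit_interval hnn (fun t ht => (hxi t ht).add (hwi t ht))
      (B := x 0 ⬝ᵥ (P (ρ 0) *ᵥ x 0) / ε) fun t ht => by
        rw [le_div_iff₀ hε]
        have h1 := hdis t ht
        have h2 : 0 ≤ c * ‖x t‖ ^ 2 := by positivity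
        linarith [hlow t ht]
    have hbound : ∀ t, 1 ≤ t →
        c * ‖x t‖ ^ 2 ≤ C * ∫ q in (t - 1)..t, (x q ⬝ᵥ x q + w q ⬝ᵥ w q) := by
      intro t ht
      have ht0 : 0 ≤ t := by linarith
      have hsub : Set.uIcc (t - 1) t ⊆ Set.uIcc 0 t := by
        rw [Set.uIcc_of_le (by linarith), Set.uIcc_of_le ht0]
        exact Set.Icc_subset_Icc_left (by linarith)
      have hx1 := (hxi t ht0).mono_set hsub
      have hw1 := (hwi t ht0).mono_set hsub
      -- averaging over the starting point `q ∈ [t - 1, t]`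
      have h1 : ∀ q ∈ Set.Icc (t - 1) t, c * ‖x t‖ ^ 2 ≤
          C * (x q ⬝ᵥ x q) + C * ∫ p in (t - 1)..t, w p ⬝ᵥ w p := by
        intro q hq
        have hq0 : 0 ≤ q := by linarith [hq.1]
        have h2 := h.storage_sub_le hγ hε hU hρ hq0 hq.2
        have h3 : ∫ p in q..t, w p ⬝ᵥ w p ≤ ∫ p in (t - 1)..t, w p ⬝ᵥ w p :=
          intervalIntegral.integral_mono_interval hq.1 hq.2 le_rfl
            (Eventually.of_forall fun p => zero_le_dotProduct_self _) hw1
        have h4 := mul_le_mul_of_nonneg_left h3 hC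
        linarith [hlow t ht0, hup q hq0]
      have h5 := intervalIntegral.integral_mono_on (by linarith) intervalIntegrable_const
        ((hx1.const_mul C).add intervalIntegrable_const) h1
      rw [intervalIntegral.integral_add (hx1.const_mul C) intervalIntegrable_const,
        intervalIntegral.integral_const, intervalIntegral.integral_const,
        intervalIntegral.integral_const_mul, sub_sub_cancel, one_smul, one_smul, ← mul_add,
        ← intervalIntegral.integral_add hx1 hw1] at h5
      exact h5
    have hsq : Tendsto (fun t => ‖x t‖ ^ 2) atTop (𝓝 0) := by
      have hlim' := hlim.const_mul (C / c)
      rw [mul_zero] at hlim'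
      refine squeeze_zero' (Eventually.of_forall fun t => sq_nonneg _) ?_ hlim'
      filter_upwards [eventually_ge_atTop (1 : ℝ)] with t ht
      rw [div_mul_eq_mul_div, le_div_iff₀ hc, mul_comm]
      exact hbound t ht
    rw [tendsto_zero_iff_norm_tendsto_zero]
    have := hsq.sqrt
    simpa only [Real.sqrt_sq (norm_nonneg _), Real.sqrt_zero] using this

/-- The gain bound, with `γ'² = γ (γ - min ε γ)`; the minimum keeps the root real when `ε` exceeds
`γ`. -/
theorem UniformCertificate.l2GainLT (hγ : 0 < γ) (hε : 0 < ε) (hc : 0 < c)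
    (hG : G.Regular Ω) (hU : UniformCertificate G F K Ω νlo νhi γ P Xk ε c C)
    (hI : DelayIQC F Xk Ω νlo νhi τmax r) : L2GainLT G F K Ω νlo νhi τmax r γ := by
  have hγε : 0 ≤ γ * (γ - min ε γ) := mul_nonneg hγ.le (sub_nonneg.2 (min_le_right _ _))
  refine ⟨Real.sqrt (γ * (γ - min ε γ)), Real.sqrt_nonneg _, ?_,
    fun τ ρ ρd d x u w hτ hρ h h0 T hT => ?_⟩
  · rw [Real.sqrt_lt' hγ]
    nlinarith [lt_min hε hγ]
  · rw [Real.sq_sqrt hγε]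
    have h1 := h.dissipation hG hU hI hτ hρ hT
    have h2 : 0 ≤ x T ⬝ᵥ (P (ρ T) *ᵥ x T) :=
      (mul_nonneg hc.le (zero_le_dotProduct_self _)).trans
        (hU.lower _ (hρ T hT).1 _ (hρ T hT).2.2 _)
    have h3 : 0 ≤ ∫ t in (0 : ℝ)..T, x t ⬝ᵥ x t + w t ⬝ᵥ w t :=
      intervalIntegral.integral_nonneg hT fun t _ =>
        add_nonneg (zero_le_dotProduct_self _) (zero_le_dotProduct_self _)
    have h4 : 0 ≤ ∫ t in (0 : ℝ)..T, d t ⬝ᵥ d t :=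
      intervalIntegral.integral_nonneg hT fun t _ => zero_le_dotProduct_self _
    rw [h0, zero_dotProduct, zero_add, mul_add] at h1
    have h5 := mul_le_mul_of_nonneg_right (min_le_left ε γ) h4
    have h6 := mul_nonneg hε.le h3
    set e2 := ∫ t in (0 : ℝ)..T, clOutput G F K ρ ρd x w d t ⬝ᵥ clOutput G F K ρ ρd x w d t
    have h7 : γ⁻¹ * e2 ≤ (γ - min ε γ) * ∫ t in (0 : ℝ)..T, d t ⬝ᵥ d t := by linarith
    rw [inv_mul_le_iff₀ hγ] at h7
    linarith

end Loop

end DelayLPV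

theorem theorem2 {s np nψ nd nu ne ny L : ℕ}
    (G : Plant s np nd nu ne ny) (F : IQCFilter nψ nu L)
    (Ω : Set (Fin s → ℝ)) (νlo νhi : Fin s → ℝ) (γ : ℝ)
    (Q : Decision (Fin s) (Fin np ⊕ Fin nψ) (Fin nu) (Fin L))
    (hG : G.Regular Ω) (hγ : 0 < γ) (hQ : Feasible G F Ω νlo νhi γ Q) :
    -- Step 1 can be carried out, with continuous feedthrough matrices
    (∃ (Dh1 : (Fin s → ℝ) → Matrix (Fin nu) (Fin ny) ℝ)
       (Dh2 : (Fin s → ℝ) → Matrix (Fin nu) (Fin nu) ℝ),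
      ContinuousOn Dh1 Ω ∧ ContinuousOn Dh2 Ω ∧ Step1 G F Ω γ Q Dh1 Dh2) ∧
    -- after every choice in Step 1, the equations of Step 2 are uniquely solvable
    (∀ Dh1 Dh2, Step1 G F Ω γ Q Dh1 Dh2 → ∀ ρ ∈ Ω,
      (∃! B : Matrix (Fin np ⊕ Fin nψ) (Fin ny) ℝ × Matrix (Fin np ⊕ Fin nψ) (Fin nu) ℝ,
        EqB (augment G F ρ) γ (Q.S ρ) (Q.X ρ) (Q.Xk ρ) (Dh1 ρ) (Dh2 ρ) B.1 B.2) ∧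
      (∃! C : Matrix (Fin nu) (Fin np ⊕ Fin nψ) ℝ,
        EqC (augment G F ρ) γ (Q.R ρ) (Q.X ρ) (Q.Xk ρ) (Dh1 ρ) (Dh2 ρ) C)) ∧
    -- factors `M`, `N` exist, and the matrices inverted in Step 4 are nonsingular
    (∃ M N, IsFactor Ω Q.R Q.S M N) ∧
    (∀ M N, IsFactor Ω Q.R Q.S M N → ∀ ρ ∈ Ω,
      IsUnit (leftT (augment G F ρ) (Q.S ρ) (N ρ)) ∧
      IsUnit (rightT (augment G F ρ) (Q.R ρ) (M ρ) (Q.X ρ))) ∧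
    -- hence every choice in Step 1 and of the factors leads to a controller
    (∀ Dh1 Dh2 M N, Step1 G F Ω γ Q Dh1 Dh2 → IsFactor Ω Q.R Q.S M N →
      ∃ h K : LPVGains (Fin s) (Fin np ⊕ Fin nψ) (Fin nu) (Fin ny),
        h.D1 = Dh1 ∧ h.D2 = Dh2 ∧ Reconstructs G F Ω νlo νhi γ Q M N h K) ∧
    -- every controller so obtained certifies the closed loop
    (∀ (M N : (Fin s → ℝ) → Matrix (Fin np ⊕ Fin nψ) (Fin np ⊕ Fin nψ) ℝ)
       (h K : LPVGains (Fin s) (Fin np ⊕ Fin nψ) (Fin nu) (Fin ny)),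
      Reconstructs G F Ω νlo νhi γ Q M N h K →
      (∀ ρ ∈ Ω, ∀ ν ∈ RateBox νlo νhi,
        (lyap (Q.R ρ) (Q.S ρ) (M ρ) (N ρ)).PosDef ∧
        (-clLMI (augment G F ρ) (K.eval ρ ν) γ (lyap (Q.R ρ) (Q.S ρ) (M ρ) (N ρ))
          (dirDeriv (fun q => lyap (Q.R q) (Q.S q) (M q) (N q)) ρ ν)
          (Q.X ρ) (Q.Xk ρ)).PosDef ∧
        (-clDissip (augment G F ρ) (K.eval ρ ν) γ (lyap (Q.R ρ) (Q.S ρ) (M ρ) (N ρ))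
          (dirDeriv (fun q => lyap (Q.R q) (Q.S q) (M q) (N q)) ρ ν) (Q.Xk ρ)).PosDef) ∧
      -- and is stabilizing with `L₂` gain less than `γ`, if the delay operator satisfies its
      -- integral quadratic constraints (`Ω₀ = Ω` if `Ω` is compact)
      (ContinuousOn h.D1 Ω → ContinuousOn h.D2 Ω →
        ∀ τmax r : ℝ, DelayIQC F Q.Xk Ω νlo νhi τmax r →
        ∀ Ω₀ : Set (Fin s → ℝ), IsCompact Ω₀ → Ω₀ ⊆ Ω →
          AsympStable G F K Ω₀ νlo νhi τmax r ∧ L2GainLT G F K Ω₀ νlo νhi τmax r γ)) := by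
  refine ⟨hQ.exists_continuous_step1 hG,
    fun Dh1 Dh2 h1 ρ hρ => ⟨h1.existsUnique_B hG hρ, h1.existsUnique_C hG hρ⟩,
    exists_isFactor Q.R Q.S,
    fun M N hf ρ hρ => ⟨isUnit_leftT (hf.isUnit hQ hρ).2,
      isUnit_rightT (hf.isUnit hQ hρ).1 (hQ.isUnit_X hG hρ)⟩,
    fun Dh1 Dh2 M N h1 hf => h1.exists_reconstructs hG hQ hf,
    fun M N h K hK => ⟨fun ρ hρ ν hν => hK.certificate hγ hQ hρ hν,
      fun hD1 hD2 τmax r hI Ω₀ hc hsub => ?_⟩⟩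
  obtain ⟨ε, c, C, hε, hc0, hC, hU⟩ := hK.exists_uniformCertificate hG hγ hQ hD1 hD2 hc hsub
  exact ⟨hU.asympStable hγ hε hc0 hC (hG.mono hsub) (hI.mono hsub),
    hU.l2GainLT hγ hε hc0 (hG.mono hsub) (hI.mono hsub)⟩
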